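/- \textbf{Model.} There are $n$ nodes with pairwise distinct IDs of $w=O(\log n)$ bits. Every node runs the same local program, knows $n$, $w$ and its own ID, and has private random bits; initially it knows no other ID. Time proceeds in synchronous rounds. In each round a node initiates at most one communication: it contacts either a uniformly random node or a node whose ID it knows (direct addressing), and it either PUSHes a message to that node or PULLs a message from it. A message consists of IDs known to the sender ($w$ bits each) and further data bits, plus one header bit; a PULL costs a request message without content and, if there is an answer, the answer message. All random choices are independent. A rumor of $b$ bits is initially known to some nodes (the sources), and a node is informed if it outputs the rumor at the end. Failed nodes crash before the first round: they send nothing, and communication directed to them is lost. \textbf{Theorem.} For every $C\in\mathbb N$ and every $\gamma\in[0,1)$ there is a randomized gossip algorithm in the random phone call model with direct addressing such that, whenever $w=O(\log n)$ and $b=\Omega(\log n)$, the following holds for all sufficiently large $n$ and every assignment of the IDs, where the constants in $O(\cdot)$ may depend only on $C$, $\gamma$ and the constants in $w=O(\log n)$ and $b=\Omega(\log n)$. The algorithm does not depend on $b$ and stops after $O(\log\log n)$ rounds. (i) If no node fails, then for every non-empty set of sources and every rumor, with probability at least $1-n^{-C}$ all nodes are informed, at most $O(n)$ messages are sent in total (that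 is, $O(1)$ per node on average), and these have $O(nb)$ bits in total. (ii) (Fault tolerance.) There is a sequence $\varepsilon_n\to0$, which may depend only on the same parameters as the constants, such that for every set of $F\le\gamma n$ failed nodes, fixed independently of the algorithm's randomness, with probability at least $1-n^{-C}$ the following holds. There is a set of surviving nodes (a cluster), containing all but at most $\varepsilon_nF=o(F)$ of the surviving nodes, together with a leader in it, such that for every set of sources and every rumor (the cluster and leader being the same for all of them): at the end the surviving nodes that know the leader's ID and follow it are exactly those of the cluster; if at least one source lies in the cluster, then all nodes of the cluster are informed; and at most $O(n)$ messages with $O(nb)$ bits in total are sent. -/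

import Mathlib

open Filter Topology

namespace Gossip

/-- A message between nodes whose addresses (IDs) are `w`-bit strings: a list of IDs together with
arbitrary further data bits. -/
structure Message (w : ℕ) where
  ids : List (BitVec w)
  data : List Bool

/-- The number of bits of a message. One bit is charged on top of the content, so that no message,
not even an empty one, is free. -/
def Message.size {w : ℕ} (m : Message w) : ℕ := 1 + m.ids.length * w + m.data.length

/-- The request that opens a PULL: a message without content. -/
def Message.request (w : ℕ) : Message w := ⟨[], []⟩

/-- Only IDs that the sender knows can be put into a message; any others are removed. -/
def Message.restrict {w : ℕ} (m : Message w) (known : Finset (BitVec w)) : Message w :=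
  ⟨m.ids.filter (fun a => decide (a ∈ known)), m.data⟩

/-- The partner that a node asks for: a uniformly random node, or (direct addressing) the node with
a given ID. -/
inductive Target (w : ℕ) where
  | random : Target w
  | address (a : BitVec w) : Target w

/-- In a round a node initiates at most one communication: it PUSHes a message or it PULLs. -/
inductive Action (w : ℕ) where
  | idle : Action w
  | push (t : Target w) (m : Message w) : Action w
  | pull (t : Target w) : Action w

/-- A randomized gossip algorithm: the local program that every node runs. The nodes are anonymous
up to their IDs, and a node decides on the basis of its own local state only. -/
structure Algorithm (w : ℕ) where
  /-- local states -/
  State : Type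
  /-- number of private random bits of a node -/
  coins : ℕ
  /-- number of rounds after which the algorithm stops -/
  rounds : ℕ
  /-- the initial state, from the node's own ID, its private random bits, and the rumor
  (`none` for a node that does not have the rumor initially) -/
  start : BitVec w → (Fin coins → Bool) → Option (List Bool) → State
  /-- the communication that a node initiates in the current round -/
  action : State → Action w
  /-- the answer that a node gives in the current round to the nodes that PULL from it, if any -/
  reply : State → Option (Message w)
  /-- the new state, from the messages PUSHed to the node in this round and the answer to its own
  PULL (`none` if it did not PULL or got no answer) -/
  update : State → Multiset (Message w) → Option (Message w) → State
  /-- the ID of the leader of the cluster to which the node belongs, `none` if unclustered -/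
  follow : State → Option (BitVec w)
  /-- the rumor that the node outputs, if any -/
  output : State → Option (List Bool)

/-- A complete network on `n` nodes with distinct `w`-bit IDs, in which the nodes of `failed` have
crashed before the first round. -/
structure Network (n w : ℕ) where
  id : Fin n ↪ BitVec w
  failed : Finset (Fin n)

/-- A node during an execution: its local state, and the set of IDs that it knows. -/
structure Node {w : ℕ} (A : Algorithm w) where
  state : A.State
  known : Finset (BitVec w)

section Execution

variable {n w : ℕ} (N : Network n w) (A : Algorithm w)

/-- The node that is actually contacted, for a caller that knows the IDs in `known` and whose
random contact in this round is `r`. Only a known ID can be addressed. -/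
def resolve (known : Finset (BitVec w)) (r : Fin n) : Target w → Option (Fin n)
  | .random => some r
  | .address a =>
    if a ∈ known then (List.finRange n).find? (fun u => decide (N.id u = a)) else none

/-- The PUSH performed by node `v` (receiver and message), if it performs one. Here `c` gives the
nodes at the beginning of the round and `r` the random contacts of the round. -/
def pushOf (c : Fin n → Node A) (r : Fin n → Fin n) (v : Fin n) : Option (Fin n × Message w) :=
  if v ∈ N.failed then none else
    match A.action (c v).state with
    | .push t m => (resolve N (c v).known (r v) t).map (fun u => (u, m.restrict (c v).known))
    | _ => none

/-- The node from which node `v` PULLs, if it does. -/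
def pullOf (c : Fin n → Node A) (r : Fin n → Fin n) (v : Fin n) : Option (Fin n) :=
  if v ∈ N.failed then none else
    match A.action (c v).state with
    | .pull t => resolve N (c v).known (r v) t
    | _ => none

/-- The answer of node `u` to every PULL that reaches it in the round, if it answers. -/
def replyOf (c : Fin n → Node A) (u : Fin n) : Option (Message w) :=
  if u ∈ N.failed then none else (A.reply (c u).state).map (fun m => m.restrict (c u).known)

/-- The messages PUSHed to node `u` in the round. -/
def inbox (c : Fin n → Node A) (r : Fin n → Fin n) (u : Fin n) : Multiset (Message w) :=
  (Finset.univ : Finset (Fin n)).val.filterMap fun v =>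
    (pushOf N A c r v).bind fun p => if p.1 = u then some p.2 else none

/-- The answer that node `v` gets to its PULL in the round, if any. -/
def response (c : Fin n → Node A) (r : Fin n → Fin n) (v : Fin n) : Option (Message w) :=
  (pullOf N A c r v).bind (replyOf N A c)

/-- All messages exchanged in the communication initiated by node `v`: the PUSHed message, or the
PULL request and the answer to it. -/
def traffic (c : Fin n → Node A) (r : Fin n → Fin n) (v : Fin n) : List (Message w) :=
  (pushOf N A c r v).toList.map Prod.snd ++
    (pullOf N A c r v).toList.map (fun _ => Message.request w) ++ (response N A c r v).toList

/-- One synchronous round. -/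
def step (c : Fin n → Node A) (r : Fin n → Fin n) : Fin n → Node A := fun v =>
  if v ∈ N.failed then c v else
    { state := A.update (c v).state (inbox N A c r v) (response N A c r v)
      known := (c v).known ∪
        ((inbox N A c r v + Multiset.ofList (response N A c r v).toList).bind
          (fun m => Multiset.ofList m.ids)).toFinset }

/-- The randomness of an execution: the private random bits of every node, and for every round and
every node the node that it reaches in this round if it asks for a random partner. -/
abbrev Outcome (n : ℕ) {w : ℕ} (A : Algorithm w) : Type :=
  (Fin n → Fin A.coins → Bool) × (Fin A.rounds → Fin n → Fin n)

/-- The random contacts of round `t` (the value is irrelevant from round `A.rounds` on). -/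
def contacts {A : Algorithm w} (ω : Outcome n A) (t : ℕ) : Fin n → Fin n :=
  if h : t < A.rounds then ω.2 ⟨t, h⟩ else fun v => v

variable (sources : Finset (Fin n)) (rumor : List Bool) (ω : Outcome n A)

/-- The nodes after `t` rounds, if exactly the nodes in `sources` have the rumor initially.
Initially every node knows its own ID and no other. -/
def run : ℕ → Fin n → Node A
  | 0 => fun v =>
    { state := A.start (N.id v) (ω.1 v) (if v ∈ sources then some rumor else none)
      known := {N.id v} }
  | t + 1 => step N A (run t) (contacts ω t)

/-- The total number of messages sent. -/
def messageCount : ℕ :=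
  ∑ t ∈ Finset.range A.rounds, ∑ v : Fin n,
    (traffic N A (run N A sources rumor ω t) (contacts ω t) v).length

/-- The total number of bits sent in all messages. -/
def bitCount : ℕ :=
  ∑ t ∈ Finset.range A.rounds, ∑ v : Fin n,
    ((traffic N A (run N A sources rumor ω t) (contacts ω t) v).map Message.size).sum

/-- Node `v` has learned the rumor when the algorithm stops. -/
def Informed (v : Fin n) : Prop :=
  A.output (run N A sources rumor ω A.rounds v).state = some rumor

/-- Node `v` belongs to the cluster of leader `l` when the algorithm stops: it knows the ID of `l`
and follows it. -/
def Follows (l v : Fin n) : Prop :=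
  A.follow (run N A sources rumor ω A.rounds v).state = some (N.id l) ∧
    N.id l ∈ (run N A sources rumor ω A.rounds v).known

end Execution

/-- The probability of an event when all private random bits and all random contacts are uniform
and independent. -/
noncomputable def prob {n w : ℕ} {A : Algorithm w} (E : Set (Outcome n A)) : ℝ :=
  (E.ncard : ℝ) / (Fintype.card (Outcome n A) : ℝ)

/-- At most `K * n` messages are sent in total, of at most `K * n * b` bits altogether, where `b`
is the length of the rumor. -/
def Efficient {n w : ℕ} (N : Network n w) (A : Algorithm w) (K : ℝ) (sources : Finset (Fin n))
    (rumor : List Bool) (ω : Outcome n A) : Prop :=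
  (messageCount N A sources rumor ω : ℝ) ≤ K * n ∧
    (bitCount N A sources rumor ω : ℝ) ≤ K * n * rumor.length

/-- Without failures, for every non-empty set of sources and every rumor of at least `minLength`
bits, all nodes learn the rumor at the stated cost, except with probability `δ`. -/
def Broadcasts {n w : ℕ} (id : Fin n ↪ BitVec w) (A : Algorithm w) (K minLength δ : ℝ) : Prop :=
  ∀ (sources : Finset (Fin n)) (rumor : List Bool), sources.Nonempty →
    minLength ≤ rumor.length →
    1 - δ ≤ prob {ω : Outcome n A |
      (∀ v, Informed ⟨id, ∅⟩ A sources rumor ω v) ∧ Efficient ⟨id, ∅⟩ A K sources rumor ω}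

/-- For every set `failed` of at most `γ * n` nodes that crash at the beginning, chosen
independently of the randomness, the following holds except with probability `δ`: there is one
cluster, with a surviving leader, of all but at most `ε * |failed|` surviving nodes, which does not
depend on the rumor or on who has it, and all nodes of this cluster learn the rumor if any of them
has it initially; the cost is as stated. -/
def FaultTolerant {n w : ℕ} (id : Fin n ↪ BitVec w) (A : Algorithm w)
    (K minLength δ γ ε : ℝ) : Prop :=
  ∀ failed : Finset (Fin n), (failed.card : ℝ) ≤ γ * n →
    1 - δ ≤ prob {ω : Outcome n A |
      ∃ (cluster : Finset (Fin n)) (leader : Fin n),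
        leader ∈ cluster ∧ Disjoint cluster failed ∧
        ((failedᶜ \ cluster).card : ℝ) ≤ ε * failed.card ∧
        ∀ (sources : Finset (Fin n)) (rumor : List Bool), minLength ≤ rumor.length →
          (∀ v, v ∉ failed → (v ∈ cluster ↔ Follows ⟨id, failed⟩ A sources rumor ω leader v)) ∧
          ((∃ s ∈ sources, s ∈ cluster) →
            ∀ v ∈ cluster, Informed ⟨id, failed⟩ A sources rumor ω v) ∧
          Efficient ⟨id, failed⟩ A K sources rumor ω}

end Gossip

/-! Nodes that share a leader can exchange information in two rounds, one communication per member
each time: everybody PUSHes to the leader, then everybody PULLs its answer. So it suffices to gather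
almost all survivors in one cluster within `O(log log n)` rounds and `O(n)` communications; any
rumor is then spread by one PUSH and one PULL per member. Write `ℓ` for the rounded value of `log₂
log₂ n`, so that `2 ^ ℓ` is of order `log n`.

Doubling alone would take about `log n` phases; the gain comes from merging. Nodes elect themselves
with probability `2 ^ (-102 ℓ)` and their clusters double by invitations up to size `2 ^ (100 ℓ)`.
Only a fraction of about `4 ^ (-ℓ)` of the nodes is then clustered, so the next `O(ℓ)` operations
are cheap. Clusters of size `k` are activated with probability about `k ^ (-1/2)`. An inactive
cluster sends `k` PULLs at once, hits an active cluster with probability at least `1/2`, and joins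
it. Each active cluster absorbs about `√k` others, so the size goes from `k` to `k ^ (3/2)`, and
`O(ℓ)` merges reach `n ^ (3/5)`. Then any two clusters hit each other, as in the birthday paradox,
and all join the smallest leader. The resulting cluster of size `n / polylog n` doubles `O(ℓ)` times
up to linear size, and the remaining nodes PULL until they hit it.

Truncation keeps all clusters at exactly the same size, so all active clusters are equally likely
targets: `le_pr_selects`, `inv_le_pr_selects` and `hoare_merge`. Doubling rests on the counting
argument `stuck_spec`, `pr_stuck_le`, which leads to `hoare_grow`. Failed nodes only waste contacts.
In the final phase `m` outsiders become about `m (F + m) / n`: the decay is quadratic until `m` is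
below `F`, and one further round gives `o(F)`; if `F` is at most polylogarithmic, a first-moment
bound removes every outsider (`hoare_joins`).

Random events are tied to disjoint sets of coordinates, so elementary exponential-moment bounds
apply, mostly with error `exp (-4 ^ ℓ)`, which is superpolynomially small. `Rep` and `simulate`
replace executions by the abstract dynamics `absStep`, `Hoare` adds up the errors of successive
operations, and `hoare_program` puts the phases together. The clustering never looks at the rumor,
so one cluster serves all sources and rumors (`share_run`). -/

namespace Gossip

/-! ### Averages over finite types -/

open scoped Classical in
/-- The mean of a real function on a finite type. -/
noncomputable def avg {α : Type*} [Fintype α] (f : α → ℝ) : ℝ := (∑ a, f a) / Fintype.card α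

open scoped Classical in
/-- The indicator of a proposition. -/
noncomputable def ind (P : Prop) : ℝ := if P then 1 else 0

/-- The probability of an event under the uniform distribution. -/
noncomputable def pr {α : Type*} [Fintype α] (P : α → Prop) : ℝ := avg fun a => ind (P a)

theorem ind_true {P : Prop} (h : P) : ind P = 1 := by simp [ind, h]
theorem ind_false {P : Prop} (h : ¬ P) : ind P = 0 := by simp [ind, h]
theorem ind_nonneg (P : Prop) : 0 ≤ ind P := by unfold ind; split_ifs <;> norm_num
theorem ind_le_one (P : Prop) : ind P ≤ 1 := by unfold ind; split_ifs <;> norm_num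
theorem ind_not (P : Prop) : ind (¬ P) = 1 - ind P := by
  by_cases h : P <;> simp [ind, h]
theorem ind_mono {P Q : Prop} (h : P → Q) : ind P ≤ ind Q := by
  by_cases hP : P
  · rw [ind_true hP, ind_true (h hP)]
  · rw [ind_false hP]; exact ind_nonneg Q

section Avg

variable {α β : Type*} [Fintype α] [Fintype β]

theorem avg_mono {f g : α → ℝ} (h : ∀ a, f a ≤ g a) : avg f ≤ avg g :=
  div_le_div_of_nonneg_right (Finset.sum_le_sum fun a _ => h a) (Nat.cast_nonneg _)

theorem avg_nonneg {f : α → ℝ} (h : ∀ a, 0 ≤ f a) : 0 ≤ avg f :=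
  div_nonneg (Finset.sum_nonneg fun a _ => h a) (Nat.cast_nonneg _)

theorem avg_const [Nonempty α] (c : ℝ) : avg (fun _ : α => c) = c := by
  have : (Fintype.card α : ℝ) ≠ 0 := by exact_mod_cast Fintype.card_ne_zero
  simp [avg, this]

theorem avg_add (f g : α → ℝ) : avg (fun a => f a + g a) = avg f + avg g := by
  simp [avg, Finset.sum_add_distrib, add_div]

theorem avg_sub (f g : α → ℝ) : avg (fun a => f a - g a) = avg f - avg g := by
  simp [avg, Finset.sum_sub_distrib, sub_div]

theorem avg_mul_left (c : ℝ) (f : α → ℝ) : avg (fun a => c * f a) = c * avg f := by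
  simp [avg, ← Finset.mul_sum, mul_div_assoc]

theorem avg_sum {κ : Type*} (s : Finset κ) (f : κ → α → ℝ) :
    avg (fun a => ∑ k ∈ s, f k a) = ∑ k ∈ s, avg (f k) := by
  simp only [avg]
  rw [Finset.sum_comm, Finset.sum_div]

theorem avg_prod (f : α × β → ℝ) : avg f = avg fun a => avg fun b => f (a, b) := by
  simp only [avg, Fintype.sum_prod_type, Fintype.card_prod, Nat.cast_mul, ← Finset.sum_div]
  rw [div_div, mul_comm]

theorem avg_equiv (e : α ≃ β) (f : β → ℝ) : avg (fun a => f (e a)) = avg f := by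
  simp only [avg, Equiv.sum_comp e f, Fintype.card_congr e]

theorem avg_comm (f : α → β → ℝ) : avg (fun a => avg fun b => f a b) = avg fun b => avg fun a => f a b := by
  rw [← avg_prod (fun x : α × β => f x.1 x.2), ← avg_prod (fun x : β × α => f x.2 x.1)]
  exact avg_equiv (Equiv.prodComm α β) (fun x : β × α => f x.2 x.1)

theorem pr_nonneg (P : α → Prop) : 0 ≤ pr P := avg_nonneg fun _ => ind_nonneg _

theorem pr_mono {P Q : α → Prop} (h : ∀ a, P a → Q a) : pr P ≤ pr Q :=
  avg_mono fun a => ind_mono (h a)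

theorem pr_le_one [Nonempty α] (P : α → Prop) : pr P ≤ 1 :=
  (avg_mono fun a => ind_le_one (P a)).trans (avg_const 1).le

theorem pr_not [Nonempty α] (P : α → Prop) : pr (fun a => ¬ P a) = 1 - pr P := by
  simp only [pr, ind_not, avg_sub, avg_const]

theorem pr_or_le (P Q : α → Prop) : pr (fun a => P a ∨ Q a) ≤ pr P + pr Q := by
  rw [pr, pr, pr, ← avg_add]
  refine avg_mono fun a => ?_
  by_cases h : P a
  · rw [ind_true (Or.inl h), ind_true h]; linarith [ind_nonneg (Q a)]
  · refine (ind_mono (Q := Q a) (fun h' => h'.resolve_left h)).trans ?_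
    linarith [ind_nonneg (P a)]

theorem pr_exists_le {κ : Type*} (s : Finset κ) (P : κ → α → Prop) :
    pr (fun a => ∃ k ∈ s, P k a) ≤ ∑ k ∈ s, pr (P k) := by
  simp only [pr]
  rw [← avg_sum]
  refine avg_mono fun a => ?_
  by_cases h : ∃ k ∈ s, P k a
  · obtain ⟨k, hk, hp⟩ := h
    rw [ind_true ⟨k, hk, hp⟩, ← ind_true hp]
    exact Finset.single_le_sum (f := fun k => ind (P k a)) (fun i _ => ind_nonneg _) hk
  · rw [ind_false h]; exact Finset.sum_nonneg fun _ _ => ind_nonneg _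

theorem pr_exists_le_card_mul {κ : Type*} (s : Finset κ) (P : κ → α → Prop) {c : ℝ}
    (h : ∀ k ∈ s, pr (P k) ≤ c) : pr (fun a => ∃ k ∈ s, P k a) ≤ s.card * c := by
  refine (pr_exists_le s P).trans ((Finset.sum_le_sum h).trans ?_)
  simp

theorem pr_eq_ncard (P : α → Prop) : pr P = ({a | P a}.ncard : ℝ) / Fintype.card α := by
  classical
  have : {a | P a}.ncard = ∑ a, if P a then 1 else 0 := by
    rw [Set.ncard_eq_toFinset_card', Finset.card_eq_sum_ones, ← Finset.sum_filter]
    exact Finset.sum_congr (by ext; simp) fun _ _ => rfl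
  simp only [pr, avg, this, Nat.cast_sum]
  refine congrArg (· / _) (Finset.sum_congr rfl fun a _ => ?_)
  by_cases h : P a <;> simp [ind, h]

theorem markov {f : α → ℝ} (hf : ∀ a, 0 ≤ f a) {c : ℝ} (hc : 0 < c) {P : α → Prop}
    (h : ∀ a, P a → c ≤ f a) : pr P ≤ avg f / c := by
  rw [le_div_iff₀ hc, mul_comm, pr, ← avg_mul_left]
  refine avg_mono fun a => ?_
  by_cases hp : P a
  · rw [ind_true hp, mul_one]; exact h a hp
  · rw [ind_false hp, mul_zero]; exact hf a

end Avg

/-! ### Independence -/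

section Indep

variable {ι α : Type*} [Fintype ι] [DecidableEq ι] [Fintype α] [Nonempty α]

/-- Splitting the coordinates into those in `S` and the others makes `f` a function of one factor
and `g` a function of the other, so the double average factorises. -/
theorem avg_mul_of_dependsOn {S : Set ι} {f g : (ι → α) → ℝ} (hf : DependsOn f S)
    (hg : DependsOn g Sᶜ) : avg (fun x => f x * g x) = avg f * avg g := by
  classical
  let e := Equiv.piEquivPiSubtypeProd (· ∈ S) (fun _ : ι => α)
  have hz : Nonempty ({i // ¬ i ∈ S} → α) := inferInstance
  have hy : Nonempty ({i // i ∈ S} → α) := inferInstance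
  obtain ⟨y0⟩ := hy
  obtain ⟨z0⟩ := hz
  have hf' : ∀ y z, f (e.symm (y, z)) = f (e.symm (y, z0)) := by
    intro y z
    refine hf fun i hi => ?_
    simp [e, Equiv.piEquivPiSubtypeProd, hi]
  have hg' : ∀ y z, g (e.symm (y, z)) = g (e.symm (y0, z)) := by
    intro y z
    refine hg fun i hi => ?_
    have : i ∉ S := hi
    simp [e, Equiv.piEquivPiSubtypeProd, this]
  have h1 := fun F : (ι → α) → ℝ => (avg_equiv e.symm F).symm.trans (avg_prod (fun a => F (e.symm a)))
  rw [h1 f, h1 g, h1]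
  simp only [hf', hg', avg_const, avg_mul_left]
  simp only [mul_comm (f _), avg_mul_left]
  rw [mul_comm]

theorem avg_prod_of_dependsOn {κ : Type*} (T : Finset κ) (S : κ → Set ι)
    (hS : (T : Set κ).PairwiseDisjoint S) (f : κ → (ι → α) → ℝ)
    (hf : ∀ k ∈ T, DependsOn (f k) (S k)) :
    avg (fun x => ∏ k ∈ T, f k x) = ∏ k ∈ T, avg (f k) := by
  classical
  induction T using Finset.induction_on with
  | empty => simpa using avg_const (α := ι → α) 1
  | insert a T ha ih =>
    simp only [Finset.prod_insert ha]
    rw [avg_mul_of_dependsOn (S := S a), ih]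
    · exact hS.subset (by simp)
    · exact fun k hk => hf k (Finset.mem_insert_of_mem hk)
    · exact hf a (Finset.mem_insert_self _ _)
    · intro x y hxy
      refine Finset.prod_congr rfl fun k hk => hf k (Finset.mem_insert_of_mem hk) fun i hi => ?_
      refine hxy i fun hia => ?_
      have hne : k ≠ a := fun h => ha (h ▸ hk)
      exact Set.disjoint_left.1
        (hS (Finset.mem_coe.2 (Finset.mem_insert_of_mem hk)) (by simp) hne) hi hia

theorem avg_apply (i : ι) (f : α → ℝ) : avg (fun x : ι → α => f (x i)) = avg f := by
  rw [← avg_equiv (Equiv.funSplitAt i α).symm, avg_prod]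
  simp [Equiv.funSplitAt, Equiv.piSplitAt, avg_const]

theorem avg_prod_apply (T : Finset ι) (f : ι → α → ℝ) :
    avg (fun x : ι → α => ∏ i ∈ T, f i (x i)) = ∏ i ∈ T, avg (f i) := by
  rw [avg_prod_of_dependsOn T (fun i => {i}) _ (fun i x => f i (x i))]
  · exact Finset.prod_congr rfl fun i _ => avg_apply i (f i)
  · intro i _ x y h
    simp [h i rfl]
  · intro i _ j _ hij
    simpa [Function.onFun] using hij

/-- If every coordinate in `W` has to hit a target that is determined by the other coordinates and
has probability at most `ρ`, then all of them succeed with probability at most `ρ ^ #W`. -/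
theorem pr_forall_le_pow (W : Finset ι) (G : (ι → α) → α → Prop)
    (hG : ∀ a, DependsOn (fun x => G x a) (W : Set ι)ᶜ) {ρ : ℝ} (hρ : ∀ x, pr (G x) ≤ ρ) :
    pr (fun x => ∀ j ∈ W, G x (x j)) ≤ ρ ^ W.card := by
  classical
  let e := Equiv.piEquivPiSubtypeProd (· ∈ W) (fun _ : ι => α)
  have hy : Nonempty ({i // i ∈ W} → α) := inferInstance
  obtain ⟨y0⟩ := hy
  have hG' : ∀ y z a, G (e.symm (y, z)) a = G (e.symm (y0, z)) a := by
    intro y z a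
    refine hG a fun i hi => ?_
    have : i ∉ W := by simpa using hi
    simp [e, Equiv.piEquivPiSubtypeProd, this]
  -- The coordinates outside `W` are frozen first: they determine the target, and the coordinates in
  -- `W` remain independent.
  rw [pr, ← avg_equiv e.symm, avg_prod, avg_comm]
  refine (avg_mono fun z => ?_).trans (avg_const (ρ ^ W.card)).le
  have h : ∀ y, ind (∀ j ∈ W, G (e.symm (y, z)) (e.symm (y, z) j))
      = ∏ j : {i // i ∈ W}, ind (G (e.symm (y0, z)) (y j)) := by
    intro y
    by_cases hh : ∀ j ∈ W, G (e.symm (y, z)) (e.symm (y, z) j)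
    · rw [ind_true hh, Finset.prod_eq_one]
      intro j _
      have := hh j j.2
      rw [hG'] at this
      refine ind_true ?_
      simpa [e, Equiv.piEquivPiSubtypeProd] using this
    · rw [ind_false hh]
      push Not at hh
      obtain ⟨j, hj, hn⟩ := hh
      rw [Finset.prod_eq_zero (i := ⟨j, hj⟩) (Finset.mem_univ _)]
      refine ind_false fun h => hn ?_
      rw [hG']
      simpa [e, Equiv.piEquivPiSubtypeProd, hj] using h
  simp only [h]
  rw [avg_prod_apply Finset.univ (fun _ a => ind (G (e.symm (y0, z)) a))]
  refine (Finset.prod_le_prod (fun _ _ => pr_nonneg _) fun _ _ => hρ _).trans ?_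
  simp

section Tails

variable {κ : Type*} (T : Finset κ) (S : κ → Set ι) (P : κ → (ι → α) → Prop)

open scoped Classical in
/-- The moment generating function of a number of independent events. -/
theorem avg_exp_card {θ : ℝ} (hS : (T : Set κ).PairwiseDisjoint S)
    (hP : ∀ k ∈ T, DependsOn (P k) (S k)) :
    avg (fun x => Real.exp (θ * (T.filter fun k => P k x).card))
      = ∏ k ∈ T, (1 + pr (P k) * (Real.exp θ - 1)) := by
  have h : ∀ x, Real.exp (θ * (T.filter fun k => P k x).card)
      = ∏ k ∈ T, (1 + ind (P k x) * (Real.exp θ - 1)) := by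
    intro x
    have : ∀ k ∈ T, 1 + ind (P k x) * (Real.exp θ - 1) = if P k x then Real.exp θ else 1 := by
      intro k _
      by_cases hk : P k x <;> simp [ind, hk]
    rw [Finset.prod_congr rfl this, Finset.prod_ite, Finset.prod_const, Finset.prod_const_one,
      mul_one, ← Real.exp_nat_mul, mul_comm]
  simp only [h]
  rw [avg_prod_of_dependsOn T S hS]
  · refine Finset.prod_congr rfl fun k _ => ?_
    rw [avg_add, avg_const]
    simp only [mul_comm (ind _), avg_mul_left]
    rw [pr, mul_comm]
  · intro k hk x y hxy
    simp only [hP k hk hxy]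

open scoped Classical in
/-- Lower tail: independent events of probability at least `p`. -/
theorem lower_tail {p : ℝ} (hp0 : 0 ≤ p) (hS : (T : Set κ).PairwiseDisjoint S)
    (hP : ∀ k ∈ T, DependsOn (P k) (S k)) (hp : ∀ k ∈ T, p ≤ pr (P k)) :
    pr (fun x => ((T.filter fun k => P k x).card : ℝ) < T.card * p / 4)
      ≤ Real.exp (-(T.card * p / 4)) := by
  -- Exponential moments at the fixed parameter `-1`: each factor is at most `1 - p / 2`, and
  -- Markov's inequality at the level `T.card * p / 4` uses up half of the exponent.
  have h1 := avg_exp_card T S P (θ := -1) hS hP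
  have he : Real.exp (-1) ≤ 1 / 2 := by
    rw [Real.exp_neg, one_div]
    refine inv_anti₀ (by norm_num) ?_
    have := Real.add_one_le_exp (1 : ℝ)
    linarith
  have h2 : ∏ k ∈ T, (1 + pr (P k) * (Real.exp (-1) - 1)) ≤ Real.exp (-(T.card * p / 2)) := by
    have : Real.exp (-(T.card * p / 2)) = ∏ _k ∈ T, Real.exp (-(p / 2)) := by
      rw [Finset.prod_const, ← Real.exp_nat_mul]; congr 1; ring
    rw [this]
    refine Finset.prod_le_prod (fun k _ => ?_) fun k hk => ?_
    · have a1 := pr_le_one (P k); have a2 := pr_nonneg (P k)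
      have a3 := Real.exp_pos (-1)
      nlinarith
    · have := Real.add_one_le_exp (-(p / 2))
      have a1 := hp k hk
      nlinarith
  refine (markov (f := fun x => Real.exp (-1 * (T.filter fun k => P k x).card))
    (fun _ => (Real.exp_pos _).le) (Real.exp_pos (-(T.card * p / 4))) fun x hx => ?_).trans ?_
  · refine Real.exp_le_exp.2 ?_
    linarith
  · rw [h1, div_le_iff₀ (Real.exp_pos _), ← Real.exp_add]
    refine h2.trans (Real.exp_le_exp.2 ?_)
    linarith

open scoped Classical in
/-- Upper tail: independent events of probability at most `q`. -/
theorem upper_tail {q : ℝ} (a : ℝ) (hS : (T : Set κ).PairwiseDisjoint S)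
    (hP : ∀ k ∈ T, DependsOn (P k) (S k)) (hq : ∀ k ∈ T, pr (P k) ≤ q) :
    pr (fun x => a ≤ ((T.filter fun k => P k x).card : ℝ)) ≤ Real.exp (2 * T.card * q - a) := by
  -- At the parameter `1` each factor is at most `1 + 2 * q`. The level `a` stays free; the
  -- applications take twice the resulting exponent, or more.
  have h1 := avg_exp_card T S P (θ := 1) hS hP
  have he : Real.exp 1 - 1 ≤ 2 := by
    have := Real.exp_one_lt_d9
    norm_num at this ⊢
    linarith
  have he' : 0 ≤ Real.exp 1 - 1 := by linarith [Real.add_one_le_exp (1 : ℝ)]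
  have h2 : ∏ k ∈ T, (1 + pr (P k) * (Real.exp 1 - 1)) ≤ Real.exp (2 * T.card * q) := by
    have : Real.exp (2 * T.card * q) = ∏ _k ∈ T, Real.exp (2 * q) := by
      rw [Finset.prod_const, ← Real.exp_nat_mul]; congr 1; ring
    rw [this]
    refine Finset.prod_le_prod (fun k _ => ?_) fun k hk => ?_
    · have a2 := pr_nonneg (P k)
      positivity
    · have := Real.add_one_le_exp (2 * q)
      have a1 := hq k hk
      have a2 := pr_nonneg (P k)
      nlinarith
  refine (markov (f := fun x => Real.exp (1 * (T.filter fun k => P k x).card))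
    (fun _ => (Real.exp_pos _).le) (Real.exp_pos a) fun x hx => ?_).trans ?_
  · refine Real.exp_le_exp.2 ?_
    linarith
  · rw [h1, div_le_iff₀ (Real.exp_pos _), ← Real.exp_add]
    refine h2.trans (Real.exp_le_exp.2 ?_)
    linarith

end Tails

end Indep

/-! ### The algorithm -/

/-- The operations of which the algorithm consists; each of them takes two rounds. -/
inductive Op where
  /-- every node becomes the leader of a cluster with probability `2 ^ (-e)` -/
  | elect (e : ℕ) : Op
  /-- clustered nodes invite random nodes into their cluster -/
  | recruit : Op
  /-- every cluster is cut down to its `k` members of smallest ID; smaller ones are dissolved -/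
  | trunc (k : ℕ) : Op
  /-- every cluster becomes active with probability `2 ^ (-e)` -/
  | flip (e : ℕ) : Op
  /-- members of inactive clusters look for a member of an active cluster -/
  | search (all : Bool) : Op
  /-- inactive clusters join one of the clusters that they found -/
  | settle (all : Bool) : Op
  /-- leaders become members of their own clusters -/
  | crown : Op
  /-- unclustered nodes look for a clustered node and join its cluster -/
  | join : Op
  /-- the rumor goes to the leader and from there to all members -/
  | share : Op

/-- Local states. -/
structure St (w E : ℕ) where
  time : ℕ
  id : BitVec w
  coin : ℕ → Fin E → Bool
  mem : Option (BitVec w)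
  cand : Option (BitVec w)
  act : Bool
  box : Multiset (Message w)
  rumor : Option (List Bool)

/-- IDs are compared as numbers. -/
instance bitVecLinearOrder (w : ℕ) : LinearOrder (BitVec w) where
  le_refl x := BitVec.le_def.2 le_rfl
  le_trans x y z h h' := BitVec.le_def.2 ((BitVec.le_def.1 h).trans (BitVec.le_def.1 h'))
  le_antisymm x y h h' := BitVec.eq_of_toNat_eq (le_antisymm (BitVec.le_def.1 h) (BitVec.le_def.1 h'))
  le_total x y := by
    simp only [BitVec.le_def]
    exact le_total _ _
  lt_iff_le_not_ge x y := by
    simp only [BitVec.le_def, BitVec.lt_def]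
    exact lt_iff_le_not_ge
  toDecidableLE := inferInstance

section Local

variable {w E : ℕ}

/-- The first `e` bits are all zero. -/
def zeros (e : ℕ) (c : Fin E → Bool) : Bool := decide (∀ j : Fin E, j.val < e → c j = false)

/-- The leading IDs of some messages. -/
def heads (M : Multiset (Message w)) : Finset (BitVec w) :=
  (M.filterMap fun m => m.ids.head?).toFinset

/-- The pairs of IDs in some messages. -/
def pairs (M : Multiset (Message w)) : Finset (BitVec w ×ₗ BitVec w) :=
  (M.filterMap fun m => match m.ids with
    | [a, c] => some (toLex (a, c))
    | _ => none).toFinset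

/-- The smallest element, if there is one. -/
noncomputable def pickMin {α : Type*} [LinearOrder α] (S : Finset α) : Option α :=
  if h : S.Nonempty then some (S.min' h) else none

open scoped Classical in
/-- The `k`-th smallest element, if there is one. -/
noncomputable def threshold (k : ℕ) (S : Finset (BitVec w)) : Option (BitVec w) :=
  if h : ∃ t ∈ S, (S.filter (· ≤ t)).card = k then some h.choose else none

variable (o : Op) (s : St w E)

/-- The cluster that the node belongs to or is invited to. -/
def St.cl : Option (BitVec w) := s.mem.or s.cand

/-- The indices 1 and 2 denote the two rounds of an operation. The reports in `settle` are pairs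
which the leader minimises lexicographically. With `all = false` the first entry is the ID of the
reporter, so the member of smallest ID among the successful ones decides. With `all = true` it is
the leader that was found, so the smallest leader wins. -/
def action₁ : Action w :=
  match o with
  | .elect _ => .idle
  | .recruit => match s.mem with
    | some a => .push .random ⟨[a], []⟩
    | none => .idle
  | .trunc _ => match s.cl with
    | some a => .push (.address a) ⟨[s.id], []⟩
    | none => .idle
  | .flip _ => match s.mem with
    | some a => .pull (.address a)
    | none => .idle
  | .search all => if s.mem.isSome && (all || !s.act) then .pull .random else .idle
  | .settle all => match s.mem, s.cand with
    | some a, some c =>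
      if all || !s.act then .push (.address a) ⟨[if all then c else s.id, c], []⟩ else .idle
    | _, _ => .idle
  | .crown => match s.mem with
    | some a => .push (.address a) ⟨[], []⟩
    | none => .idle
  | .join => match s.mem with
    | some _ => .idle
    | none => .pull .random
  | .share => match s.mem, s.rumor with
    | some a, some ρ => .push (.address a) ⟨[], ρ⟩
    | _, _ => .idle

def reply₁ : Option (Message w) :=
  match o with
  | .flip e => some ⟨[], [zeros e (s.coin (s.time / 2))]⟩
  | .search all => if all || s.act then s.mem.map fun a => ⟨[a], []⟩ else none
  | .join => s.mem.map fun a => ⟨[a], []⟩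
  | _ => none

open scoped Classical in
-- The messages come without an order, so choices between IDs are made canonical by `pickMin`. The
-- arbitrary choice in `share` is harmless, since all rumors that arrive are equal. For `crown`, the
-- mere arrival of a message tells a node that it has followers.
noncomputable def update₁ (M : Multiset (Message w)) (a : Option (Message w)) : St w E :=
  match o with
  | .elect e =>
    { s with
      time := s.time + 1
      mem := if zeros e (s.coin (s.time / 2)) then some s.id else none }
  | .recruit =>
    { s with
      time := s.time + 1
      cand := if s.cl = none then pickMin (heads M) else s.cand }
  | .trunc _ => { s with time := s.time + 1, box := M }
  | .flip _ =>
    { s with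
      time := s.time + 1
      act := match a with
        | some m => m.data.headD false
        | none => s.act }
  | .search _ => { s with time := s.time + 1, cand := a.bind fun m => m.ids.head? }
  | .settle _ => { s with time := s.time + 1, box := M }
  | .crown => { s with time := s.time + 1, mem := if M = 0 then s.mem else some s.id }
  | .join => { s with time := s.time + 1, mem := s.mem.or (a.bind fun m => m.ids.head?) }
  | .share =>
    { s with
      time := s.time + 1
      rumor := s.rumor.or ((M.map Message.data).toList.head?) }

def action₂ : Action w :=
  match o with
  | .trunc _ => match s.cl with
    | some a => .pull (.address a)
    | none => .idle
  | .settle all => match s.mem with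
    | some a => if all || !s.act then .pull (.address a) else .idle
    | none => .idle
  | .share => match s.mem with
    | some a => .pull (.address a)
    | none => .idle
  | _ => .idle

noncomputable def reply₂ : Option (Message w) :=
  match o with
  | .trunc k => (threshold k (heads s.box)).map fun t => ⟨[t], []⟩
  | .settle _ => (pickMin (pairs s.box)).map fun q => ⟨[(ofLex q).2], []⟩
  | .share => s.rumor.map fun ρ => ⟨[], ρ⟩
  | _ => none

/-- If the leader has nothing to answer, the nodes that ask become unclustered. This dissolves
clusters that are too small in `trunc` and unsuccessful searchers in `settle`. -/
def update₂ (a : Option (Message w)) : St w E :=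
  match o with
  | .trunc _ =>
    { s with
      time := s.time + 1
      mem := match a.bind fun m => m.ids.head? with
        | some t => if s.id ≤ t then s.cl else none
        | none => none
      cand := none }
  | .settle all =>
    { s with
      time := s.time + 1
      mem := if all || !s.act then a.bind fun m => m.ids.head? else s.mem
      cand := none }
  | .share => { s with time := s.time + 1, rumor := s.rumor.or (a.map Message.data) }
  | _ => { s with time := s.time + 1 }

end Local

/-- The operation to be performed at a given time. -/
def opAt (p : List Op) (t : ℕ) : Op := p.getD (t / 2) .crown

/-- The algorithm that performs the operations in the list `p`, with `E` private random bits for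
each of them. -/
noncomputable def alg (p : List Op) (E w : ℕ) : Algorithm w where
  State := St w E
  coins := p.length * E
  rounds := p.length * 2
  start a c ρ :=
    { time := 0
      id := a
      coin := fun i j => if h : i < p.length then c (finProdFinEquiv (⟨i, h⟩, j)) else false
      mem := none
      cand := none
      act := false
      box := 0
      rumor := ρ }
  action s := if s.time % 2 = 0 then action₁ (opAt p s.time) s else action₂ (opAt p s.time) s
  reply s := if s.time % 2 = 0 then reply₁ (opAt p s.time) s else reply₂ (opAt p s.time) s
  update s M a :=
    if s.time % 2 = 0 then update₁ (opAt p s.time) s M a else update₂ (opAt p s.time) s a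
  follow := St.mem
  output := St.rumor

/-! ### Abstract semantics -/

/-- The clustering, as seen from outside, with the number of communications so far. -/
structure Abs (n w : ℕ) where
  mem : Fin n → Option (BitVec w)
  cand : Fin n → Option (BitVec w)
  act : Fin n → Bool
  cost : ℕ

section AbsSem

variable {n w E : ℕ} (N : Network n w)

/-- The cluster that a node belongs to or is invited to. -/
def Abs.cl (σ : Abs n w) (v : Fin n) : Option (BitVec w) := (σ.mem v).or (σ.cand v)

/-- The random input of one operation: for every node, random bits and a random contact. -/
abbrev Input (n E : ℕ) : Type := Fin n → (Fin E → Bool) × Fin n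

def searcher (all : Bool) (σ : Abs n w) (v : Fin n) : Prop := all = true ∨ σ.act v = false

open scoped Classical in
/-- The clusters that invite node `v`. -/
noncomputable def invitations (σ : Abs n w) (x : Input n E) (v : Fin n) : Finset (BitVec w) :=
  Finset.univ.filter fun a => ∃ u, σ.mem u = some a ∧ (x u).2 = v

/-- The nodes that belong or are invited to the cluster of `a`. -/
def candidates (σ : Abs n w) (a : BitVec w) : Finset (Fin n) :=
  Finset.univ.filter fun u => σ.cl u = some a

open scoped Classical in
/-- The reports that the leader `a` of a cluster gets. -/
noncomputable def reports (all : Bool) (σ : Abs n w) (a : BitVec w) :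
    Finset (BitVec w ×ₗ BitVec w) :=
  Finset.univ.filter fun q => ∃ u, σ.mem u = some a ∧ searcher all σ u ∧
    σ.cand u = some (ofLex q).2 ∧ (ofLex q).1 = if all then (ofLex q).2 else N.id u

open scoped Classical in
-- This is the net effect of both rounds. The threshold announced in `trunc` is replaced by the rank
-- of the node among the candidates, which is what the counting arguments need.
noncomputable def newMem (o : Op) (σ : Abs n w) (x : Input n E) (v : Fin n) :
    Option (BitVec w) :=
  match o with
  | .elect e => if zeros e (x v).1 then some (N.id v) else none
  | .trunc k => (σ.cl v).bind fun a =>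
    if k ≤ (candidates σ a).card ∧ ((candidates σ a).filter fun u => N.id u < N.id v).card < k
    then some a else none
  | .settle all => (σ.mem v).bind fun a =>
    if searcher all σ v then (pickMin (reports N all σ a)).map fun q => (ofLex q).2 else some a
  | .crown => if ∃ u, σ.mem u = some (N.id v) then some (N.id v) else σ.mem v
  | .join => (σ.mem v).or (σ.mem (x v).2)
  | _ => σ.mem v

open scoped Classical in
noncomputable def newCand (o : Op) (σ : Abs n w) (x : Input n E) (v : Fin n) :
    Option (BitVec w) :=
  match o with
  | .recruit => if σ.cl v = none then pickMin (invitations σ x v) else σ.cand v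
  | .search all => (σ.mem v).bind fun _ =>
    if searcher all σ v ∧ (all = true ∨ σ.act (x v).2 = true) then σ.mem (x v).2 else none
  | .trunc _ => none
  | .settle _ => none
  | _ => σ.cand v

open scoped Classical in
-- The coin is that of the leader and not of the member, so a cluster acts as a unit.
noncomputable def newAct (o : Op) (σ : Abs n w) (x : Input n E) (v : Fin n) : Bool :=
  match o with
  | .flip e => match σ.mem v with
    | some a => decide (∃ u, N.id u = a ∧ zeros e (x u).1)
    | none => σ.act v
  | _ => σ.act v

/-- The number of clustered nodes. -/
def members (σ : Abs n w) : Finset (Fin n) := Finset.univ.filter fun v => σ.mem v ≠ none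

/-- The surviving nodes that are not clustered. -/
def outsiders (σ : Abs n w) : Finset (Fin n) :=
  Finset.univ.filter fun v => v ∉ N.failed ∧ σ.mem v = none

/-- A bound for the number of communications that are initiated in an operation. -/
def opCost (o : Op) (σ : Abs n w) : ℕ :=
  match o with
  | .elect _ => 0
  | .trunc _ => 2 * (Finset.univ.filter fun v => σ.cl v ≠ none).card
  | .settle _ => 2 * (members σ).card
  | .join => (outsiders N σ).card
  | .share => 2 * n
  | _ => (members σ).card

open scoped Classical in
/-- The effect of an operation on the clustering. -/
noncomputable def absStep (o : Op) (σ : Abs n w) (x : Input n E) : Abs n w where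
  mem v := if v ∈ N.failed then σ.mem v else newMem N o σ x v
  cand v := if v ∈ N.failed then σ.cand v else newCand o σ x v
  act v := if v ∈ N.failed then σ.act v else newAct N o σ x v
  cost := σ.cost + opCost N o σ

/-- Failed nodes are in no cluster, and leaders are surviving nodes. -/
structure WF (σ : Abs n w) : Prop where
  mem_failed : ∀ v ∈ N.failed, σ.mem v = none
  cand_failed : ∀ v ∈ N.failed, σ.cand v = none
  mem_leader : ∀ v a, σ.mem v = some a → ∃ u, u ∉ N.failed ∧ N.id u = a
  cand_leader : ∀ v a, σ.cand v = some a → ∃ u, u ∉ N.failed ∧ N.id u = a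

end AbsSem

/-! ### Communication in one round -/

section Round

variable {n w : ℕ} {N : Network n w} {A : Algorithm w} {c : Fin n → Node A} {r : Fin n → Fin n}

theorem resolve_address {known : Finset (BitVec w)} {q u : Fin n} {a : BitVec w} :
    resolve N known q (.address a) = some u ↔ a ∈ known ∧ N.id u = a := by
  unfold resolve
  by_cases h : a ∈ known
  · simp only [h, if_true, true_and]
    constructor
    · intro hu
      simpa using List.find?_some hu
    · intro hu
      rcases hf : (List.finRange n).find? (fun u => decide (N.id u = a)) with _ | u'
      · have := List.find?_eq_none.1 hf u (List.mem_finRange u)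
        simp [hu] at this
      · have : N.id u' = a := by simpa using List.find?_some hf
        rw [N.id.injective (this.trans hu.symm)]
  · simp [h]

theorem pushOf_eq_some {v u : Fin n} {m : Message w} :
    pushOf N A c r v = some (u, m) ↔ v ∉ N.failed ∧ ∃ t m', A.action (c v).state = .push t m' ∧
      resolve N (c v).known (r v) t = some u ∧ m = m'.restrict (c v).known := by
  unfold pushOf
  by_cases h : v ∈ N.failed
  · simp [h]
  · simp only [h, if_false, not_false_eq_true, true_and]
    rcases hA : A.action (c v).state with _ | ⟨t, m'⟩ | t
    · simp
    · simp only [Option.map_eq_some_iff, Prod.mk.injEq, Action.push.injEq]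
      constructor
      · rintro ⟨u', h1, rfl, rfl⟩; exact ⟨t, m', ⟨rfl, rfl⟩, h1, rfl⟩
      · rintro ⟨t, m', ⟨rfl, rfl⟩, h1, rfl⟩; exact ⟨u, h1, rfl, rfl⟩
    · simp

theorem mem_inbox {u : Fin n} {m : Message w} :
    m ∈ inbox N A c r u ↔ ∃ v, pushOf N A c r v = some (u, m) := by
  unfold inbox
  rw [Multiset.mem_filterMap]
  constructor
  · rintro ⟨v, -, hv⟩
    rw [Option.bind_eq_some_iff] at hv
    obtain ⟨⟨u', m'⟩, h1, h2⟩ := hv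
    by_cases hu : u' = u
    · simp only [hu, if_true, Option.some.injEq] at h2
      exact ⟨v, by rw [h1, hu, h2]⟩
    · simp [hu] at h2
  · rintro ⟨v, hv⟩
    exact ⟨v, Finset.mem_univ_val _, by rw [hv]; simp⟩

theorem pullOf_pull {v : Fin n} (hv : v ∉ N.failed) {t : Target w}
    (h : A.action (c v).state = .pull t) :
    pullOf N A c r v = resolve N (c v).known (r v) t := by
  simp [pullOf, hv, h]

theorem response_none {v : Fin n} (h : ∀ t, A.action (c v).state ≠ .pull t) :
    response N A c r v = none := by
  unfold response pullOf
  rcases hA : A.action (c v).state with _ | ⟨t, m'⟩ | t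
  · simp
  · simp
  · exact absurd hA (h t)

theorem step_state {v : Fin n} (hv : v ∉ N.failed) : (step N A c r v).state =
    A.update (c v).state (inbox N A c r v) (response N A c r v) := by
  simp [step, hv]

theorem step_failed {v : Fin n} (hv : v ∈ N.failed) : step N A c r v = c v := by
  simp [step, hv]

theorem known_subset (v : Fin n) : (c v).known ⊆ (step N A c r v).known := by
  by_cases hv : v ∈ N.failed
  · rw [step_failed hv]
  · simp only [step, hv, if_false]; exact Finset.subset_union_left

theorem known_of_inbox {v : Fin n} (hv : v ∉ N.failed) {m : Message w}
    (hm : m ∈ inbox N A c r v) {a : BitVec w} (ha : a ∈ m.ids) :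
    a ∈ (step N A c r v).known := by
  simp only [step, hv, if_false]
  refine Finset.mem_union_right _ ?_
  rw [Multiset.mem_toFinset, Multiset.mem_bind]
  exact ⟨m, Multiset.mem_add.2 (Or.inl hm), by simpa using ha⟩

theorem known_of_response {v : Fin n} (hv : v ∉ N.failed) {m : Message w}
    (hm : response N A c r v = some m) {a : BitVec w} (ha : a ∈ m.ids) :
    a ∈ (step N A c r v).known := by
  simp only [step, hv, if_false]
  refine Finset.mem_union_right _ ?_
  rw [Multiset.mem_toFinset, Multiset.mem_bind]
  exact ⟨m, Multiset.mem_add.2 (Or.inr (by simp [hm])), by simpa using ha⟩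

end Round

/-! ### Simulation -/

section Simulation

variable {n w E : ℕ} (N : Network n w) (p : List Op)

/-- The state of a node in an execution of `alg`. -/
abbrev st (x : Node (alg p E w)) : St w E := x.state

/-- The nodes `c` at time `t` are described by `σ`. -/
structure Rep (coins : Fin n → ℕ → Fin E → Bool) (ρ : Fin n → Option (List Bool)) (t : ℕ)
    (c : Fin n → Node (alg p E w)) (σ : Abs n w) : Prop where
  time : ∀ v ∉ N.failed, (st p (c v)).time = t
  id : ∀ v, (st p (c v)).id = N.id v
  coin : ∀ v, (st p (c v)).coin = coins v
  mem : ∀ v, (st p (c v)).mem = σ.mem v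
  cand : ∀ v, (st p (c v)).cand = σ.cand v
  act : ∀ v, (st p (c v)).act = σ.act v
  rumor : ∀ v, (st p (c v)).rumor = ρ v
  known_id : ∀ v, N.id v ∈ (c v).known
  known_mem : ∀ v a, σ.mem v = some a → a ∈ (c v).known
  known_cand : ∀ v a, σ.cand v = some a → a ∈ (c v).known

variable {N p} {coins : Fin n → ℕ → Fin E → Bool} {ρ : Fin n → Option (List Bool)} {i t : ℕ}
  {c : Fin n → Node (alg p E w)} {σ : Abs n w} {o : Op} {r r' : Fin n → Fin n}

theorem opAt_even (ho : p[i]? = some o) : opAt p (2 * i) = o := by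
  simp [opAt, List.getD, ho]

theorem opAt_odd (ho : p[i]? = some o) : opAt p (2 * i + 1) = o := by
  have : (2 * i + 1) / 2 = i := by omega
  simp [opAt, List.getD, this, ho]

theorem alg_action_even (ho : p[i]? = some o) {s : St w E} (hs : s.time = 2 * i) :
    (alg p E w).action s = action₁ o s := by
  simp [alg, hs, opAt_even ho]

theorem alg_reply_even (ho : p[i]? = some o) {s : St w E} (hs : s.time = 2 * i) :
    (alg p E w).reply s = reply₁ o s := by
  simp [alg, hs, opAt_even ho]

theorem alg_update_even (ho : p[i]? = some o) {s : St w E} (hs : s.time = 2 * i) (M) (a) :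
    (alg p E w).update s M a = update₁ o s M a := by
  simp [alg, hs, opAt_even ho]

theorem alg_action_odd (ho : p[i]? = some o) {s : St w E} (hs : s.time = 2 * i + 1) :
    (alg p E w).action s = action₂ o s := by
  simp [alg, hs, opAt_odd ho]

theorem alg_reply_odd (ho : p[i]? = some o) {s : St w E} (hs : s.time = 2 * i + 1) :
    (alg p E w).reply s = reply₂ o s := by
  simp [alg, hs, opAt_odd ho]

theorem alg_update_odd (ho : p[i]? = some o) {s : St w E} (hs : s.time = 2 * i + 1) (M) (a) :
    (alg p E w).update s M a = update₂ o s a := by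
  simp [alg, hs, opAt_odd ho]

theorem Rep.push_even (h : Rep N p coins ρ (2 * i) c σ) (ho : p[i]? = some o) {v u : Fin n}
    {m : Message w} : pushOf N (alg p E w) c r v = some (u, m) ↔ v ∉ N.failed ∧
      ∃ t m', action₁ o (st p (c v)) = .push t m' ∧
      resolve N (c v).known (r v) t = some u ∧ m = m'.restrict (c v).known := by
  rw [pushOf_eq_some]
  refine and_congr_right fun hv => ?_
  rw [alg_action_even ho (h.time v hv)]

theorem Rep.state_even (h : Rep N p coins ρ (2 * i) c σ) (ho : p[i]? = some o) {v : Fin n}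
    (hv : v ∉ N.failed) : st p (step N (alg p E w) c r v) =
      update₁ o (st p (c v)) (inbox N _ c r v) (response N _ c r v) := by
  rw [st, step_state hv, alg_update_even ho (h.time v hv)]

theorem Rep.state_odd (h : Rep N p coins ρ (2 * i + 1) c σ) (ho : p[i]? = some o) {v : Fin n}
    (hv : v ∉ N.failed) : st p (step N (alg p E w) c r v) =
      update₂ o (st p (c v)) (response N _ c r v) := by
  rw [st, step_state hv, alg_update_odd ho (h.time v hv)]

theorem Rep.reply_even (h : Rep N p coins ρ (2 * i) c σ) (ho : p[i]? = some o) {v : Fin n}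
    (hv : v ∉ N.failed) : replyOf N (alg p E w) c v =
      (reply₁ o (st p (c v))).map fun m => m.restrict (c v).known := by
  rw [replyOf, if_neg hv, alg_reply_even ho (h.time v hv)]

theorem Rep.reply_odd (h : Rep N p coins ρ (2 * i + 1) c σ) (ho : p[i]? = some o) {v : Fin n}
    (hv : v ∉ N.failed) : replyOf N (alg p E w) c v =
      (reply₂ o (st p (c v))).map fun m => m.restrict (c v).known := by
  rw [replyOf, if_neg hv, alg_reply_odd ho (h.time v hv)]

theorem Rep.response_even (h : Rep N p coins ρ (2 * i) c σ) (ho : p[i]? = some o) {v u : Fin n}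
    (hv : v ∉ N.failed) {t : Target w} (ha : action₁ o (st p (c v)) = .pull t)
    (hr : resolve N (c v).known (r v) t = some u) (hu : u ∉ N.failed) :
    response N (alg p E w) c r v =
      (reply₁ o (st p (c u))).map fun m => m.restrict (c u).known := by
  rw [response, pullOf_pull hv (t := t), hr, Option.bind_some, h.reply_even ho hu]
  rw [alg_action_even ho (h.time v hv), ha]

theorem Rep.response_odd (h : Rep N p coins ρ (2 * i + 1) c σ) (ho : p[i]? = some o) {v u : Fin n}
    (hv : v ∉ N.failed) {t : Target w} (ha : action₂ o (st p (c v)) = .pull t)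
    (hr : resolve N (c v).known (r v) t = some u) (hu : u ∉ N.failed) :
    response N (alg p E w) c r v =
      (reply₂ o (st p (c u))).map fun m => m.restrict (c u).known := by
  rw [response, pullOf_pull hv (t := t), hr, Option.bind_some, h.reply_odd ho hu]
  rw [alg_action_odd ho (h.time v hv), ha]

theorem Rep.response_none_even (h : Rep N p coins ρ (2 * i) c σ) (ho : p[i]? = some o) {v : Fin n}
    (hv : v ∉ N.failed) (ha : ∀ t, action₁ o (st p (c v)) ≠ .pull t) :
    response N (alg p E w) c r v = none := by
  refine response_none fun t => ?_
  rw [alg_action_even ho (h.time v hv)]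
  exact ha t

theorem Rep.response_none_odd (h : Rep N p coins ρ (2 * i + 1) c σ) (ho : p[i]? = some o)
    {v : Fin n} (hv : v ∉ N.failed) (ha : ∀ t, action₂ o (st p (c v)) ≠ .pull t) :
    response N (alg p E w) c r v = none := by
  refine response_none fun t => ?_
  rw [alg_action_odd ho (h.time v hv)]
  exact ha t

theorem Message.restrict_of_subset {m : Message w} {known : Finset (BitVec w)}
    (h : ∀ a ∈ m.ids, a ∈ known) : m.restrict known = m := by
  have : m.ids.filter (fun a => decide (a ∈ known)) = m.ids :=
    List.filter_eq_self.2 fun a ha => by simpa using h a ha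
  unfold Message.restrict
  rw [this]

theorem Rep.cl (h : Rep N p coins ρ t c σ) (v : Fin n) : (st p (c v)).cl = σ.cl v := by
  rw [St.cl, Abs.cl, h.mem, h.cand]

theorem Rep.known_cl (h : Rep N p coins ρ t c σ) {v : Fin n} {a : BitVec w}
    (ha : σ.cl v = some a) : a ∈ (c v).known := by
  rw [Abs.cl, Option.or_eq_some_iff] at ha
  rcases ha with ha | ⟨-, ha⟩
  · exact h.known_mem v a ha
  · exact h.known_cand v a ha

theorem WF.cl_leader (h : WF N σ) {v : Fin n} {a : BitVec w} (ha : σ.cl v = some a) :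
    ∃ u, u ∉ N.failed ∧ N.id u = a := by
  rw [Abs.cl, Option.or_eq_some_iff] at ha
  rcases ha with ha | ⟨-, ha⟩
  · exact h.mem_leader v a ha
  · exact h.cand_leader v a ha

theorem WF.cl_failed (h : WF N σ) {v : Fin n} (hv : v ∈ N.failed) : σ.cl v = none := by
  simp [Abs.cl, h.mem_failed v hv, h.cand_failed v hv]

/-- To check a description of the nodes after a round, it suffices to look at surviving nodes. -/
theorem Rep.step {σ' : Abs n w} {t' : ℕ} (h : Rep N p coins ρ t c σ)
    (hf : ∀ v ∈ N.failed, σ'.mem v = σ.mem v ∧ σ'.cand v = σ.cand v ∧ σ'.act v = σ.act v)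
    (hs : ∀ v ∉ N.failed, (st p (step N (alg p E w) c r v)).time = t' ∧
      (st p (step N (alg p E w) c r v)).id = (st p (c v)).id ∧
      (st p (step N (alg p E w) c r v)).coin = (st p (c v)).coin ∧
      (st p (step N (alg p E w) c r v)).rumor = (st p (c v)).rumor ∧
      (st p (step N (alg p E w) c r v)).mem = σ'.mem v ∧
      (st p (step N (alg p E w) c r v)).cand = σ'.cand v ∧
      (st p (step N (alg p E w) c r v)).act = σ'.act v)
    (hm : ∀ v ∉ N.failed, ∀ a, σ'.mem v = some a → a ∈ (step N (alg p E w) c r v).known)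
    (hc : ∀ v ∉ N.failed, ∀ a, σ'.cand v = some a → a ∈ (step N (alg p E w) c r v).known) :
    Rep N p coins ρ t' (Gossip.step N (alg p E w) c r) σ' where
  time v hv := (hs v hv).1
  id v := by
    by_cases hv : v ∈ N.failed
    · rw [step_failed hv]; exact h.id v
    · rw [(hs v hv).2.1]; exact h.id v
  coin v := by
    by_cases hv : v ∈ N.failed
    · rw [step_failed hv]; exact h.coin v
    · rw [(hs v hv).2.2.1]; exact h.coin v
  rumor v := by
    by_cases hv : v ∈ N.failed
    · rw [step_failed hv]; exact h.rumor v
    · rw [(hs v hv).2.2.2.1]; exact h.rumor v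
  mem v := by
    by_cases hv : v ∈ N.failed
    · rw [step_failed hv, (hf v hv).1]; exact h.mem v
    · exact (hs v hv).2.2.2.2.1
  cand v := by
    by_cases hv : v ∈ N.failed
    · rw [step_failed hv, (hf v hv).2.1]; exact h.cand v
    · exact (hs v hv).2.2.2.2.2.1
  act v := by
    by_cases hv : v ∈ N.failed
    · rw [step_failed hv, (hf v hv).2.2]; exact h.act v
    · exact (hs v hv).2.2.2.2.2.2
  known_id v := known_subset v (h.known_id v)
  known_mem v a ha := by
    by_cases hv : v ∈ N.failed
    · rw [(hf v hv).1] at ha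
      exact known_subset v (h.known_mem v a ha)
    · exact hm v hv a ha
  known_cand v a ha := by
    by_cases hv : v ∈ N.failed
    · rw [(hf v hv).2.1] at ha
      exact known_subset v (h.known_cand v a ha)
    · exact hc v hv a ha

/-- The second round of an operation that consists of one round only. -/
theorem Rep.idle (h : Rep N p coins ρ (2 * i + 1) c σ) (ho : p[i]? = some o)
    (hupd : ∀ (s : St w E) a, update₂ o s a = { s with time := s.time + 1 }) :
    Rep N p coins ρ (2 * (i + 1)) (Gossip.step N (alg p E w) c r) σ := by
  refine h.step (fun v _ => ⟨rfl, rfl, rfl⟩) (fun v hv => ?_)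
    (fun v _ a ha => known_subset v (h.known_mem v a ha))
    (fun v _ a ha => known_subset v (h.known_cand v a ha))
  rw [h.state_odd ho hv, hupd]
  exact ⟨by simp only [h.time v hv]; ring, rfl, rfl, rfl, h.mem v, h.cand v, h.act v⟩

theorem pickMin_mem {α : Type*} [LinearOrder α] {S : Finset α} {a : α} (h : pickMin S = some a) :
    a ∈ S := by
  unfold pickMin at h
  split_ifs at h with hS
  · cases h; exact S.min'_mem hS

theorem mem_heads {M : Multiset (Message w)} {a : BitVec w} :
    a ∈ heads M ↔ ∃ m ∈ M, m.ids.head? = some a := by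
  simp [heads]

theorem mem_pairs {M : Multiset (Message w)} {q : BitVec w ×ₗ BitVec w} :
    q ∈ pairs M ↔ ∃ m ∈ M, m.ids = [(ofLex q).1, (ofLex q).2] := by
  simp only [pairs, Multiset.mem_toFinset, Multiset.mem_filterMap]
  refine exists_congr fun m => and_congr_right fun _ => ?_
  rcases hm : m.ids with _ | ⟨a, _ | ⟨b, _ | ⟨d, l⟩⟩⟩
  · simp
  · simp
  · simp only [Option.some.injEq, List.cons.injEq, and_true]
    constructor
    · rintro rfl; simp
    · rintro ⟨rfl, rfl⟩; rfl
  · simp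

variable {x : Input n E}

theorem absStep_failed {v : Fin n} (hv : v ∈ N.failed) : (absStep N o σ x).mem v = σ.mem v ∧
    (absStep N o σ x).cand v = σ.cand v ∧ (absStep N o σ x).act v = σ.act v := by
  simp [absStep, hv]

theorem absStep_mem {v : Fin n} (hv : v ∉ N.failed) :
    (absStep N o σ x).mem v = newMem N o σ x v := by simp [absStep, hv]
theorem absStep_cand {v : Fin n} (hv : v ∉ N.failed) :
    (absStep N o σ x).cand v = newCand o σ x v := by simp [absStep, hv]
theorem absStep_act {v : Fin n} (hv : v ∉ N.failed) :
    (absStep N o σ x).act v = newAct N o σ x v := by simp [absStep, hv]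

/-- Each simulation lemma of this kind checks both that the states agree and that every ID kept as a
membership or an invitation is known. The second point makes direct addressing succeed and
`Message.restrict` act as the identity in later rounds. -/
theorem Rep.elect {e : ℕ} (h : Rep N p coins ρ (2 * i) c σ) (ho : p[i]? = some (.elect e))
    (hx : ∀ v, x v = (coins v i, r v)) :
    Rep N p coins ρ (2 * i + 1) (Gossip.step N (alg p E w) c r) (absStep N (.elect e) σ x) := by
  refine h.step (fun v hv => absStep_failed hv) (fun v hv => ?_) (fun v hv a ha => ?_)
    (fun v hv a ha => ?_)
  · rw [h.state_even ho hv, absStep_mem hv, absStep_cand hv, absStep_act hv]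
    refine ⟨by simp [update₁, h.time v hv], rfl, rfl, rfl, ?_, h.cand v, h.act v⟩
    simp [update₁, newMem, h.time v hv, h.coin v, hx, h.id v]
  · rw [absStep_mem hv] at ha
    simp only [newMem, Option.ite_none_right_eq_some, Option.some.injEq] at ha
    rw [← ha.2]
    exact known_subset v (h.known_id v)
  · rw [absStep_cand hv] at ha
    exact known_subset v (h.known_cand v a ha)

theorem Rep.recruit (h : Rep N p coins ρ (2 * i) c σ) (ho : p[i]? = some .recruit) (hσ : WF N σ)
    (hx : ∀ v, x v = (coins v i, r v)) :
    Rep N p coins ρ (2 * i + 1) (Gossip.step N (alg p E w) c r) (absStep N .recruit σ x) := by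
  have key : ∀ v m, m ∈ inbox N (alg p E w) c r v ↔
      ∃ u a, σ.mem u = some a ∧ r u = v ∧ m = ⟨[a], []⟩ := by
    intro v m
    rw [mem_inbox]
    refine exists_congr fun u => ?_
    rw [h.push_even ho]
    constructor
    · rintro ⟨hu, t, m', ha, hr, rfl⟩
      simp only [action₁] at ha
      rw [h.mem] at ha
      rcases hm : σ.mem u with _ | a
      · simp [hm] at ha
      · simp only [hm, Action.push.injEq] at ha
        obtain ⟨rfl, rfl⟩ := ha
        refine ⟨a, rfl, by simpa [resolve] using hr, Message.restrict_of_subset ?_⟩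
        simpa using h.known_mem u a hm
    · rintro ⟨a, hm, rfl, rfl⟩
      have hu : u ∉ N.failed := fun hu => by simp [hσ.mem_failed u hu] at hm
      refine ⟨hu, .random, ⟨[a], []⟩, ?_, rfl, (Message.restrict_of_subset ?_).symm⟩
      · simp [action₁, h.mem, hm]
      · simpa using h.known_mem u a hm
  have hheads : ∀ v, heads (inbox N (alg p E w) c r v) = invitations σ x v := by
    intro v
    ext a
    rw [mem_heads]
    simp only [key, invitations, Finset.mem_filter, Finset.mem_univ, true_and, hx]
    constructor
    · rintro ⟨m, ⟨u, b, hu, hr, rfl⟩, hb⟩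
      simp only [List.head?_cons, Option.some.injEq] at hb
      exact ⟨u, hb ▸ hu, hr⟩
    · rintro ⟨u, hu, hr⟩
      exact ⟨⟨[a], []⟩, ⟨u, a, hu, hr, rfl⟩, rfl⟩
  refine h.step (fun v hv => absStep_failed hv) (fun v hv => ?_) (fun v hv a ha => ?_)
    (fun v hv a ha => ?_)
  · rw [h.state_even ho hv, absStep_mem hv, absStep_cand hv, absStep_act hv]
    refine ⟨by simp [update₁, h.time v hv], rfl, rfl, rfl, h.mem v, ?_, h.act v⟩
    simp only [update₁, newCand, hheads, h.cl, h.cand]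
  · rw [absStep_mem hv] at ha
    exact known_subset v (h.known_mem v a ha)
  · rw [absStep_cand hv] at ha
    simp only [newCand] at ha
    split_ifs at ha with hcl
    · have := pickMin_mem ha
      rw [← hheads, mem_heads] at this
      obtain ⟨m, hm, hma⟩ := this
      exact known_of_inbox hv hm (List.mem_of_head? hma)
    · exact known_subset v (h.known_cand v a ha)

theorem Rep.flip {e : ℕ} (h : Rep N p coins ρ (2 * i) c σ) (ho : p[i]? = some (.flip e))
    (hσ : WF N σ) (hx : ∀ v, x v = (coins v i, r v)) :
    Rep N p coins ρ (2 * i + 1) (Gossip.step N (alg p E w) c r) (absStep N (.flip e) σ x) := by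
  refine h.step (fun v hv => absStep_failed hv) (fun v hv => ?_) (fun v hv a ha => ?_)
    (fun v hv a ha => ?_)
  · rw [h.state_even ho hv, absStep_mem hv, absStep_cand hv, absStep_act hv]
    refine ⟨by simp [update₁, h.time v hv], rfl, rfl, rfl, h.mem v, h.cand v, ?_⟩
    rcases hm : σ.mem v with _ | a
    · rw [h.response_none_even ho hv]
      · simpa [update₁, newAct, hm] using h.act v
      · simp [action₁, h.mem, hm]
    · obtain ⟨u, hu, rfl⟩ := hσ.mem_leader v a hm
      rw [h.response_even ho hv (t := .address (N.id u)) (u := u)]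
      · simp only [update₁, reply₁, Option.map_some, Message.restrict, newAct, hm, hx, h.coin,
          h.time u hu, List.headD_cons, N.id.injective.eq_iff, exists_eq_left]
        simp
      · simp [action₁, h.mem, hm]
      · exact resolve_address.2 ⟨h.known_mem v _ hm, rfl⟩
      · exact hu
  · rw [absStep_mem hv] at ha
    exact known_subset v (h.known_mem v a ha)
  · rw [absStep_cand hv] at ha
    exact known_subset v (h.known_cand v a ha)

theorem Rep.search {all : Bool} (h : Rep N p coins ρ (2 * i) c σ)
    (ho : p[i]? = some (.search all)) (hσ : WF N σ) (hx : ∀ v, x v = (coins v i, r v)) :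
    Rep N p coins ρ (2 * i + 1) (Gossip.step N (alg p E w) c r) (absStep N (.search all) σ x) := by
  have key : ∀ v ∉ N.failed, ((response N (alg p E w) c r v).bind fun m => m.ids.head?) =
      newCand (.search all) σ x v := by
    intro v hv
    simp only [newCand]
    rcases hm : σ.mem v with _ | a
    · rw [h.response_none_even ho hv]
      · simp
      · simp [action₁, h.mem, hm]
    · by_cases hs : searcher all σ v
      · have hact : action₁ (.search all) (st p (c v)) = .pull .random := by
          rcases hs with hs | hs <;> simp [action₁, h.mem, hm, h.act, hs]
        have hxv : (x v).2 = r v := by rw [hx]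
        simp only [Option.bind_some, hs, true_and, hxv]
        -- A failed node does not answer; the abstract step agrees because failed nodes belong to no
        -- cluster.
        by_cases hu : r v ∈ N.failed
        · rw [response, pullOf_pull hv (t := .random)]
          · simp [resolve, replyOf, hu, hσ.mem_failed _ hu]
          · rw [alg_action_even ho (h.time v hv), hact]
        · rw [h.response_even ho hv hact (u := r v) rfl hu]
          simp only [reply₁, h.act, h.mem, Bool.or_eq_true]
          by_cases h1 : all = true ∨ σ.act (r v) = true
          · simp only [h1, if_true]
            rcases hb : σ.mem (r v) with _ | b
            · simp
            · have : b ∈ (c (r v)).known := h.known_mem _ _ hb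
              simp [Message.restrict, this]
          · simp [h1]
      · have hs' : ¬ (all = true ∨ σ.act v = false) := hs
        rw [h.response_none_even ho hv]
        · simp [hs]
        · push Not at hs'
          simp [action₁, h.mem, hm, h.act, hs']
  refine h.step (fun v hv => absStep_failed hv) (fun v hv => ?_) (fun v hv a ha => ?_)
    (fun v hv a ha => ?_)
  · rw [h.state_even ho hv, absStep_mem hv, absStep_cand hv, absStep_act hv]
    exact ⟨by simp [update₁, h.time v hv], rfl, rfl, rfl, h.mem v, key v hv, h.act v⟩
  · rw [absStep_mem hv] at ha
    exact known_subset v (h.known_mem v a ha)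
  · rw [absStep_cand hv, ← key v hv, Option.bind_eq_some_iff] at ha
    obtain ⟨m, hm, hma⟩ := ha
    exact known_of_response hv hm (List.mem_of_head? hma)

theorem Rep.crown (h : Rep N p coins ρ (2 * i) c σ) (ho : p[i]? = some .crown) (hσ : WF N σ) :
    Rep N p coins ρ (2 * i + 1) (Gossip.step N (alg p E w) c r) (absStep N .crown σ x) := by
  have key : ∀ v, inbox N (alg p E w) c r v = 0 ↔ ¬ ∃ u, σ.mem u = some (N.id v) := by
    intro v
    rw [Multiset.eq_zero_iff_forall_notMem]
    constructor
    · rintro h0 ⟨u, hu⟩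
      have hu' : u ∉ N.failed := fun hf => by simp [hσ.mem_failed u hf] at hu
      refine h0 (Message.restrict ⟨[], []⟩ (c u).known) (mem_inbox.2 ⟨u, (h.push_even ho).2
        ⟨hu', .address (N.id v), ⟨[], []⟩, ?_, resolve_address.2 ⟨h.known_mem u _ hu, rfl⟩, rfl⟩⟩)
      simp [action₁, h.mem, hu]
    · intro h0 m hm
      obtain ⟨u, hu⟩ := mem_inbox.1 hm
      obtain ⟨hu', t, m', ha, hr, rfl⟩ := (h.push_even ho).1 hu
      simp only [action₁] at ha
      rw [h.mem] at ha
      rcases hmu : σ.mem u with _ | a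
      · simp [hmu] at ha
      · simp only [hmu, Action.push.injEq] at ha
        obtain ⟨rfl, rfl⟩ := ha
        rw [resolve_address] at hr
        exact h0 ⟨u, by rw [hmu, hr.2]⟩
  refine h.step (fun v hv => absStep_failed hv) (fun v hv => ?_) (fun v hv a ha => ?_)
    (fun v hv a ha => ?_)
  · rw [h.state_even ho hv, absStep_mem hv, absStep_cand hv, absStep_act hv]
    refine ⟨by simp [update₁, h.time v hv], rfl, rfl, rfl, ?_, h.cand v, h.act v⟩
    simp only [update₁, newMem, key, h.mem, h.id]
    by_cases h1 : ∃ u, σ.mem u = some (N.id v)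
    · simp [h1]
    · simp [h1]
  · rw [absStep_mem hv] at ha
    simp only [newMem] at ha
    split_ifs at ha with h1
    · rw [← Option.some.inj ha]
      exact known_subset v (h.known_id v)
    · exact known_subset v (h.known_mem v a ha)
  · rw [absStep_cand hv] at ha
    exact known_subset v (h.known_cand v a ha)

theorem Rep.join (h : Rep N p coins ρ (2 * i) c σ) (ho : p[i]? = some .join) (hσ : WF N σ)
    (hx : ∀ v, x v = (coins v i, r v)) :
    Rep N p coins ρ (2 * i + 1) (Gossip.step N (alg p E w) c r) (absStep N .join σ x) := by
  have key : ∀ v ∉ N.failed, σ.mem v = none →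
      ((response N (alg p E w) c r v).bind fun m => m.ids.head?) = σ.mem (r v) := by
    intro v hv hm
    have hact : action₁ .join (st p (c v)) = .pull .random := by
      simp [action₁, h.mem, hm]
    by_cases hu : r v ∈ N.failed
    · rw [response, pullOf_pull hv (t := .random)]
      · simp [resolve, replyOf, hu, hσ.mem_failed _ hu]
      · rw [alg_action_even ho (h.time v hv), hact]
    · rw [h.response_even ho hv hact (u := r v) rfl hu]
      simp only [reply₁, h.mem]
      rcases hb : σ.mem (r v) with _ | b
      · simp
      · have : b ∈ (c (r v)).known := h.known_mem _ _ hb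
        simp [Message.restrict, this]
  have key' : ∀ v ∉ N.failed,
      (σ.mem v).or ((response N (alg p E w) c r v).bind fun m => m.ids.head?) =
      newMem N .join σ x v := by
    intro v hv
    rcases hm : σ.mem v with _ | b
    · rw [key v hv hm]; simp [newMem, hm, hx]
    · simp [newMem, hm]
  refine h.step (fun v hv => absStep_failed hv) (fun v hv => ?_) (fun v hv a ha => ?_)
    (fun v hv a ha => ?_)
  · rw [h.state_even ho hv, absStep_mem hv, absStep_cand hv, absStep_act hv, ← key' v hv]
    refine ⟨by simp [update₁, h.time v hv], rfl, rfl, rfl, ?_, h.cand v, h.act v⟩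
    simp only [update₁, h.mem]
  · rw [absStep_mem hv, ← key' v hv, Option.or_eq_some_iff] at ha
    rcases ha with ha | ⟨-, ha⟩
    · exact known_subset v (h.known_mem v a ha)
    · obtain ⟨m, hm, hma⟩ := Option.bind_eq_some_iff.1 ha
      exact known_of_response hv hm (List.mem_of_head? hma)
  · rw [absStep_cand hv] at ha
    exact known_subset v (h.known_cand v a ha)

end Simulation

/-! ### Thresholds -/

section Threshold

theorem exists_threshold {α : Type*} [LinearOrder α] (S : Finset α) {k : ℕ} (hk : 1 ≤ k)
    (hkS : k ≤ S.card) : ∃ t ∈ S, (S.filter (· ≤ t)).card = k := by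
  induction hn : S.card generalizing S with
  | zero => omega
  | succ m ih =>
    have hne : S.Nonempty := Finset.card_pos.1 (by omega)
    rcases eq_or_lt_of_le hkS with h | h
    · refine ⟨S.max' hne, S.max'_mem hne, ?_⟩
      rw [Finset.filter_true_of_mem fun x hx => S.le_max' x hx, h]
    · have hcard : (S.erase (S.max' hne)).card = m := by
        rw [Finset.card_erase_of_mem (S.max'_mem hne)]; omega
      obtain ⟨t, ht, htk⟩ := ih (S.erase (S.max' hne)) (by omega) hcard
      have htS := Finset.mem_of_mem_erase ht
      refine ⟨t, htS, ?_⟩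
      rw [← htk]
      congr 1
      ext x
      simp only [Finset.mem_filter, Finset.mem_erase]
      constructor
      · rintro ⟨hx, hxt⟩
        refine ⟨⟨fun hxm => ?_, hx⟩, hxt⟩
        have h1 : t = S.max' hne := le_antisymm (S.le_max' t htS) (hxm ▸ hxt)
        exact Finset.ne_of_mem_erase ht h1
      · rintro ⟨⟨-, hx⟩, hxt⟩
        exact ⟨hx, hxt⟩

/-- A member that learns only the threshold can decide whether its rank is below `k`; no list of IDs
has to be sent. -/
theorem le_threshold_iff {α : Type*} [LinearOrder α] {S : Finset α} {k : ℕ} {t y : α}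
    (hk : (S.filter (· ≤ t)).card = k) (hy : y ∈ S) :
    y ≤ t ↔ (S.filter (· < y)).card < k := by
  constructor
  · intro h
    rw [← hk]
    refine Finset.card_lt_card ((Finset.ssubset_iff_of_subset ?_).2 ⟨y, ?_, ?_⟩)
    · intro x hx
      simp only [Finset.mem_filter] at hx ⊢
      exact ⟨hx.1, hx.2.le.trans h⟩
    · simp [hy, h]
    · simp
  · intro h
    by_contra hlt
    push Not at hlt
    refine absurd h (not_lt.2 ?_)
    rw [← hk]
    refine Finset.card_le_card fun x hx => ?_
    simp only [Finset.mem_filter] at hx ⊢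
    exact ⟨hx.1, hx.2.trans_lt hlt⟩

theorem card_filter_rank {α : Type*} [LinearOrder α] (S : Finset α) {k : ℕ} (hkS : k ≤ S.card) :
    (S.filter fun y => (S.filter (· < y)).card < k).card = k := by
  rcases Nat.eq_zero_or_pos k with rfl | hk
  · simp
  · obtain ⟨t, -, htk⟩ := exists_threshold S hk hkS
    rw [← htk]
    congr 1
    refine Finset.filter_congr fun y hy => ?_
    rw [le_threshold_iff rfl hy]

end Threshold

/-! ### Simulation of truncation and settling, and of a whole operation -/

section Simulation

variable {n w E : ℕ} {N : Network n w} {p : List Op} {coins : Fin n → ℕ → Fin E → Bool}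
  {ρ : Fin n → Option (List Bool)} {i t : ℕ}
  {c : Fin n → Node (alg p E w)} {σ : Abs n w} {o : Op} {r r' : Fin n → Fin n} {x : Input n E}

theorem threshold_eq_some {k : ℕ} {S : Finset (BitVec w)} {t : BitVec w}
    (h : threshold k S = some t) : t ∈ S ∧ (S.filter (· ≤ t)).card = k := by
  unfold threshold at h
  split_ifs at h with h1
  rw [← Option.some.inj h]
  exact h1.choose_spec

theorem threshold_eq_none {k : ℕ} {S : Finset (BitVec w)} (h : threshold k S = none) :
    k = 0 ∨ S.card < k := by
  unfold threshold at h
  split_ifs at h with h1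
  by_contra h2
  push Not at h2
  exact h1 (exists_threshold S (by omega) h2.2)

theorem candidates_rank {a : BitVec w} (v : Fin n) :
    ((candidates σ a).filter fun u => N.id u < N.id v).card =
      (((candidates σ a).map N.id).filter (· < N.id v)).card := by
  rw [Finset.filter_map, Finset.card_map]
  rfl

/-- The leader collects the IDs of all candidates and answers with the `k`-th smallest, so every
message carries a single ID. -/
theorem Rep.trunc {k : ℕ} (h : Rep N p coins ρ (2 * i) c σ) (ho : p[i]? = some (.trunc k))
    (hσ : WF N σ) :
    Rep N p coins ρ (2 * i + 1) (Gossip.step N (alg p E w) c r) σ ∧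
    Rep N p coins ρ (2 * (i + 1)) (Gossip.step N _ (Gossip.step N (alg p E w) c r) r')
      (absStep N (.trunc k) σ x) := by
  have key : ∀ v m, m ∈ inbox N (alg p E w) c r v ↔
      ∃ u, σ.cl u = some (N.id v) ∧ m = ⟨[N.id u], []⟩ := by
    intro v m
    rw [mem_inbox]
    refine exists_congr fun u => ?_
    rw [h.push_even ho]
    constructor
    · rintro ⟨hu, t, m', ha, hr, rfl⟩
      simp only [action₁] at ha
      rw [h.cl] at ha
      rcases hm : σ.cl u with _ | a
      · simp [hm] at ha
      · simp only [hm, Action.push.injEq] at ha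
        obtain ⟨rfl, rfl⟩ := ha
        rw [resolve_address] at hr
        rw [hr.2, Message.restrict_of_subset, h.id]
        · exact ⟨rfl, rfl⟩
        · simpa [h.id] using h.known_id u
    · rintro ⟨hm, rfl⟩
      have hu : u ∉ N.failed := fun hu => by simp [hσ.cl_failed hu] at hm
      refine ⟨hu, .address (N.id v), ⟨[N.id u], []⟩, ?_,
        resolve_address.2 ⟨h.known_cl hm, rfl⟩, (Message.restrict_of_subset ?_).symm⟩
      · simp [action₁, h.cl, hm, h.id]
      · simpa using h.known_id u
  have hheads : ∀ v, heads (inbox N (alg p E w) c r v) = (candidates σ (N.id v)).map N.id := by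
    intro v
    ext a
    rw [mem_heads]
    simp only [key, candidates, Finset.mem_map, Finset.mem_filter, Finset.mem_univ, true_and]
    constructor
    · rintro ⟨m, ⟨u, hu, rfl⟩, hb⟩
      exact ⟨u, hu, by simpa using hb⟩
    · rintro ⟨u, hu, rfl⟩
      exact ⟨_, ⟨u, hu, rfl⟩, rfl⟩
  have h1 : Rep N p coins ρ (2 * i + 1) (Gossip.step N (alg p E w) c r) σ := by
    refine h.step (fun v _ => ⟨rfl, rfl, rfl⟩) (fun v hv => ?_)
      (fun v _ a ha => known_subset v (h.known_mem v a ha))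
      (fun v _ a ha => known_subset v (h.known_cand v a ha))
    rw [h.state_even ho hv]
    exact ⟨by simp [update₁, h.time v hv], rfl, rfl, rfl, h.mem v, h.cand v, h.act v⟩
  refine ⟨h1, ?_⟩
  have hbox : ∀ v ∉ N.failed, heads (st p (Gossip.step N (alg p E w) c r v)).box =
      (candidates σ (N.id v)).map N.id := by
    intro v hv
    rw [h.state_even ho hv, ← hheads]
    rfl
  have hnew : ∀ v ∉ N.failed,
      (match (response N (alg p E w) (Gossip.step N (alg p E w) c r) r' v).bind
          fun m => m.ids.head? with
        | some t => if N.id v ≤ t then σ.cl v else none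
        | none => none) = newMem N (.trunc k) σ x v := by
    intro v hv
    simp only [newMem]
    rcases hm : σ.cl v with _ | a
    · rw [h1.response_none_odd ho hv]
      · simp
      · simp [action₂, h1.cl, hm]
    · obtain ⟨u, hu, rfl⟩ := hσ.cl_leader hm
      have hvmem : N.id v ∈ (candidates σ (N.id u)).map N.id :=
        Finset.mem_map_of_mem _ (by simp [candidates, hm])
      rw [h1.response_odd ho hv (t := .address (N.id u)) (u := u)]
      · simp only [reply₂, hbox u hu, Option.bind_some]
        rcases ht : threshold k ((candidates σ (N.id u)).map N.id) with _ | t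
        · have := threshold_eq_none ht
          rw [Finset.card_map] at this
          rw [if_neg]
          · simp
          · omega
        · obtain ⟨htS, htk⟩ := threshold_eq_some ht
          -- The threshold is the ID of a candidate that has just reported, so the leader is allowed
          -- to send it.
          have hkn : t ∈ (Gossip.step N (alg p E w) c r u).known := by
            rw [← hbox u hu, h.state_even ho hu] at htS
            obtain ⟨m, hm, hma⟩ := mem_heads.1 htS
            exact known_of_inbox hu hm (List.mem_of_head? hma)
          have hle : k ≤ (candidates σ (N.id u)).card := by
            rw [← htk, ← Finset.card_map N.id]
            exact Finset.card_filter_le _ _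
          simp only [Option.map_some, Option.bind_some, Message.restrict_of_subset
            (m := ⟨[t], []⟩) (by simpa using hkn), List.head?_cons, hle, true_and,
            candidates_rank]
          by_cases hlt : N.id v ≤ t
          · have := (le_threshold_iff htk hvmem).1 hlt
            simp only [hlt, if_true]
            exact (if_pos (by convert this)).symm
          · have := fun hh => hlt ((le_threshold_iff htk hvmem).2 hh)
            simp only [hlt, if_false]
            exact (if_neg (by convert this)).symm
      · simp [action₂, h1.cl, hm]
      · exact resolve_address.2 ⟨h1.known_cl hm, rfl⟩
      · exact hu
  refine h1.step (fun v hv => absStep_failed hv) (fun v hv => ?_) (fun v hv a ha => ?_)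
    (fun v hv a ha => ?_)
  · rw [h1.state_odd ho hv, absStep_mem hv, absStep_cand hv, absStep_act hv, ← hnew v hv]
    refine ⟨by simp only [update₂, h1.time v hv]; ring, rfl, rfl, rfl, ?_, rfl, h1.act v⟩
    simp only [update₂, h1.cl, h1.id]
  · rw [absStep_mem hv] at ha
    simp only [newMem, Option.bind_eq_some_iff] at ha
    obtain ⟨b, hb, hb'⟩ := ha
    split_ifs at hb'
    rw [← Option.some.inj hb']
    exact known_subset v (h1.known_cl hb)
  · rw [absStep_cand hv] at ha
    simp [newCand] at ha

theorem Rep.settle {all : Bool} (h : Rep N p coins ρ (2 * i) c σ)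
    (ho : p[i]? = some (.settle all)) (hσ : WF N σ) :
    Rep N p coins ρ (2 * i + 1) (Gossip.step N (alg p E w) c r) σ ∧
    Rep N p coins ρ (2 * (i + 1)) (Gossip.step N _ (Gossip.step N (alg p E w) c r) r')
      (absStep N (.settle all) σ x) := by
  have hsearch : ∀ v, (all || !(σ.act v)) = true ↔ searcher all σ v := by
    intro v; simp [searcher]
  have key : ∀ v m, m ∈ inbox N (alg p E w) c r v ↔
      ∃ u b, σ.mem u = some (N.id v) ∧ searcher all σ u ∧ σ.cand u = some b ∧
        m = ⟨[if all then b else N.id u, b], []⟩ := by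
    intro v m
    rw [mem_inbox]
    refine exists_congr fun u => ?_
    rw [h.push_even ho]
    have hkn : ∀ b, σ.cand u = some b → ∀ a ∈ (⟨[if all then b else N.id u, b], []⟩ : Message w).ids,
        a ∈ (c u).known := by
      intro b hb a ha
      have hb' := h.known_cand u b hb
      have hu' := h.known_id u
      simp only [List.mem_cons, List.not_mem_nil, or_false] at ha
      rcases ha with rfl | rfl
      · split_ifs <;> assumption
      · assumption
    constructor
    · rintro ⟨hu, t, m', ha, hr, rfl⟩
      simp only [action₁] at ha
      rw [h.mem, h.cand, h.act, h.id] at ha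
      rcases hm : σ.mem u with _ | a
      · simp [hm] at ha
      · rcases hb : σ.cand u with _ | b
        · simp [hm, hb] at ha
        · simp only [hm, hb, hsearch] at ha
          split_ifs at ha with hs
          all_goals
            simp only [Action.push.injEq] at ha
            obtain ⟨rfl, rfl⟩ := ha
            rw [resolve_address] at hr
            refine ⟨b, by rw [hr.2], (hsearch u).1 hs, rfl, ?_⟩
            have := hkn b hb
            rw [Message.restrict_of_subset]
            · simp_all
            · simp_all
    · rintro ⟨b, hm, hs, hb, rfl⟩
      have hu : u ∉ N.failed := fun hu => by simp [hσ.mem_failed u hu] at hm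
      refine ⟨hu, .address (N.id v), ⟨[if all then b else N.id u, b], []⟩, ?_,
        resolve_address.2 ⟨h.known_mem u _ hm, rfl⟩, (Message.restrict_of_subset ?_).symm⟩
      · simp only [action₁, h.mem, hm, h.cand, hb, h.act, hsearch, hs, if_true, h.id]
      · exact hkn b hb
  have hpairs : ∀ v, pairs (inbox N (alg p E w) c r v) = reports N all σ (N.id v) := by
    intro v
    ext q
    rw [mem_pairs]
    simp only [key, reports, Finset.mem_filter, Finset.mem_univ, true_and]
    constructor
    · rintro ⟨m, ⟨u, b, hu, hs, hb, rfl⟩, hq⟩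
      simp only [List.cons.injEq, and_true] at hq
      exact ⟨u, hu, hs, by rw [hb, hq.2], by rw [← hq.1, hq.2]⟩
    · rintro ⟨u, hu, hs, hb, hq⟩
      exact ⟨_, ⟨u, _, hu, hs, hb, rfl⟩, by rw [hq]⟩
  have h1 : Rep N p coins ρ (2 * i + 1) (Gossip.step N (alg p E w) c r) σ := by
    refine h.step (fun v _ => ⟨rfl, rfl, rfl⟩) (fun v hv => ?_)
      (fun v _ a ha => known_subset v (h.known_mem v a ha))
      (fun v _ a ha => known_subset v (h.known_cand v a ha))
    rw [h.state_even ho hv]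
    exact ⟨by simp [update₁, h.time v hv], rfl, rfl, rfl, h.mem v, h.cand v, h.act v⟩
  refine ⟨h1, ?_⟩
  have hbox : ∀ v ∉ N.failed, pairs (st p (Gossip.step N (alg p E w) c r v)).box =
      reports N all σ (N.id v) := by
    intro v hv
    rw [h.state_even ho hv, ← hpairs]
    rfl
  have hresp : ∀ v ∉ N.failed, ∀ a, σ.mem v = some a → searcher all σ v →
      ((response N (alg p E w) (Gossip.step N (alg p E w) c r) r' v).bind
          fun m => m.ids.head?) = (pickMin (reports N all σ a)).map fun q => (ofLex q).2 := by
    intro v hv a hm hs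
    obtain ⟨u, hu, rfl⟩ := hσ.mem_leader v a hm
    rw [h1.response_odd ho hv (t := .address (N.id u)) (u := u)]
    · simp only [reply₂, hbox u hu]
      rcases ht : pickMin (reports N all σ (N.id u)) with _ | q
      · simp
      -- The chosen leader was named in a report, hence its ID is known and survives the restriction
      -- of the answer.
      · have hkn : (ofLex q).2 ∈ (Gossip.step N (alg p E w) c r u).known := by
          have htS := pickMin_mem ht
          rw [← hbox u hu, h.state_even ho hu] at htS
          obtain ⟨m, hm, hma⟩ := mem_pairs.1 htS
          exact known_of_inbox hu hm (by simp [hma])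
        simp only [Option.map_some, Option.bind_some, Message.restrict_of_subset
            (m := ⟨[(ofLex q).2], []⟩) (by simpa using hkn), List.head?_cons]
    · simp only [action₂, h1.mem, hm, h1.act, hsearch, hs, if_true]
    · exact resolve_address.2 ⟨h1.known_mem v _ hm, rfl⟩
    · exact hu
  have hnew : ∀ v ∉ N.failed,
      (if (all || !(σ.act v)) = true then
        (response N (alg p E w) (Gossip.step N (alg p E w) c r) r' v).bind
          fun m => m.ids.head?
        else σ.mem v) = newMem N (.settle all) σ x v := by
    intro v hv
    simp only [newMem]
    rcases hm : σ.mem v with _ | a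
    · rw [h1.response_none_odd ho hv]
      · simp
      · simp [action₂, h1.mem, hm]
    · simp only [hsearch, Option.bind_some]
      by_cases hs : searcher all σ v
      · simp only [hs, if_true, hresp v hv a hm hs]
        exact if_pos ((hsearch v).2 hs)
      · simp only [hs, if_false]
        exact if_neg (fun hh => hs ((hsearch v).1 hh))
  refine h1.step (fun v hv => absStep_failed hv) (fun v hv => ?_) (fun v hv a ha => ?_)
    (fun v hv a ha => ?_)
  · rw [h1.state_odd ho hv, absStep_mem hv, absStep_cand hv, absStep_act hv, ← hnew v hv]
    refine ⟨by simp only [update₂, h1.time v hv]; ring, rfl, rfl, rfl, ?_, rfl, h1.act v⟩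
    simp only [update₂, h1.act, h1.mem]
  · rw [absStep_mem hv] at ha
    rw [← hnew v hv] at ha
    split_ifs at ha
    · obtain ⟨m, hm, hma⟩ := Option.bind_eq_some_iff.1 ha
      exact known_of_response hv hm (List.mem_of_head? hma)
    · exact known_subset v (h1.known_mem v a ha)
  · rw [absStep_cand hv] at ha
    simp [newCand] at ha

theorem WF.absStep (h : WF N σ) : WF N (absStep N o σ x) where
  mem_failed v hv := by rw [(absStep_failed hv).1]; exact h.mem_failed v hv
  cand_failed v hv := by rw [(absStep_failed hv).2.1]; exact h.cand_failed v hv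
  mem_leader v a ha := by
    by_cases hv : v ∈ N.failed
    · rw [(absStep_failed hv).1] at ha; exact h.mem_leader v a ha
    · rw [absStep_mem hv] at ha
      rcases o with e | _ | k | e | all | all | _ | _ | _
      all_goals simp only [newMem] at ha
      · split_ifs at ha
        exact ⟨v, hv, Option.some.inj ha⟩
      · exact h.mem_leader v a ha
      · obtain ⟨b, hb, hb'⟩ := Option.bind_eq_some_iff.1 ha
        split_ifs at hb'
        exact h.cl_leader (Option.some.inj hb' ▸ hb)
      · exact h.mem_leader v a ha
      · exact h.mem_leader v a ha
      · obtain ⟨b, hb, hb'⟩ := Option.bind_eq_some_iff.1 ha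
        split_ifs at hb'
        · obtain ⟨q, hq, rfl⟩ := Option.map_eq_some_iff.1 hb'
          have := pickMin_mem hq
          simp only [reports, Finset.mem_filter] at this
          obtain ⟨-, u, -, -, hu, -⟩ := this
          exact h.cand_leader u _ hu
        · exact h.mem_leader v a (Option.some.inj hb' ▸ hb)
      · split_ifs at ha
        · exact ⟨v, hv, Option.some.inj ha⟩
        · exact h.mem_leader v a ha
      · rw [Option.or_eq_some_iff] at ha
        rcases ha with ha | ⟨-, ha⟩
        · exact h.mem_leader v a ha
        · exact h.mem_leader _ a ha
      · exact h.mem_leader v a ha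
  cand_leader v a ha := by
    by_cases hv : v ∈ N.failed
    · rw [(absStep_failed hv).2.1] at ha; exact h.cand_leader v a ha
    · rw [absStep_cand hv] at ha
      rcases o with e | _ | k | e | all | all | _ | _ | _
      all_goals simp only [newCand] at ha
      · exact h.cand_leader v a ha
      · split_ifs at ha
        · have := pickMin_mem ha
          simp only [invitations, Finset.mem_filter] at this
          obtain ⟨-, u, hu, -⟩ := this
          exact h.mem_leader u a hu
        · exact h.cand_leader v a ha
      · cases ha
      · exact h.cand_leader v a ha
      · obtain ⟨b, hb, hb'⟩ := Option.bind_eq_some_iff.1 ha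
        split_ifs at hb'
        exact h.mem_leader _ a hb'
      · cases ha
      · exact h.cand_leader v a ha
      · exact h.cand_leader v a ha
      · exact h.cand_leader v a ha

/-- One operation of the algorithm has the effect described by `absStep`. -/
theorem Rep.op (h : Rep N p coins ρ (2 * i) c σ) (ho : p[i]? = some o) (hσ : WF N σ)
    (hne : o ≠ .share) (hx : ∀ v, x v = (coins v i, r v)) :
    Rep N p coins ρ (2 * (i + 1)) (Gossip.step N _ (Gossip.step N (alg p E w) c r) r')
      (Gossip.absStep N o σ x) := by
  rcases o with e | _ | k | e | all | all | _ | _ | _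
  · exact (h.elect ho hx).idle ho fun _ _ => rfl
  · exact (h.recruit ho hσ hx).idle ho fun _ _ => rfl
  · exact (h.trunc ho hσ).2
  · exact (h.flip ho hσ hx).idle ho fun _ _ => rfl
  · exact (h.search ho hσ hx).idle ho fun _ _ => rfl
  · exact (h.settle ho hσ).2
  · exact (h.crown ho hσ).idle ho fun _ _ => rfl
  · exact (h.join ho hσ hx).idle ho fun _ _ => rfl
  · exact absurd rfl hne

end Simulation

/-! ### The cost of an execution -/

section Traffic

variable {n w : ℕ} {N : Network n w} {A : Algorithm w} {c : Fin n → Node A} {r : Fin n → Fin n}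

theorem Option.length_toList_le {α : Type*} (a : Option α) : a.toList.length ≤ 1 := by
  cases a <;> simp

theorem traffic_length_le (v : Fin n) : (traffic N A c r v).length ≤ 2 := by
  unfold traffic
  rw [List.length_append, List.length_append, List.length_map, List.length_map]
  have h1 := Option.length_toList_le (pushOf N A c r v)
  have h2 := Option.length_toList_le (pullOf N A c r v)
  have h3 := Option.length_toList_le (response N A c r v)
  by_cases hp : pullOf N A c r v = none
  · have : response N A c r v = none := by simp [response, hp]
    rw [hp, this]
    simpa using h1.trans one_le_two
  · have : pushOf N A c r v = none := by
      unfold pullOf at hp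
      unfold pushOf
      split_ifs with hv
      · rfl
      · rw [if_neg hv] at hp
        rcases hA : A.action (c v).state with _ | ⟨t, m⟩ | t <;> simp_all
    rw [this]
    simp only [Option.toList_none, List.length_nil]
    omega

theorem traffic_eq_nil {v : Fin n} (h : v ∈ N.failed ∨ A.action (c v).state = .idle) :
    traffic N A c r v = [] := by
  unfold traffic response pushOf pullOf
  by_cases hv : v ∈ N.failed
  · simp [hv]
  · simp [hv, h.resolve_left hv]

theorem sum_traffic_le (S : Finset (Fin n))
    (h : ∀ v ∉ N.failed, v ∉ S → A.action (c v).state = .idle) :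
    ∑ v, (traffic N A c r v).length ≤ 2 * S.card := by
  calc ∑ v, (traffic N A c r v).length
      ≤ ∑ v, if v ∈ S then 2 else 0 := by
        refine Finset.sum_le_sum fun v _ => ?_
        by_cases hv : v ∈ S
        · simpa [hv] using traffic_length_le v
        · by_cases hf : v ∈ N.failed
          · simp [traffic_eq_nil (Or.inl hf)]
          · simp [traffic_eq_nil (Or.inr (h v hf hv))]
    _ = 2 * S.card := by simp [Finset.sum_ite_mem, mul_comm]

end Traffic

section Simulation

variable {n w E : ℕ} {N : Network n w} {p : List Op} {coins : Fin n → ℕ → Fin E → Bool}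
  {ρ : Fin n → Option (List Bool)} {i t : ℕ}
  {c : Fin n → Node (alg p E w)} {σ σ' : Abs n w} {o : Op} {r r' : Fin n → Fin n} {x : Input n E}

theorem Rep.sum_even (h : Rep N p coins ρ (2 * i) c σ) (ho : p[i]? = some o) (S : Finset (Fin n))
    (hS : ∀ v ∉ N.failed, v ∉ S → action₁ o (st p (c v)) = .idle) :
    ∑ v, (traffic N (alg p E w) c r v).length ≤ 2 * S.card :=
  sum_traffic_le S fun v hv hvS => by
    rw [alg_action_even ho (h.time v hv)]
    exact hS v hv hvS

theorem Rep.sum_odd (h : Rep N p coins ρ (2 * i + 1) c σ) (ho : p[i]? = some o)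
    (S : Finset (Fin n)) (hS : ∀ v ∉ N.failed, v ∉ S → action₂ o (st p (c v)) = .idle) :
    ∑ v, (traffic N (alg p E w) c r v).length ≤ 2 * S.card :=
  sum_traffic_le S fun v hv hvS => by
    rw [alg_action_odd ho (h.time v hv)]
    exact hS v hv hvS

/-- The factor 2 covers the request and the answer of a PULL. Answers are charged to the node that
asks, so the many answers of a leader need no separate count. -/
theorem Rep.cost (h : Rep N p coins ρ (2 * i) c σ) (ho : p[i]? = some o) (hσ : WF N σ)
    (hx : ∀ v, x v = (coins v i, r v)) :
    ∑ v, (traffic N (alg p E w) c r v).length +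
      ∑ v, (traffic N (alg p E w) (Gossip.step N _ c r) r' v).length ≤ 2 * opCost N o σ := by
  have hmem : ∀ v, v ∉ members σ → σ.mem v = none := by
    intro v hv
    by_contra hne
    exact hv (by simp [members, hne])
  have hidle : ∀ σ', Rep N p coins ρ (2 * i + 1) (Gossip.step N (alg p E w) c r) σ' →
      (∀ s : St w E, action₂ o s = .idle) →
      ∑ v, (traffic N (alg p E w) (Gossip.step N _ c r) r' v).length ≤ 0 := fun σ' h' ha => by
    simpa using h'.sum_odd (r := r') ho ∅ fun v _ _ => ha _
  rcases o with e | _ | k | e | all | all | _ | _ | _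
  · have h1 := h.sum_even (r := r) ho ∅ fun v _ _ => rfl
    have h2 := hidle _ (h.elect ho hx) fun _ => rfl
    simp only [opCost, Finset.card_empty] at *
    omega
  · have h1 := h.sum_even (r := r) ho (members σ) fun v _ hv => by
      simp [action₁, h.mem, hmem v hv]
    have h2 := hidle _ (h.recruit ho hσ hx) fun _ => rfl
    simp only [opCost] at *
    omega
  · have hcl : ∀ v, v ∉ (Finset.univ.filter fun v => σ.cl v ≠ none) → σ.cl v = none := by
      intro v hv
      by_contra hne
      exact hv (by simp [hne])
    have h1 := h.sum_even (r := r) ho (Finset.univ.filter fun v => σ.cl v ≠ none) fun v _ hv => by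
      simp [action₁, h.cl, hcl v hv]
    have h' := (h.trunc (r := r) (r' := r) (x := x) ho hσ).1
    have h2 := h'.sum_odd (r := r') ho (Finset.univ.filter fun v => σ.cl v ≠ none) fun v _ hv => by
      simp [action₂, h'.cl, hcl v hv]
    simp only [opCost] at *
    omega
  · have h1 := h.sum_even (r := r) ho (members σ) fun v _ hv => by
      simp [action₁, h.mem, hmem v hv]
    have h2 := hidle _ (h.flip ho hσ hx) fun _ => rfl
    simp only [opCost] at *
    omega
  · have h1 := h.sum_even (r := r) ho (members σ) fun v _ hv => by
      simp [action₁, h.mem, hmem v hv]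
    have h2 := hidle _ (h.search ho hσ hx) fun _ => rfl
    simp only [opCost] at *
    omega
  · have h1 := h.sum_even (r := r) ho (members σ) fun v _ hv => by
      simp [action₁, h.mem, hmem v hv]
    have h' := (h.settle (r := r) (r' := r) (x := x) ho hσ).1
    have h2 := h'.sum_odd (r := r') ho (members σ) fun v _ hv => by
      simp [action₂, h'.mem, hmem v hv]
    simp only [opCost] at *
    omega
  · have h1 := h.sum_even (r := r) ho (members σ) fun v _ hv => by
      simp [action₁, h.mem, hmem v hv]
    have h2 := hidle _ (h.crown (x := x) ho hσ) fun _ => rfl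
    simp only [opCost] at *
    omega
  · have h1 := h.sum_even (r := r) ho (outsiders N σ) fun v hv hvo => by
      rcases hm : σ.mem v with _ | a
      · exact absurd (by simp [outsiders, hv, hm]) hvo
      · simp [action₁, h.mem, hm]
    have h2 := hidle _ (h.join ho hσ hx) fun _ => rfl
    simp only [opCost] at *
    omega
  · have h1 := sum_traffic_le (N := N) (A := alg p E w) (c := c) (r := r) Finset.univ
      fun v _ hv => absurd (Finset.mem_univ v) hv
    have h2 := sum_traffic_le (N := N) (A := alg p E w) (c := Gossip.step N _ c r) (r := r')
      Finset.univ fun v _ hv => absurd (Finset.mem_univ v) hv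
    simp only [opCost, Finset.card_univ, Fintype.card_fin] at *
    omega

/-! ### Sizes of messages -/

/-- No node has a rumor of more than `b` bits. -/
def RumorLE (p : List Op) (b : ℕ) (c : Fin n → Node (alg p E w)) : Prop :=
  ∀ v s, (st p (c v)).rumor = some s → s.length ≤ b

/-- A message with at most two IDs and `b` data bits. -/
def Message.Short (b : ℕ) (m : Message w) : Prop := m.ids.length ≤ 2 ∧ m.data.length ≤ b

theorem action₁_short {b : ℕ} {s : St w E} (hs : ∀ l, s.rumor = some l → l.length ≤ b)
    {t : Target w} {m : Message w} (h : action₁ o s = .push t m) : m.Short b := by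
  rcases o with e | _ | k | e | all | all | _ | _ | _ <;> simp only [action₁] at h
  · cases h
  · split at h <;> simp at h
    rw [← h.2]; simp [Message.Short]
  · split at h <;> simp at h
    rw [← h.2]; simp [Message.Short]
  · split at h <;> simp at h
  · split_ifs at h
  · split at h
    · split_ifs at h <;> simp at h <;> rw [← h.2] <;> simp [Message.Short]
    · simp at h
  · split at h <;> simp at h
    rw [← h.2]; simp [Message.Short]
  · split at h <;> simp at h
  · split at h
    · rename_i hl
      simp only [Action.push.injEq] at h
      rw [← h.2]
      exact ⟨by simp, hs _ hl⟩
    · simp at h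

theorem action₂_ne_push {s : St w E} {t : Target w} {m : Message w} :
    action₂ o s ≠ .push t m := by
  intro h
  rcases o with e | _ | k | e | all | all | _ | _ | _ <;> simp only [action₂] at h
  any_goals cases h
  · split at h <;> simp at h
  · split at h
    · split_ifs at h
    · simp at h
  · split at h <;> simp at h

theorem action_short {b : ℕ} {s : St w E} (hs : ∀ l, s.rumor = some l → l.length ≤ b)
    {t : Target w} {m : Message w} (h : (alg p E w).action s = .push t m) : m.Short b := by
  simp only [alg] at h
  split_ifs at h
  · exact action₁_short hs h
  · exact absurd h action₂_ne_push

theorem reply₁_short {b : ℕ} (hb : 1 ≤ b) {s : St w E}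
    {m : Message w} (h : reply₁ o s = some m) : m.Short b := by
  rcases o with e | _ | k | e | all | all | _ | _ | _ <;> simp only [reply₁] at h
  any_goals cases h
  · exact ⟨by simp, by simpa using hb⟩
  · split_ifs at h
    obtain ⟨a, -, rfl⟩ := Option.map_eq_some_iff.1 h
    simp [Message.Short]
  · obtain ⟨a, -, rfl⟩ := Option.map_eq_some_iff.1 h
    simp [Message.Short]

theorem reply₂_short {b : ℕ} {s : St w E} (hs : ∀ l, s.rumor = some l → l.length ≤ b)
    {m : Message w} (h : reply₂ o s = some m) : m.Short b := by
  rcases o with e | _ | k | e | all | all | _ | _ | _ <;> simp only [reply₂] at h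
  any_goals cases h
  · obtain ⟨a, -, rfl⟩ := Option.map_eq_some_iff.1 h
    simp [Message.Short]
  · obtain ⟨a, -, rfl⟩ := Option.map_eq_some_iff.1 h
    simp [Message.Short]
  · obtain ⟨a, ha, rfl⟩ := Option.map_eq_some_iff.1 h
    exact ⟨by simp, hs _ ha⟩

theorem reply_short {b : ℕ} (hb : 1 ≤ b) {s : St w E} (hs : ∀ l, s.rumor = some l → l.length ≤ b)
    {m : Message w} (h : (alg p E w).reply s = some m) : m.Short b := by
  simp only [alg] at h
  split_ifs at h
  · exact reply₁_short hb h
  · exact reply₂_short hs h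

theorem Message.Short.restrict {b : ℕ} {m : Message w} (h : m.Short b)
    (known : Finset (BitVec w)) : (m.restrict known).Short b :=
  ⟨(List.length_filter_le _ _).trans h.1, h.2⟩

theorem Message.Short.size_le {b : ℕ} {m : Message w} (h : m.Short b) :
    m.size ≤ 1 + 2 * w + b := by
  unfold Message.size
  have := Nat.mul_le_mul_right w h.1
  have := h.2
  omega

theorem pushOf_short {b : ℕ} (hc : RumorLE p b c) {v u : Fin n} {m : Message w}
    (h : pushOf N (alg p E w) c r v = some (u, m)) : m.Short b := by
  obtain ⟨-, t, m', ha, -, rfl⟩ := pushOf_eq_some.1 h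
  exact (action_short (hc v) ha).restrict _

theorem replyOf_short {b : ℕ} (hb : 1 ≤ b) (hc : RumorLE p b c) {u : Fin n} {m : Message w}
    (h : replyOf N (alg p E w) c u = some m) : m.Short b := by
  unfold replyOf at h
  split_ifs at h
  obtain ⟨m', hm', rfl⟩ := Option.map_eq_some_iff.1 h
  exact (reply_short hb (hc u) hm').restrict _

theorem response_short {b : ℕ} (hb : 1 ≤ b) (hc : RumorLE p b c) {v : Fin n} {m : Message w}
    (h : response N (alg p E w) c r v = some m) : m.Short b := by
  obtain ⟨u, -, hu⟩ := Option.bind_eq_some_iff.1 h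
  exact replyOf_short hb hc hu

theorem traffic_short {b : ℕ} (hb : 1 ≤ b) (hc : RumorLE p b c) {v : Fin n} {m : Message w}
    (h : m ∈ traffic N (alg p E w) c r v) : m.Short b := by
  unfold traffic at h
  simp only [List.mem_append, List.mem_map, Option.mem_toList, Prod.exists] at h
  rcases h with (⟨u, m', h, rfl⟩ | ⟨u, h, rfl⟩) | h
  · exact pushOf_short hc h
  · simp [Message.Short, Message.request]
  · exact response_short hb hc h

theorem rumor_update₁ {s : St w E} {M : Multiset (Message w)} {a : Option (Message w)}
    {l : List Bool} (h : (update₁ o s M a).rumor = some l) :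
    s.rumor = some l ∨ ∃ m ∈ M, m.data = l := by
  rcases o with e | _ | k | e | all | all | _ | _ | _
  all_goals try exact Or.inl h
  simp only [update₁] at h
  rw [Option.or_eq_some_iff] at h
  rcases h with h | ⟨-, h⟩
  · exact Or.inl h
  · have := List.mem_of_head? h
    exact Or.inr (by simpa using this)

theorem rumor_update₂ {s : St w E} {a : Option (Message w)}
    {l : List Bool} (h : (update₂ o s a).rumor = some l) :
    s.rumor = some l ∨ ∃ m, a = some m ∧ m.data = l := by
  rcases o with e | _ | k | e | all | all | _ | _ | _
  all_goals try exact Or.inl h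
  simp only [update₂] at h
  rw [Option.or_eq_some_iff] at h
  rcases h with h | ⟨-, h⟩
  · exact Or.inl h
  · exact Or.inr (Option.map_eq_some_iff.1 h)

theorem rumor_update {s : St w E} {M : Multiset (Message w)} {a : Option (Message w)}
    {l : List Bool} (h : ((alg p E w).update s M a : St w E).rumor = some l) :
    s.rumor = some l ∨ (∃ m ∈ M, m.data = l) ∨ ∃ m, a = some m ∧ m.data = l := by
  simp only [alg] at h
  split_ifs at h
  · exact (rumor_update₁ h).imp_right Or.inl
  · exact (rumor_update₂ h).imp_right Or.inr

theorem RumorLE.step {b : ℕ} (hb : 1 ≤ b) (hc : RumorLE p b c) :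
    RumorLE p b (Gossip.step N (alg p E w) c r) := by
  intro v l hl
  by_cases hv : v ∈ N.failed
  · rw [step_failed hv] at hl; exact hc v l hl
  · rw [st, step_state hv] at hl
    rcases rumor_update hl with h | ⟨m, hm, rfl⟩ | ⟨m, hm, rfl⟩
    · exact hc v l h
    · obtain ⟨u, hu⟩ := mem_inbox.1 hm
      exact (pushOf_short hc hu).2
    · exact (response_short hb hc hm).2

/-! ### Spreading the rumor inside a cluster -/

theorem Rep.share_even (h : Rep N p coins ρ (2 * i) c σ) (ho : p[i]? = some .share) :
    ∃ ρ', Rep N p coins ρ' (2 * i + 1) (Gossip.step N (alg p E w) c r) σ ∧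
      ∀ v ∉ N.failed, ρ' v = (ρ v).or
        (((inbox N (alg p E w) c r v).map Message.data).toList.head?) := by
  refine ⟨fun v => (st p (Gossip.step N (alg p E w) c r v)).rumor, ?_, fun v hv => ?_⟩
  · have hs := fun v hv => h.state_even (r := r) ho (v := v) hv
    have hk := fun v => known_subset (N := N) (A := alg p E w) (c := c) (r := r) v
    constructor
    · intro v hv; rw [hs v hv]; simp [update₁, h.time v hv]
    all_goals intro v
    · by_cases hv : v ∈ N.failed
      · rw [step_failed hv]; exact h.id v
      · rw [hs v hv]; exact h.id v
    · by_cases hv : v ∈ N.failed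
      · rw [step_failed hv]; exact h.coin v
      · rw [hs v hv]; exact h.coin v
    · by_cases hv : v ∈ N.failed
      · rw [step_failed hv]; exact h.mem v
      · rw [hs v hv]; exact h.mem v
    · by_cases hv : v ∈ N.failed
      · rw [step_failed hv]; exact h.cand v
      · rw [hs v hv]; exact h.cand v
    · by_cases hv : v ∈ N.failed
      · rw [step_failed hv]; exact h.act v
      · rw [hs v hv]; exact h.act v
    · rfl
    · exact hk v (h.known_id v)
    · exact fun a ha => hk v (h.known_mem v a ha)
    · exact fun a ha => hk v (h.known_cand v a ha)
  · simp only [h.state_even (r := r) ho hv, update₁, h.rumor]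

/-- One informed member suffices: it PUSHes the rumor to the leader, and in the second round every
member PULLs it. That the leader belongs to its own cluster shows that it has survived. -/
theorem Rep.share (h : Rep N p coins ρ (2 * i) c σ) (ho : p[i]? = some .share) (hσ : WF N σ)
    {R : List Bool} (hR : ∀ v, ρ v = none ∨ ρ v = some R) :
    (∀ v, (st p (Gossip.step N _ (Gossip.step N (alg p E w) c r) r' v)).mem = σ.mem v) ∧
    ∀ u s v, σ.mem u = some (N.id u) → σ.mem s = some (N.id u) → ρ s = some R →
      σ.mem v = some (N.id u) →
      (st p (Gossip.step N _ (Gossip.step N (alg p E w) c r) r' v)).rumor = some R := by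
  obtain ⟨ρ', h1, hρ'⟩ := h.share_even (r := r) ho
  have hdata : ∀ v, ∀ m ∈ inbox N (alg p E w) c r v, m.data = R := by
    intro v m hm
    obtain ⟨u, hu⟩ := mem_inbox.1 hm
    obtain ⟨hu', t, m', ha, -, rfl⟩ := (h.push_even ho).1 hu
    simp only [action₁] at ha
    split at ha
    · rename_i l _ hl
      rw [h.rumor] at hl
      have : l = R := by
        rcases hR u with h0 | h0
        · rw [h0] at hl; cases hl
        · rw [h0] at hl; exact (Option.some.inj hl).symm
      simp only [Action.push.injEq] at ha
      rw [← ha.2, ← this]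
      rfl
    · simp at ha
  have hR' : ∀ v ∉ N.failed, ρ' v = none ∨ ρ' v = some R := by
    intro v hv
    rw [hρ' v hv]
    rcases hh : ((inbox N (alg p E w) c r v).map Message.data).toList.head? with _ | l
    · simpa using hR v
    · have hl := List.mem_of_head? hh
      simp only [Multiset.mem_toList, Multiset.mem_map] at hl
      obtain ⟨m, hm, rfl⟩ := hl
      rw [hdata v m hm]
      rcases hR v with h0 | h0 <;> simp [h0]
  refine ⟨fun v => ?_, fun u s v hu hs hρs hv => ?_⟩
  · by_cases hv : v ∈ N.failed
    · rw [step_failed hv]; exact h1.mem v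
    · rw [h1.state_odd ho hv]; exact h1.mem v
  · have hnf : ∀ z, σ.mem z ≠ none → z ∉ N.failed := fun z hz hf => hz (hσ.mem_failed z hf)
    have hvf := hnf v (by simp [hv])
    have huf := hnf u (by simp [hu])
    have hsf := hnf s (by simp [hs])
    -- The message of `s` reaches the leader, possibly from itself, so its inbox contains a rumor;
    -- whichever rumor it picks is `R`.
    have hlead : ρ' u = some R := by
      refine (hR' u huf).resolve_left fun h0 => ?_
      rw [hρ' u huf, Option.or_eq_none_iff, List.head?_eq_none_iff] at h0
      have hin : Message.restrict ⟨[], R⟩ (c s).known ∈ inbox N (alg p E w) c r u := by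
        refine mem_inbox.2 ⟨s, (h.push_even ho).2 ⟨hsf, .address (N.id u), ⟨[], R⟩, ?_,
          resolve_address.2 ⟨h.known_mem s _ hs, rfl⟩, rfl⟩⟩
        simp [action₁, h.mem, hs, h.rumor, hρs]
      have := Multiset.mem_map_of_mem Message.data hin
      rw [← Multiset.mem_toList, h0.2] at this
      simp at this
    rw [h1.state_odd ho hvf, h1.response_odd ho hvf (t := .address (N.id u)) (u := u)]
    · simp only [update₂, reply₂, h1.rumor, hlead, Option.map_some, Message.restrict]
      rcases hR' v hvf with h0 | h0 <;> simp [h0]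
    · simp [action₂, h1.mem, hv]
    · exact resolve_address.2 ⟨h1.known_mem v _ hv, rfl⟩
    · exact huf

end Simulation

/-! ### Executions of a program -/

section Exec

variable {n w E : ℕ} (N : Network n w)

/-- The effect of a program on the clustering. -/
noncomputable def exec : List Op → (ℕ → Input n E) → Abs n w → Abs n w
  | [], _, σ => σ
  | o :: p, ξ, σ => exec p (fun i => ξ (i + 1)) (absStep N o σ (ξ 0))

/-- The probability that the result of a program violates `Q`. -/
noncomputable def fail (E : ℕ) : List Op → Abs n w → (Abs n w → Prop) → ℝ
  | [], σ, Q => ind (¬ Q σ)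
  | o :: p, σ, Q => avg fun x : Input n E => fail E p (absStep N o σ x) Q

instance (n E : ℕ) : Nonempty (Input n E) := ⟨fun v => (fun _ => false, v)⟩

/-- A finite sequence of inputs, continued arbitrarily. -/
def extend {T : ℕ} (ξ : Fin T → Input n E) (i : ℕ) : Input n E :=
  if h : i < T then ξ ⟨i, h⟩ else fun v => (fun _ => false, v)

/-- Successive inputs are independent, so splitting off the first one turns the average over the
whole sequence into the nested averages of `fail`. Surplus inputs are allowed because the final
`share` has one too. -/
theorem avg_exec (p : List Op) (σ : Abs n w) (Q : Abs n w → Prop) {T : ℕ} (hT : p.length ≤ T) :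
    avg (fun ξ : Fin T → Input n E => ind (¬ Q (exec N p (extend ξ) σ))) = fail N E p σ Q := by
  induction p generalizing σ T with
  | nil => simp only [exec, fail]; exact avg_const _
  | cons o p ih =>
    obtain ⟨T, rfl⟩ : ∃ T', T = T' + 1 := ⟨T - 1, by simp at hT; omega⟩
    rw [← avg_equiv (Fin.consEquiv fun _ => Input n E), avg_prod, fail]
    congr 1
    funext x
    rw [← ih _ (T := T) (by simpa using hT)]
    congr 1
    funext ξ
    have h0 : extend ((Fin.consEquiv fun _ => Input n E) (x, ξ)) 0 = x := by
      simp [extend, Fin.consEquiv]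
    have h1 : (fun i => extend ((Fin.consEquiv fun _ => Input n E) (x, ξ)) (i + 1)) = extend ξ := by
      funext i
      unfold extend
      by_cases h : i < T
      · have h' : i + 1 < T + 1 := by omega
        rw [dif_pos h, dif_pos h']
        rfl
      · have h' : ¬ i + 1 < T + 1 := by omega
        rw [dif_neg h, dif_neg h']
    rw [exec, h0, h1]

/-- From every clustering with `P`, the program leads to a clustering with `Q`, except with
probability `δ`. -/
def Hoare (E : ℕ) (P : Abs n w → Prop) (p : List Op) (Q : Abs n w → Prop) (δ : ℝ) : Prop :=
  ∀ σ, P σ → fail N E p σ Q ≤ δ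

variable {N} {P Q R : Abs n w → Prop} {p q : List Op} {δ δ' : ℝ}

theorem fail_le_one (p : List Op) (σ : Abs n w) : fail N E p σ Q ≤ 1 := by
  induction p generalizing σ with
  | nil => exact ind_le_one _
  | cons o p ih => exact (avg_mono fun x => ih _).trans (avg_const 1).le

/-- A union bound along the program: if `Q` is violated in the middle, the failure probability of
the rest is bounded by 1; otherwise it is at most `δ'`. -/
theorem fail_append_le (h : Hoare N E Q q R δ') (h0 : 0 ≤ δ') (p : List Op) (σ : Abs n w) :
    fail N E (p ++ q) σ R ≤ fail N E p σ Q + δ' := by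
  induction p generalizing σ with
  | nil =>
    simp only [List.nil_append, fail]
    by_cases hQ : Q σ
    · linarith [h σ hQ, ind_nonneg (¬ Q σ)]
    · rw [ind_true hQ]
      linarith [fail_le_one (N := N) (E := E) (Q := R) q σ]
  | cons o p ih =>
    simp only [List.cons_append, fail]
    refine (avg_mono fun x => ih _).trans ?_
    rw [avg_add, avg_const]

theorem Hoare.append (h1 : Hoare N E P p Q δ) (h2 : Hoare N E Q q R δ') (h0 : 0 ≤ δ') :
    Hoare N E P (p ++ q) R (δ + δ') := fun σ hσ =>
  (fail_append_le h2 h0 p σ).trans (by linarith [h1 σ hσ])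

theorem Hoare.nil (h : ∀ σ, P σ → Q σ) : Hoare N E P [] Q 0 := fun σ hσ => by
  rw [fail, ind_false (not_not.2 (h σ hσ))]

theorem fail_mono (h : ∀ σ, Q σ → R σ) (p : List Op) (σ : Abs n w) :
    fail N E p σ R ≤ fail N E p σ Q := by
  induction p generalizing σ with
  | nil => exact ind_mono fun hn hq => hn (h σ hq)
  | cons o p ih => exact avg_mono fun x => ih _

theorem Hoare.mono {P' : Abs n w → Prop} (h : Hoare N E P p Q δ) (hP : ∀ σ, P' σ → P σ)
    (hQ : ∀ σ, Q σ → R σ) (hδ : δ ≤ δ') : Hoare N E P' p R δ' := fun σ hσ =>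
  (fail_mono hQ p σ).trans ((h σ (hP σ hσ)).trans hδ)

/-- One operation with a random outcome. -/
theorem Hoare.single {o : Op}
    (h : ∀ σ, P σ → pr (fun x : Input n E => ¬ Q (absStep N o σ x)) ≤ δ) :
    Hoare N E P [o] Q δ := fun σ hσ => h σ hσ

/-- One operation whose outcome is certain to have a property. -/
theorem Hoare.sure {o : Op} (h : ∀ σ, P σ → ∀ x : Input n E, Q (absStep N o σ x)) :
    Hoare N E P [o] Q 0 := Hoare.single fun σ hσ => by
  refine (avg_mono fun x => (ind_false (not_not.2 (h σ hσ x))).le).trans ?_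
  rw [avg_const]

/-- A loop. -/
theorem Hoare.loop {P : ℕ → Abs n w → Prop} {p : ℕ → List Op} (h0 : 0 ≤ δ) (m : ℕ)
    (h : ∀ j < m, Hoare N E (P j) (p j) (P (j + 1)) δ) :
    Hoare N E (P 0) ((List.range m).flatMap p) (P m) (m * δ) := by
  induction m with
  | zero => simpa using Hoare.nil fun σ hσ => hσ
  | succ m ih =>
    rw [List.range_succ, List.flatMap_append, List.flatMap_singleton]
    refine ((ih fun j hj => h j (by omega)).append (h m (by omega)) h0).mono
      (fun _ hσ => hσ) (fun _ hσ => hσ) ?_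
    push_cast
    linarith

/-- `m` repetitions of an operation, as a function of all inputs together. -/
theorem fail_replicate (o : Op) (m : ℕ) (p : List Op) (σ : Abs n w) :
    fail N E (List.replicate m o ++ p) σ Q = avg fun ξ : Fin m → Input n E =>
      fail N E p (exec N (List.replicate m o) (extend ξ) σ) Q := by
  induction m generalizing σ with
  | zero => simp only [List.replicate_zero, List.nil_append, exec]; exact (avg_const _).symm
  | succ m ih =>
    rw [← avg_equiv (Fin.consEquiv fun _ => Input n E), avg_prod, List.replicate_succ,
      List.cons_append, fail]
    congr 1
    funext x
    rw [ih]
    congr 1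
    funext ξ
    have h0 : extend ((Fin.consEquiv fun _ => Input n E) (x, ξ)) 0 = x := by
      simp [extend, Fin.consEquiv]
    have h1 : (fun i => extend ((Fin.consEquiv fun _ => Input n E) (x, ξ)) (i + 1)) = extend ξ := by
      funext i
      unfold extend
      by_cases h : i < m
      · have h' : i + 1 < m + 1 := by omega
        rw [dif_pos h, dif_pos h']
        rfl
      · have h' : ¬ i + 1 < m + 1 := by omega
        rw [dif_neg h, dif_neg h']
    rw [exec, h0, h1]

end Exec

/-! ### From clusterings to executions -/

section Reduction

variable {n w E : ℕ} {N : Network n w} {p q : List Op}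
  {sources : Finset (Fin n)} {rumor : List Bool} {ω : Outcome n (alg p E w)}

/-- The private random bits of a node, arranged by operations. -/
noncomputable def coinsOf (ω : Outcome n (alg p E w)) (v : Fin n) (i : ℕ) (j : Fin E) : Bool :=
  if h : i < p.length then ω.1 v (finProdFinEquiv (⟨i, h⟩, j)) else false

/-- The inputs of the operations. -/
noncomputable def inputsOf (ω : Outcome n (alg p E w)) (i : ℕ) : Input n E := fun v =>
  (coinsOf ω v i, contacts ω (2 * i) v)

/-- The inputs that are relevant, and all other random contacts. -/
noncomputable def outcomeEquiv (n w E : ℕ) (p : List Op) : Outcome n (alg p E w) ≃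
    (Fin p.length → Input n E) × (Fin p.length → Fin n → Fin n) where
  toFun ω := (fun i v => (fun j => ω.1 v (finProdFinEquiv (i, j)), ω.2 (finProdFinEquiv (i, 0)) v),
    fun i v => ω.2 (finProdFinEquiv (i, 1)) v)
  invFun y := (fun v k => (y.1 (finProdFinEquiv.symm k).1 v).1 (finProdFinEquiv.symm k).2,
    fun t v => if (finProdFinEquiv.symm t).2 = (0 : Fin 2) then (y.1 (finProdFinEquiv.symm t).1 v).2
      else y.2 (finProdFinEquiv.symm t).1 v)
  left_inv ω := by
    refine Prod.ext ?_ ?_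
    · funext v k
      exact congrArg (ω.1 v) (finProdFinEquiv.apply_symm_apply k)
    · funext t v
      obtain ⟨⟨i, j⟩, rfl⟩ := (finProdFinEquiv (m := p.length) (n := 2)).surjective t
      simp only [Equiv.symm_apply_apply]
      fin_cases j <;> rfl
  right_inv y := by
    refine Prod.ext ?_ ?_
    · funext i v
      refine Prod.ext ?_ ?_
      · funext j
        simp
      · simp
    · funext i v
      simp

theorem inputsOf_eq (ω : Outcome n (alg p E w)) :
    inputsOf ω = extend (outcomeEquiv n w E p ω).1 := by
  funext i v
  unfold inputsOf extend contacts coinsOf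
  by_cases h : i < p.length
  · have h2 : 2 * i < (alg p E w).rounds := by simp only [alg]; omega
    simp only [h, h2, dif_pos, outcomeEquiv, Equiv.coe_fn_mk]
    refine Prod.ext rfl ?_
    refine congrArg (fun t => ω.2 t v) (Fin.ext ?_)
    simp [finProdFinEquiv]
  · have h2 : ¬ 2 * i < (alg p E w).rounds := by simp only [alg]; omega
    simp only [h, h2, dif_neg, not_false_eq_true]

/-- The second round of an operation contacts only known addresses. Hence the random contacts of odd
rounds form a separate factor of the probability space and average out. -/
theorem pr_exec (Q : Abs n w → Prop) (σ : Abs n w) (hq : q.length ≤ p.length) :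
    pr (fun ω : Outcome n (alg p E w) => ¬ Q (exec N q (inputsOf ω) σ)) = fail N E q σ Q := by
  rw [pr, ← avg_exec N q σ Q hq]
  simp only [inputsOf_eq]
  rw [avg_equiv (outcomeEquiv n w E p)
    (fun y => ind (¬ Q (exec N q (extend y.1) σ))), avg_prod]
  congr 1
  funext ξ
  have : Nonempty (Fin p.length → Fin n → Fin n) := ⟨fun _ v => v⟩
  exact avg_const (α := Fin p.length → Fin n → Fin n) (ind ¬ Q (exec N q (extend ξ) σ))

/-- Initially there are no clusters. -/
def Abs.init (n w : ℕ) : Abs n w := ⟨fun _ => none, fun _ => none, fun _ => false, 0⟩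

theorem Rep.init : Rep N p (coinsOf ω) (fun v => if v ∈ sources then some rumor else none) (2 * 0)
    (run N (alg p E w) sources rumor ω (2 * 0)) (Abs.init n w) where
  time v _ := rfl
  id v := rfl
  coin v := rfl
  mem v := rfl
  cand v := rfl
  act v := rfl
  rumor v := rfl
  known_id v := by simp [run]
  known_mem v a h := by cases h
  known_cand v a h := by cases h

theorem WF.init : WF N (Abs.init n w) where
  mem_failed v _ := rfl
  cand_failed v _ := rfl
  mem_leader v a h := by cases h
  cand_leader v a h := by cases h

/-- The number of messages of one round of an execution. -/
noncomputable def roundCount (N : Network n w) (sources : Finset (Fin n)) (rumor : List Bool)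
    (ω : Outcome n (alg p E w)) (t : ℕ) : ℕ :=
  ∑ v, (traffic N (alg p E w) (run N (alg p E w) sources rumor ω t) (contacts ω t) v).length

/-- The function `ρ` is arbitrary and stays unchanged, and `inputsOf` does not involve it: before
`share` the clustering is independent of sources and rumor. This allows one cluster to serve all of
them on the same outcome. -/
theorem simulate {ρ : Fin n → Option (List Bool)} (i : ℕ) (σ : Abs n w)
    (hp : ∀ j, ∀ o, q[j]? = some o → p[i + j]? = some o)
    (hq : Op.share ∉ q) (hσ : WF N σ)
    (h : Rep N p (coinsOf ω) ρ (2 * i) (run N (alg p E w) sources rumor ω (2 * i)) σ) :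
    Rep N p (coinsOf ω) ρ (2 * (i + q.length))
      (run N (alg p E w) sources rumor ω (2 * (i + q.length)))
      (exec N q (fun j => inputsOf ω (i + j)) σ) ∧
    WF N (exec N q (fun j => inputsOf ω (i + j)) σ) ∧
    ∑ t ∈ Finset.range (2 * (i + q.length)), roundCount N sources rumor ω t + 2 * σ.cost ≤
      ∑ t ∈ Finset.range (2 * i), roundCount N sources rumor ω t +
        2 * (exec N q (fun j => inputsOf ω (i + j)) σ).cost := by
  induction q generalizing i σ with
  | nil => exact ⟨h, hσ, le_rfl⟩
  | cons o q ih =>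
    have ho : p[i]? = some o := by simpa using hp 0 o rfl
    have hne : o ≠ .share := fun h' => hq (by simp [h'])
    have h' : Rep N p (coinsOf ω) ρ (2 * (i + 1))
        (run N (alg p E w) sources rumor ω (2 * (i + 1))) (absStep N o σ (inputsOf ω i)) :=
      h.op (r := contacts ω (2 * i)) (r' := contacts ω (2 * i + 1)) ho hσ hne fun v => rfl
    have hcost := h.cost (r := contacts ω (2 * i)) (r' := contacts ω (2 * i + 1))
      (x := inputsOf ω i) ho hσ fun v => rfl
    obtain ⟨h1, h2, h3⟩ := ih (i + 1) (absStep N o σ (inputsOf ω i))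
      (fun j o' hj => by
        have := hp (j + 1) o' (by simpa using hj)
        rwa [show i + 1 + j = i + (j + 1) by ring])
      (fun hs => hq (List.mem_cons_of_mem _ hs)) hσ.absStep h'
    have e1 : i + (o :: q).length = i + 1 + q.length := by simp; ring
    have e2 : exec N (o :: q) (fun j => inputsOf ω (i + j)) σ =
        exec N q (fun j => inputsOf ω (i + 1 + j)) (absStep N o σ (inputsOf ω i)) := by
      rw [exec]
      congr 1
      funext j
      congr 1
      ring
    rw [e1, e2]
    refine ⟨h1, h2, ?_⟩
    have e3 : ∑ t ∈ Finset.range (2 * (i + 1)), roundCount N sources rumor ω t =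
        ∑ t ∈ Finset.range (2 * i), roundCount N sources rumor ω t +
          roundCount N sources rumor ω (2 * i) + roundCount N sources rumor ω (2 * i + 1) := by
      rw [show 2 * (i + 1) = 2 * i + 1 + 1 by ring, Finset.sum_range_succ, Finset.sum_range_succ]
    have e4 : roundCount N sources rumor ω (2 * i) + roundCount N sources rumor ω (2 * i + 1) ≤
      2 * opCost N o σ := hcost
    have e5 : (absStep N o σ (inputsOf ω i)).cost = σ.cost + opCost N o σ := rfl
    omega

theorem RumorLE.run {b : ℕ} (hb : 1 ≤ b) (hr : rumor.length ≤ b) (t : ℕ) :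
    RumorLE p b (run N (alg p E w) sources rumor ω t) := by
  induction t with
  | zero =>
    intro v l hl
    simp only [Gossip.run, st, alg] at hl
    split_ifs at hl
    rw [← Option.some.inj hl]
    exact hr
  | succ t ih => exact ih.step hb

/-- A message has at most two IDs, and its data are empty, the rumor, or one coin bit; the coin bit
is why the rumor must not be empty. -/
theorem bitCount_le (hr : 1 ≤ rumor.length) :
    bitCount N (alg p E w) sources rumor ω ≤
      messageCount N (alg p E w) sources rumor ω * (1 + 2 * w + rumor.length) := by
  unfold bitCount messageCount
  rw [Finset.sum_mul]
  refine Finset.sum_le_sum fun t _ => ?_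
  rw [Finset.sum_mul]
  refine Finset.sum_le_sum fun v _ => ?_
  have h := List.sum_le_card_nsmul ((traffic N (alg p E w) (run N (alg p E w) sources rumor ω t)
    (contacts ω t) v).map Message.size) (1 + 2 * w + rumor.length) (by
      intro s hs
      obtain ⟨m, hm, rfl⟩ := List.mem_map.1 hs
      exact (traffic_short hr (RumorLE.run hr le_rfl t) hm).size_le)
  simpa using h

/-- There is exactly one cluster. -/
def OneCluster (N : Network n w) (u : Fin n) (σ : Abs n w) : Prop :=
  σ.mem u = some (N.id u) ∧ ∀ v, σ.mem v = none ∨ σ.mem v = some (N.id u)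

/-- An execution of a program that ends with one cluster, in which the rumor is shared. -/
theorem share_run (hq : Op.share ∉ q) {ω : Outcome n (alg (q ++ [.share]) E w)}
    {σ : Abs n w} (hσ : σ = exec N q (inputsOf ω) (Abs.init n w)) :
    WF N σ ∧
    (∀ (sources : Finset (Fin n)) (rumor : List Bool) (l v : Fin n), v ∉ N.failed →
      (Follows N (alg (q ++ [.share]) E w) sources rumor ω l v ↔ σ.mem v = some (N.id l))) ∧
    (∀ (sources : Finset (Fin n)) (rumor : List Bool) (u s v : Fin n),
      σ.mem u = some (N.id u) → σ.mem s = some (N.id u) → s ∈ sources →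
      σ.mem v = some (N.id u) → Informed N (alg (q ++ [.share]) E w) sources rumor ω v) ∧
    ∀ (sources : Finset (Fin n)) (rumor : List Bool),
      messageCount N (alg (q ++ [.share]) E w) sources rumor ω ≤ 2 * (σ.cost + 2 * n) := by
  have key := fun (sources : Finset (Fin n)) (rumor : List Bool) =>
    simulate (N := N) (p := q ++ [.share]) (q := q) (sources := sources) (rumor := rumor) (ω := ω)
      0 (Abs.init n w) (fun j o hj => by
        rw [zero_add, List.getElem?_append_left]
        · exact hj
        · exact (List.getElem?_eq_some_iff.1 hj).1) hq WF.init Rep.init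
  simp only [zero_add] at key
  have hσ' : exec N q (fun j => inputsOf ω j) (Abs.init n w) = σ := hσ.symm
  simp only [hσ'] at key
  have ho : (q ++ [Op.share])[q.length]? = some .share := by simp
  have hT : (alg (q ++ [Op.share]) E w).rounds = 2 * q.length + 1 + 1 := by
    simp [alg]; ring
  have hWF := (key ∅ []).2.1
  have hshare := fun (sources : Finset (Fin n)) (rumor : List Bool) =>
    (key sources rumor).1.share (r := contacts ω (2 * q.length))
      (r' := contacts ω (2 * q.length + 1)) ho hWF (R := rumor) fun v => by
        by_cases hv : v ∈ sources <;> simp [hv]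
  refine ⟨hWF, fun sources rumor l v hv => ?_, fun sources rumor u s v hu hs hss hv => ?_,
    fun sources rumor => ?_⟩
  · have h1 := (hshare sources rumor).1 v
    unfold Follows
    rw [hT]
    change (st _ (run N _ sources rumor ω (2 * q.length + 1 + 1) v)).mem = _ ∧ _ ↔ _
    have h1' : (st _ (run N (alg (q ++ [Op.share]) E w) sources rumor ω
      (2 * q.length + 1 + 1) v)).mem = σ.mem v := h1
    rw [h1']
    refine ⟨fun h => h.1, fun h => ⟨h, ?_⟩⟩
    exact known_subset v (known_subset v ((key sources rumor).1.known_mem v _ h))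
  · unfold Informed
    rw [hT]
    exact (hshare sources rumor).2 u s v hu hs (by simp [hss]) hv
  · have h3 := (key sources rumor).2.2
    have hc := (key sources rumor).1.cost (r := contacts ω (2 * q.length))
      (r' := contacts ω (2 * q.length + 1)) (x := inputsOf ω q.length) ho hWF fun v => rfl
    unfold messageCount
    rw [hT, Finset.sum_range_succ, Finset.sum_range_succ]
    have hi : (Abs.init n w).cost = 0 := rfl
    have hc' : roundCount N sources rumor ω (2 * q.length) +
      roundCount N sources rumor ω (2 * q.length + 1) ≤ 2 * (2 * n) := hc
    simp only [Nat.mul_zero, Finset.range_zero, Finset.sum_empty, hi] at h3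
    simp only [roundCount] at h3 hc'
    omega

end Reduction

/-! ### From a good final clustering to broadcasting and fault tolerance -/

section Final

variable {n w E : ℕ}

/-- The aim of the clustering: one cluster with all but a few surviving nodes, at low cost. -/
def Final (N : Network n w) (K ε : ℝ) (σ : Abs n w) : Prop :=
  ∃ u, OneCluster N u σ ∧ ((outsiders N σ).card : ℝ) ≤ ε * N.failed.card ∧ (σ.cost : ℝ) ≤ K * n

variable {q : List Op} {K ε : ℝ}

theorem prob_le_prob {A : Algorithm w} {S T : Set (Outcome n A)} (h : S ⊆ T) : prob S ≤ prob T := by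
  classical
  exact div_le_div_of_nonneg_right (Nat.cast_le.2 (Set.ncard_le_ncard h)) (Nat.cast_nonneg _)

theorem prob_final {N : Network n w} (hn : 0 < n) :
    prob {ω : Outcome n (alg (q ++ [.share]) E w) |
      Final N K ε (exec N q (inputsOf ω) (Abs.init n w))} =
      1 - fail N E q (Abs.init n w) (Final N K ε) := by
  have : Nonempty (Fin n) := ⟨⟨0, hn⟩⟩
  rw [← pr_exec (p := q ++ [.share]) _ _ (by simp), pr_not, pr_eq_ncard, prob]
  ring

/-- There are at most `K * n` communications before `share` and `2 * n` in it, each of at most two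
messages. The factor `2 + 2 * D` converts `1 + 2 * w + b` bits into multiples of `b`; the same
constant is used for both bounds. -/
theorem cost_of_final {N : Network n w} (hq : Op.share ∉ q)
    {ω : Outcome n (alg (q ++ [.share]) E w)} {D : ℝ} (hD : 0 ≤ D)
    (h : ((exec N q (inputsOf ω) (Abs.init n w)).cost : ℝ) ≤ K * n) (sources : Finset (Fin n))
    (rumor : List Bool) (h1 : 1 ≤ rumor.length) (hw : (w : ℝ) ≤ D * rumor.length) (hK : 0 ≤ K) :
    Efficient N (alg (q ++ [.share]) E w) (2 * (K + 2) * (2 + 2 * D)) sources rumor ω := by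
  have hm := (share_run hq (ω := ω) (N := N) rfl).2.2.2 sources rumor
  have hb := bitCount_le (N := N) (sources := sources) (ω := ω) h1
  have hm' : (messageCount N (alg (q ++ [.share]) E w) sources rumor ω : ℝ) ≤ 2 * (K + 2) * n := by
    have : (messageCount N (alg (q ++ [.share]) E w) sources rumor ω : ℝ) ≤
      2 * ((exec N q (inputsOf ω) (Abs.init n w)).cost + 2 * n) := by exact_mod_cast hm
    linarith
  have h1' : (1 : ℝ) ≤ rumor.length := by exact_mod_cast h1
  have hn : (0 : ℝ) ≤ n := Nat.cast_nonneg _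
  constructor
  · refine hm'.trans (mul_le_mul_of_nonneg_right ?_ hn)
    nlinarith
  · have hb' : (bitCount N (alg (q ++ [.share]) E w) sources rumor ω : ℝ) ≤
        messageCount N (alg (q ++ [.share]) E w) sources rumor ω * (1 + 2 * w + rumor.length) := by
      exact_mod_cast hb
    refine hb'.trans ?_
    have h2 : (1 + 2 * w + rumor.length : ℝ) ≤ (2 + 2 * D) * rumor.length := by linarith
    calc _ ≤ 2 * (K + 2) * n * ((2 + 2 * D) * rumor.length) := by
            refine mul_le_mul hm' h2 (by positivity) (by positivity)
      _ = _ := by ring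

theorem faultTolerant_of_fail {id : Fin n ↪ BitVec w} (hn : 0 < n) (hq : Op.share ∉ q)
    (hK : 0 ≤ K) {D minLength δ γ : ℝ} (hD : 0 ≤ D)
    (hlen : ∀ b : ℕ, minLength ≤ b → 1 ≤ b ∧ (w : ℝ) ≤ D * b)
    (h : ∀ failed : Finset (Fin n), (failed.card : ℝ) ≤ γ * n →
      fail ⟨id, failed⟩ E q (Abs.init n w) (Final ⟨id, failed⟩ K ε) ≤ δ) :
    FaultTolerant id (alg (q ++ [.share]) E w) (2 * (K + 2) * (2 + 2 * D)) minLength δ γ ε := by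
  intro failed hf
  have h1 := prob_final (q := q) (E := E) (K := K) (ε := ε) (N := ⟨id, failed⟩) hn
  refine (show 1 - δ ≤ _ by rw [h1]; linarith [h failed hf]).trans (prob_le_prob ?_)
  rintro ω ⟨u, ⟨hu, hone⟩, hout, hcost⟩
  obtain ⟨hWF, hfol, hinf, -⟩ := share_run (N := ⟨id, failed⟩) hq (ω := ω) rfl
  set σ := exec ⟨id, failed⟩ q (inputsOf ω) (Abs.init n w) with hσ
  have hnf : ∀ v, σ.mem v = some (id u) → v ∉ failed := fun v hv hvf => by
    have := hWF.mem_failed v hvf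
    rw [this] at hv
    cases hv
  refine ⟨Finset.univ.filter fun v => σ.mem v = some (id u), u, by simpa using hu, ?_, ?_, ?_⟩
  · rw [Finset.disjoint_left]
    intro v hv
    exact hnf v (by simpa using hv)
  · refine le_trans (Nat.cast_le.2 (Finset.card_le_card ?_)) hout
    intro v hv
    simp only [Finset.mem_sdiff, Finset.mem_compl, Finset.mem_filter, Finset.mem_univ,
      true_and] at hv
    simp only [outsiders, Finset.mem_filter, Finset.mem_univ, true_and]
    exact ⟨hv.1, (hone v).resolve_right hv.2⟩
  · intro sources rumor hr
    obtain ⟨hb, hw⟩ := hlen _ hr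
    refine ⟨fun v hv => ?_, ?_, cost_of_final hq hD hcost sources rumor hb hw hK⟩
    · rw [hfol sources rumor u v hv]
      simp
    · rintro ⟨s, hs, hsc⟩ v hv
      exact hinf sources rumor u s v hu (by simpa using hsc) hs (by simpa using hv)

/-- Broadcasting is the case `F = 0` of the same analysis: the bound `ε * F` on the number of
outsiders then leaves none. -/
theorem broadcasts_of_fail {id : Fin n ↪ BitVec w} (hn : 0 < n) (hq : Op.share ∉ q)
    (hK : 0 ≤ K) {D minLength δ : ℝ} (hD : 0 ≤ D)
    (hlen : ∀ b : ℕ, minLength ≤ b → 1 ≤ b ∧ (w : ℝ) ≤ D * b)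
    (h : fail ⟨id, ∅⟩ E q (Abs.init n w) (Final ⟨id, ∅⟩ K ε) ≤ δ) :
    Broadcasts id (alg (q ++ [.share]) E w) (2 * (K + 2) * (2 + 2 * D)) minLength δ := by
  intro sources rumor hs hr
  have h1 := prob_final (q := q) (E := E) (K := K) (ε := ε) (N := ⟨id, ∅⟩) hn
  refine (show 1 - δ ≤ _ by rw [h1]; linarith).trans (prob_le_prob ?_)
  rintro ω ⟨u, ⟨hu, hone⟩, hout, hcost⟩
  obtain ⟨hWF, hfol, hinf, -⟩ := share_run (N := ⟨id, ∅⟩) hq (ω := ω) rfl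
  set σ := exec ⟨id, ∅⟩ q (inputsOf ω) (Abs.init n w) with hσ
  obtain ⟨hb, hw⟩ := hlen _ hr
  have hall : ∀ v, σ.mem v = some (id u) := by
    intro v
    refine (hone v).resolve_left fun hv => ?_
    have : 0 < (outsiders ⟨id, ∅⟩ σ).card :=
      Finset.card_pos.2 ⟨v, by simp [outsiders, hv]⟩
    have h2 : (1 : ℝ) ≤ (outsiders ⟨id, ∅⟩ σ).card := by exact_mod_cast this
    simp only [Finset.card_empty, Nat.cast_zero, mul_zero] at hout
    linarith
  obtain ⟨s, hs⟩ := hs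
  exact ⟨fun v => hinf sources rumor u s v hu (hall s) hs (hall v),
    cost_of_final hq hD hcost sources rumor hb hw hK⟩

end Final

/-! ### Clusters of equal size and truncation -/

section Clusters

variable {n w E : ℕ} {N : Network n w} {σ : Abs n w} {k : ℕ}

/-- The members of the cluster of `a`. -/
def cluster (σ : Abs n w) (a : BitVec w) : Finset (Fin n) :=
  Finset.univ.filter fun v => σ.mem v = some a

open scoped Classical in
/-- The leaders of clusters. -/
noncomputable def leaders (σ : Abs n w) : Finset (BitVec w) :=
  Finset.univ.filter fun a => ∃ v, σ.mem v = some a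

theorem mem_cluster {a : BitVec w} {v : Fin n} : v ∈ cluster σ a ↔ σ.mem v = some a := by
  simp [cluster]

theorem mem_leaders {a : BitVec w} : a ∈ leaders σ ↔ ∃ v, σ.mem v = some a := by
  simp [leaders]

theorem mem_leaders_of {a : BitVec w} {v : Fin n} (h : σ.mem v = some a) : a ∈ leaders σ :=
  mem_leaders.2 ⟨v, h⟩

theorem cluster_disjoint {a b : BitVec w} (h : a ≠ b) : Disjoint (cluster σ a) (cluster σ b) := by
  rw [Finset.disjoint_left]
  intro v ha hb
  rw [mem_cluster] at ha hb
  exact h (Option.some.inj (ha.symm.trans hb))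

theorem card_members : (members σ).card = ∑ a ∈ leaders σ, (cluster σ a).card := by
  classical
  have : members σ = (leaders σ).biUnion (cluster σ) := by
    ext v
    simp only [members, Finset.mem_filter, Finset.mem_univ, true_and, Finset.mem_biUnion,
      mem_cluster, Option.ne_none_iff_exists']
    exact ⟨fun ⟨a, ha⟩ => ⟨a, mem_leaders_of ha, ha⟩, fun ⟨a, _, ha⟩ => ⟨a, ha⟩⟩
  rw [this, Finset.card_biUnion fun a _ b _ h => cluster_disjoint h]

/-- All clusters have `k` members, and no invitations are pending. -/
structure Uniform (N : Network n w) (k : ℕ) (σ : Abs n w) : Prop where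
  wf : WF N σ
  cand : ∀ v, σ.cand v = none
  card : ∀ a ∈ leaders σ, (cluster σ a).card = k

theorem Uniform.card_members (h : Uniform N k σ) :
    (members σ).card = k * (leaders σ).card := by
  rw [Gossip.card_members, Finset.sum_congr rfl h.card]
  simp [mul_comm]

theorem mem_candidates {a : BitVec w} {v : Fin n} : v ∈ candidates σ a ↔ σ.cl v = some a := by
  simp [candidates]

variable {x : Input n E}

theorem trunc_mem (h : WF N σ) {v : Fin n} {a : BitVec w} :
    (absStep N (.trunc k) σ x).mem v = some a ↔ σ.cl v = some a ∧ k ≤ (candidates σ a).card ∧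
      ((candidates σ a).filter fun u => N.id u < N.id v).card < k := by
  by_cases hv : v ∈ N.failed
  · simp [(absStep_failed hv).1, h.mem_failed v hv, h.cl_failed hv]
  · rw [absStep_mem hv]
    simp only [newMem, Option.bind_eq_some_iff]
    constructor
    · rintro ⟨b, hb, hb'⟩
      split_ifs at hb' with hc
      cases hb'
      exact ⟨hb, hc⟩
    · rintro ⟨hb, hc⟩
      exact ⟨a, hb, if_pos hc⟩

theorem trunc_card (h : WF N σ) {a : BitVec w} (ha : k ≤ (candidates σ a).card) :
    (cluster (absStep N (.trunc k) σ x) a).card = k := by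
  have h1 : cluster (absStep N (.trunc k) σ x) a = (candidates σ a).filter fun v =>
      ((candidates σ a).filter fun u => N.id u < N.id v).card < k := by
    ext v
    rw [mem_cluster, trunc_mem h, Finset.mem_filter, mem_candidates]
    tauto
  have h2 := card_filter_rank ((candidates σ a).map N.id) (k := k) (by simpa using ha)
  rw [h1]
  refine Eq.trans ?_ h2
  rw [Finset.filter_map, Finset.card_map]
  congr 1
  refine Finset.filter_congr fun v _ => ?_
  simp only [Function.comp_apply, candidates_rank]
  congr!

/-- The effect of cutting clusters down to a common size. -/
theorem trunc_spec (h : WF N σ) (hk : 1 ≤ k) :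
    Uniform N k (absStep N (.trunc k) σ x) ∧
      ∀ a, a ∈ leaders (absStep N (.trunc k) σ x) ↔ k ≤ (candidates σ a).card := by
  have hl : ∀ a, a ∈ leaders (absStep N (.trunc k) σ x) ↔ k ≤ (candidates σ a).card := by
    intro a
    constructor
    · intro ha
      obtain ⟨v, hv⟩ := mem_leaders.1 ha
      exact ((trunc_mem h).1 hv).2.1
    · intro ha
      have := trunc_card (x := x) h ha
      obtain ⟨v, hv⟩ := Finset.card_pos.1 (show 0 < (cluster (absStep N (.trunc k) σ x) a).card by
        omega)
      exact mem_leaders_of (mem_cluster.1 hv)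
  refine ⟨⟨h.absStep, fun v => ?_, fun a ha => trunc_card h ((hl a).1 ha)⟩, hl⟩
  by_cases hv : v ∈ N.failed
  · rw [(absStep_failed hv).2.1, h.cand_failed v hv]
  · rw [absStep_cand hv]; rfl

/-! ### Random bits -/

theorem pr_eq_card_filter {α : Type*} [Fintype α] (P : α → Prop) [DecidablePred P] :
    pr P = ((Finset.univ.filter P).card : ℝ) / Fintype.card α := by
  rw [pr_eq_ncard, Set.ncard_eq_toFinset_card']
  simp

theorem pr_fst {α β : Type*} [Fintype α] [Fintype β] [Nonempty β] (P : α → Prop) :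
    pr (fun a : α × β => P a.1) = pr P := by
  rw [pr, avg_prod]
  simp only [avg_const]
  rfl

theorem pr_snd {α β : Type*} [Fintype α] [Fintype β] [Nonempty α] (P : β → Prop) :
    pr (fun a : α × β => P a.2) = pr P := by
  rw [pr, avg_prod]
  exact avg_const (α := α) (pr P)

theorem pr_apply {ι α : Type*} [Fintype ι] [DecidableEq ι] [Fintype α] [Nonempty α] (i : ι)
    (P : α → Prop) : pr (fun x : ι → α => P (x i)) = pr P :=
  avg_apply i fun a => ind (P a)

theorem pr_zeros {e : ℕ} (he : e ≤ E) :
    pr (fun c : Fin E → Bool => zeros e c = true) = (1 / 2) ^ e := by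
  have h : ∀ c : Fin E → Bool, ind (zeros e c = true) =
      ∏ j ∈ Finset.univ.filter (fun j : Fin E => j.val < e), ind (c j = false) := by
    intro c
    by_cases hc : zeros e c = true
    · rw [ind_true hc, Finset.prod_eq_one]
      intro j hj
      rw [zeros, decide_eq_true_eq] at hc
      exact ind_true (hc j (by simpa using hj))
    · rw [ind_false hc]
      rw [zeros, decide_eq_true_eq] at hc
      push Not at hc
      obtain ⟨j, hj, hjc⟩ := hc
      exact (Finset.prod_eq_zero (i := j) (by simpa using hj) (ind_false hjc)).symm
  have hhalf : avg (fun b : Bool => ind (b = false)) = 1 / 2 := by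
    simp [avg, ind]
  rw [pr]
  simp only [h]
  rw [avg_prod_apply _ fun _ b => ind (b = false), Finset.prod_const, hhalf]
  congr 1
  have : (Finset.univ.filter fun j : Fin E => j.val < e) =
      (Finset.univ : Finset (Fin e)).map (Fin.castLEEmb he) := by
    ext j
    simp only [Finset.mem_filter, Finset.mem_univ, true_and, Finset.mem_map]
    exact ⟨fun hj => ⟨⟨j, hj⟩, rfl⟩, fun ⟨i, hi⟩ => hi ▸ i.2⟩
  rw [this, Finset.card_map, Finset.card_univ, Fintype.card_fin]

/-- Every node takes part in a drawing of lots. -/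
theorem pr_lot {e : ℕ} (he : e ≤ E) (v : Fin n) :
    pr (fun x : Input n E => zeros e (x v).1 = true) = (1 / 2) ^ e := by
  have : Nonempty (Fin n) := ⟨v⟩
  rw [pr_apply v (fun a : (Fin E → Bool) × Fin n => zeros e a.1 = true)]
  exact (pr_fst fun c => zeros e c = true).trans (pr_zeros he)

/-! ### Electing leaders -/

theorem hoare_elect {e : ℕ} (he : e ≤ E) (hn : 0 < n) : Hoare N E (fun σ => σ = Abs.init n w)
    [.elect e] (fun σ => Uniform N 1 σ ∧ σ.cost = 0 ∧
      ((n - N.failed.card : ℕ) : ℝ) * (1 / 2) ^ e / 4 ≤ (leaders σ).card ∧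
      ((leaders σ).card : ℝ) ≤ 4 * n * (1 / 2) ^ e)
    (Real.exp (-(((n - N.failed.card : ℕ) : ℝ) * (1 / 2) ^ e / 4)) +
      Real.exp (-(2 * n * (1 / 2) ^ e))) := by
  classical
  have : Nonempty (Fin n) := ⟨⟨0, hn⟩⟩
  refine Hoare.single fun σ hσ => ?_
  subst hσ
  let T : Finset (Fin n) := N.failedᶜ
  have hT : T.card = n - N.failed.card := by simp [T, Finset.card_compl]
  have hmem : ∀ (x : Input n E) v a, (absStep N (.elect e) (Abs.init n w) x).mem v = some a ↔
      v ∈ T.filter (fun v => zeros e (x v).1 = true) ∧ N.id v = a := by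
    intro x v a
    simp only [Finset.mem_filter, T, Finset.mem_compl]
    by_cases hv : v ∈ N.failed
    · simp [(absStep_failed hv).1, hv, Abs.init]
    · rw [absStep_mem hv]
      simp [newMem, hv]
  have hlead : ∀ x : Input n E, leaders (absStep N (.elect e) (Abs.init n w) x) =
      (T.filter fun v => zeros e (x v).1 = true).map N.id := by
    intro x
    ext a
    rw [mem_leaders, Finset.mem_map]
    exact exists_congr fun v => hmem x v a
  have huni : ∀ x : Input n E, Uniform N 1 (absStep N (.elect e) (Abs.init n w) x) := by
    intro x
    refine ⟨WF.init.absStep, fun v => ?_, fun a ha => ?_⟩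
    · simp [absStep, newCand, Abs.init]
    · obtain ⟨v, hv⟩ := mem_leaders.1 ha
      rw [Finset.card_eq_one]
      refine ⟨v, ?_⟩
      ext u
      rw [mem_cluster, Finset.mem_singleton]
      constructor
      · intro hu
        exact N.id.injective (((hmem x u a).1 hu).2.trans ((hmem x v a).1 hv).2.symm)
      · rintro rfl; exact hv
  have hS : (T : Set (Fin n)).PairwiseDisjoint fun v => ({v} : Set (Fin n)) := by
    intro i _ j _ hij
    simpa [Function.onFun] using hij
  have hD : ∀ v ∈ T, DependsOn (fun x : Input n E => zeros e (x v).1 = true) {v} := by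
    intro v _ x y h
    simp only [h v rfl]
  have h1 := lower_tail T (fun v => {v}) (fun v (x : Input n E) => zeros e (x v).1 = true)
    (p := (1 / 2) ^ e) (by positivity) hS hD fun v _ => (pr_lot he v).ge
  have h2 := upper_tail T (fun v => {v}) (fun v (x : Input n E) => zeros e (x v).1 = true)
    (q := (1 / 2) ^ e) (4 * n * (1 / 2) ^ e) hS hD fun v _ => (pr_lot he v).le
  have hTn : (T.card : ℝ) ≤ n := by
    have := Finset.card_le_univ T
    rw [Fintype.card_fin] at this
    exact_mod_cast this
  rw [← hT]
  refine (pr_mono fun x hx => ?_).trans ((pr_or_le _ _).trans (add_le_add h1 (h2.trans ?_)))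
  · by_contra hcon
    push Not at hcon
    refine hx ⟨huni x, rfl, ?_, ?_⟩
    · rw [hlead, Finset.card_map]
      exact hcon.1.trans_eq (by congr!)
    · rw [hlead, Finset.card_map]
      exact le_of_eq_of_le (by congr!) hcon.2.le
  · refine Real.exp_le_exp.2 ?_
    have : (0 : ℝ) < (1 / 2) ^ e := by positivity
    nlinarith

/-! ### Activating clusters -/

open scoped Classical in
/-- The leaders of active clusters. -/
noncomputable def active (σ : Abs n w) : Finset (BitVec w) :=
  (leaders σ).filter fun a => ∃ v, σ.mem v = some a ∧ σ.act v = true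

/-- All members of a cluster agree whether it is active. -/
def Coherent (σ : Abs n w) : Prop :=
  ∀ v a, σ.mem v = some a → (σ.act v = true ↔ a ∈ active σ)

/-- Whether a cluster is active depends only on the coins of its leader. Different clusters have
different leaders, whether or not these are members, so the activations are independent and both
tail bounds apply. -/
theorem hoare_flip {e : ℕ} (he : e ≤ E) (hn : 0 < n) {k L c : ℕ} : Hoare N E
    (fun σ => Uniform N k σ ∧ (leaders σ).card = L ∧ σ.cost = c) [.flip e]
    (fun σ => Uniform N k σ ∧ (leaders σ).card = L ∧ σ.cost = c + k * L ∧ Coherent σ ∧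
      (L : ℝ) * (1 / 2) ^ e / 4 ≤ (active σ).card ∧ ((active σ).card : ℝ) ≤ 4 * L * (1 / 2) ^ e)
    (Real.exp (-((L : ℝ) * (1 / 2) ^ e / 4)) + Real.exp (-(2 * L * (1 / 2) ^ e))) := by
  classical
  have : Nonempty (Fin n) := ⟨⟨0, hn⟩⟩
  refine Hoare.single fun σ ⟨hσ, hL, hc⟩ => ?_
  have hmem : ∀ (x : Input n E) v, (absStep N (.flip e) σ x).mem v = σ.mem v := by
    intro x v; simp [absStep, newMem]
  have hcand : ∀ (x : Input n E) v, (absStep N (.flip e) σ x).cand v = σ.cand v := by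
    intro x v; simp [absStep, newCand]
  have hlead : ∀ (x : Input n E), leaders (absStep N (.flip e) σ x) = leaders σ := by
    intro x; ext a; simp only [mem_leaders, hmem]
  have hact : ∀ (x : Input n E) v a, σ.mem v = some a →
      ((absStep N (.flip e) σ x).act v = true ↔ ∃ u, N.id u = a ∧ zeros e (x u).1 = true) := by
    intro x v a hv
    have hvf : v ∉ N.failed := fun hf => by simp [hσ.wf.mem_failed v hf] at hv
    rw [absStep_act hvf]
    simp [newAct, hv]
  have hactive : ∀ (x : Input n E), active (absStep N (.flip e) σ x) =
      (leaders σ).filter fun a => ∃ u, N.id u = a ∧ zeros e (x u).1 = true := by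
    intro x
    unfold active
    rw [hlead]
    refine Finset.filter_congr fun a ha => ?_
    simp only [hmem]
    constructor
    · rintro ⟨v, hv, hv'⟩
      exact (hact x v a hv).1 hv'
    · intro h
      obtain ⟨v, hv⟩ := mem_leaders.1 ha
      exact ⟨v, hv, (hact x v a hv).2 h⟩
  have hS : (leaders σ : Set (BitVec w)).PairwiseDisjoint fun a => {u | N.id u = a} := by
    intro a _ b _ hab
    rw [Function.onFun, Set.disjoint_left]
    intro u hu hu'
    exact hab (hu.symm.trans hu')
  have hD : ∀ a ∈ leaders σ, DependsOn
      (fun x : Input n E => ∃ u, N.id u = a ∧ zeros e (x u).1 = true) {u | N.id u = a} := by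
    intro a _ x y h
    refine propext (exists_congr fun u => and_congr_right fun hu => ?_)
    rw [h u hu]
  have hpr : ∀ a ∈ leaders σ,
      pr (fun x : Input n E => ∃ u, N.id u = a ∧ zeros e (x u).1 = true) = (1 / 2) ^ e := by
    intro a ha
    obtain ⟨v, hv⟩ := mem_leaders.1 ha
    obtain ⟨u, -, rfl⟩ := hσ.wf.mem_leader v a hv
    simp only [N.id.injective.eq_iff, exists_eq_left]
    exact pr_lot he u
  have h1 := lower_tail (leaders σ) (fun a => {u | N.id u = a})
    (fun a (x : Input n E) => ∃ u, N.id u = a ∧ zeros e (x u).1 = true)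
    (p := (1 / 2) ^ e) (by positivity) hS hD fun v hv => (hpr v hv).ge
  have h2 := upper_tail (leaders σ) (fun a => {u | N.id u = a})
    (fun a (x : Input n E) => ∃ u, N.id u = a ∧ zeros e (x u).1 = true)
    (q := (1 / 2) ^ e) (4 * L * (1 / 2) ^ e) hS hD fun v hv => (hpr v hv).le
  rw [hL] at h1 h2
  refine (pr_mono fun x hx => ?_).trans ((pr_or_le _ _).trans (add_le_add h1 (h2.trans ?_)))
  · by_contra hcon
    push Not at hcon
    refine hx ⟨⟨hσ.wf.absStep, fun v => ?_, fun a ha => ?_⟩, ?_, ?_, ?_, ?_, ?_⟩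
    · rw [hcand, hσ.cand]
    · rw [hlead] at ha
      rw [← hσ.card a ha]
      congr 1
      ext v
      simp only [mem_cluster, hmem]
    · rw [hlead, hL]
    · simp [absStep, opCost, hc, hσ.card_members, hL]
    · intro v a hv
      rw [hmem] at hv
      rw [hact x v a hv, hactive, Finset.mem_filter]
      exact ⟨fun h => ⟨mem_leaders_of hv, h⟩, fun h => h.2⟩
    · rw [hactive]; exact hcon.1.trans_eq (by congr!)
    · rw [hactive]; exact le_of_eq_of_le (by congr!) hcon.2.le
  · refine Real.exp_le_exp.2 ?_
    linarith

end Clusters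

theorem pickMin_eq {α : Type*} [LinearOrder α] {S : Finset α} {a : α} (ha : a ∈ S)
    (h : ∀ b ∈ S, a ≤ b) : pickMin S = some a := by
  rw [pickMin, dif_pos ⟨a, ha⟩]
  congr 1
  exact le_antisymm (Finset.min'_le _ _ ha) (Finset.le_min' _ _ _ h)

/-- Every rank below `S.card` occurs exactly once. The sum arises from asking which member of a
cluster is the first, in the order of IDs, to find an active cluster. -/
theorem sum_pow_rank {α : Type*} [LinearOrder α] (q : ℝ) (S : Finset α) :
    ∑ v ∈ S, q ^ (S.filter (· < v)).card = ∑ i ∈ Finset.range S.card, q ^ i := by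
  induction S using Finset.induction_on_max with
  | empty => simp
  | insert m S hm ih =>
    have hmS : m ∉ S := fun h => lt_irrefl _ (hm m h)
    rw [Finset.sum_insert hmS, Finset.card_insert_of_notMem hmS, Finset.sum_range_succ, ← ih,
      add_comm]
    congr 1
    · refine Finset.sum_congr rfl fun v hv => ?_
      rw [Finset.filter_insert, if_neg (not_lt.2 (hm v hv).le)]
    · rw [Finset.filter_insert, if_neg (lt_irrefl _), Finset.filter_true_of_mem hm]

/-! ### Search and settlement -/

section Merge

variable {n w E : ℕ} {N : Network n w} {σ : Abs n w} {k : ℕ}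

/-- The effect of a search. -/
theorem search_spec (h : Uniform N k σ) {b : Bool} {x : Input n E} :
    (absStep N (.search b) σ x).mem = σ.mem ∧ (absStep N (.search b) σ x).act = σ.act ∧
      ∀ v c, (absStep N (.search b) σ x).cand v = some c ↔ σ.mem v ≠ none ∧ searcher b σ v ∧
        (b = true ∨ σ.act (x v).2 = true) ∧ σ.mem (x v).2 = some c := by
  refine ⟨by funext v; simp [absStep, newMem], by funext v; simp [absStep, newAct], fun v c => ?_⟩
  by_cases hv : v ∈ N.failed
  · simp [(absStep_failed hv).2.1, h.cand, h.wf.mem_failed v hv]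
  · rw [absStep_cand hv]
    simp only [newCand]
    cases hm : σ.mem v with
    | none => simp
    | some a =>
      simp only [Option.bind_some]
      split_ifs with hc
      · simp [hc]
      · simp only [reduceCtorEq, ne_eq, not_false_eq_true, true_and, false_iff]
        tauto

theorem mem_reports (h : Uniform N k σ) {b : Bool} {x : Input n E} {a : BitVec w}
    {q : BitVec w ×ₗ BitVec w} : q ∈ reports N b (absStep N (.search b) σ x) a ↔
      ∃ u, σ.mem u = some a ∧ searcher b σ u ∧ (b = true ∨ σ.act (x u).2 = true) ∧
        σ.mem (x u).2 = some (ofLex q).2 ∧ (ofLex q).1 = if b then (ofLex q).2 else N.id u := by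
  obtain ⟨h1, h2, h3⟩ := search_spec h (b := b) (x := x)
  simp only [reports, Finset.mem_filter, Finset.mem_univ, true_and, h1, h3, searcher, h2]
  refine exists_congr fun u => ?_
  constructor
  · rintro ⟨h1, h2, ⟨-, -, h3, h4⟩, h5⟩
    exact ⟨h1, h2, h3, h4, h5⟩
  · rintro ⟨h1, h2, h3, h4, h5⟩
    exact ⟨h1, h2, ⟨by simp [h1], h2, h3, h4⟩, h5⟩

open scoped Classical in
/-- The clustering after a search. -/
theorem settle_mem (h : Uniform N k σ) {b : Bool} {x y : Input n E} {v : Fin n} {a : BitVec w}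
    (hv : σ.mem v = some a) :
    (absStep N (.settle b) (absStep N (.search b) σ x) y).mem v = if searcher b σ v then
      (pickMin (reports N b (absStep N (.search b) σ x) a)).map fun q => (ofLex q).2
      else some a := by
  obtain ⟨h1, h2, -⟩ := search_spec h (b := b) (x := x)
  have hvf : v ∉ N.failed := fun hf => by simp [h.wf.mem_failed v hf] at hv
  rw [absStep_mem hvf]
  have hs : searcher b (absStep N (.search b) σ x) v ↔ searcher b σ v := by
    rw [searcher, searcher, h2]
  simp only [newMem, h1, hv, Option.bind_some, hs]

theorem settle_mem_none (h : Uniform N k σ) {b : Bool} {x y : Input n E} {v : Fin n}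
    (hv : σ.mem v = none) :
    (absStep N (.settle b) (absStep N (.search b) σ x) y).mem v = none := by
  obtain ⟨h1, h2, -⟩ := search_spec h (b := b) (x := x)
  by_cases hvf : v ∈ N.failed
  · rw [(absStep_failed hvf).1, h1, hv]
  · rw [absStep_mem hvf]
    simp only [newMem, h1, hv, Option.bind_none]

theorem settle_cand (h : Uniform N k σ) {b : Bool} {x y : Input n E} (v : Fin n) :
    (absStep N (.settle b) (absStep N (.search b) σ x) y).cand v = none := by
  by_cases hvf : v ∈ N.failed
  · exact (h.wf.absStep.absStep (x := y)).cand_failed v hvf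
  · rw [absStep_cand hvf]
    rfl

/-- The constant is `1 + 2 + 2`, for `search`, `settle` and `trunc`. Nodes can lose their membership
on the way but none is gained. -/
theorem merge_cost (h : Uniform N k σ) {b : Bool} {k' : ℕ} {x y z : Input n E} :
    (absStep N (.trunc k') (absStep N (.settle b) (absStep N (.search b) σ x) y) z).cost ≤
      σ.cost + 5 * (k * (leaders σ).card) := by
  obtain ⟨h1, -, -⟩ := search_spec h (b := b) (x := x)
  have h2 : members (absStep N (.search b) σ x) = members σ := by simp only [members, h1]
  have h3 : (Finset.univ.filter fun v =>
      (absStep N (.settle b) (absStep N (.search b) σ x) y).cl v ≠ none).card ≤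
      (members σ).card := by
    refine Finset.card_le_card fun v hv => ?_
    simp only [Finset.mem_filter, Finset.mem_univ, true_and, members] at hv ⊢
    intro hm
    exact hv (by simp [Abs.cl, settle_mem_none h hm, settle_cand h])
  change σ.cost + (members σ).card + 2 * (members (absStep N (.search b) σ x)).card + 2 * _ ≤ _
  rw [h2, ← h.card_members]
  omega

/-! ### Merging all clusters -/

/-- If every cluster hits every cluster, each leader receives the pair `(l, l)` of the smallest
leader, and that pair is the minimum of its reports. The case `a = b` of `hx` is needed too: the
cluster of `l` has to find itself in order to stay. -/
theorem mergeAll_spec (h : Uniform N k σ) {k' : ℕ} (hk' : 1 ≤ k') {x y z : Input n E}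
    (hL : (leaders σ).Nonempty) (hkL : k' ≤ k * (leaders σ).card)
    (hx : ∀ a ∈ leaders σ, ∀ b ∈ leaders σ, ∃ v ∈ cluster σ a, (x v).2 ∈ cluster σ b) :
    Uniform N k' (absStep N (.trunc k') (absStep N (.settle true) (absStep N (.search true) σ x) y) z)
      ∧ (leaders (absStep N (.trunc k')
        (absStep N (.settle true) (absStep N (.search true) σ x) y) z)).card = 1 := by
  set τ := absStep N (.settle true) (absStep N (.search true) σ x) y with hτ
  set l := (leaders σ).min' hL with hl
  have hmem : ∀ v, τ.mem v = if σ.mem v = none then none else some l := by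
    intro v
    cases hv : σ.mem v with
    | none => rw [if_pos rfl]; exact settle_mem_none h hv
    | some a =>
      rw [if_neg (by simp), hτ, settle_mem h hv, if_pos (show searcher true σ v from Or.inl rfl)]
      have : pickMin (reports N true (absStep N (.search true) σ x) a) = some (toLex (l, l)) := by
        refine pickMin_eq ?_ fun q hq => ?_
        · rw [mem_reports h]
          obtain ⟨u, hu, hu'⟩ := hx a (mem_leaders_of hv) l (Finset.min'_mem _ _)
          exact ⟨u, mem_cluster.1 hu, Or.inl rfl, Or.inl rfl, by simpa [mem_cluster] using hu',
            by simp⟩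
        · rw [mem_reports h] at hq
          obtain ⟨u, -, -, -, hu, hq⟩ := hq
          have := Finset.min'_le _ _ (mem_leaders_of hu)
          rw [if_pos rfl] at hq
          have hq' : q = toLex ((ofLex q).2, (ofLex q).2) := by
            rw [← toLex_ofLex q, toLex_inj]
            exact Prod.ext hq rfl
          rw [hq', Prod.Lex.toLex_le_toLex']
          exact ⟨this, fun _ => this⟩
      rw [this]
      rfl
  have hcl : ∀ v, τ.cl v = if σ.mem v = none then none else some l := by
    intro v
    rw [Abs.cl, hτ, settle_cand h, ← hτ, hmem]
    simp
  have hτw : WF N τ := h.wf.absStep.absStep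
  obtain ⟨h1, h2⟩ := trunc_spec (x := z) hτw hk'
  refine ⟨h1, ?_⟩
  rw [Finset.card_eq_one]
  refine ⟨l, ?_⟩
  ext a
  rw [h2, Finset.mem_singleton]
  constructor
  · intro ha
    obtain ⟨v, hv⟩ := Finset.card_pos.1 (hk'.trans ha)
    rw [mem_candidates, hcl] at hv
    split_ifs at hv
    exact (Option.some.inj hv).symm
  · rintro rfl
    refine hkL.trans ?_
    rw [← h.card_members]
    refine Finset.card_le_card fun v hv => ?_
    rw [mem_candidates, hcl, if_neg]
    simpa [members] using hv

theorem pr_contact (hn : 0 < n) (S : Finset (Fin n)) :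
    pr (fun a : (Fin E → Bool) × Fin n => a.2 ∈ S) = S.card / n := by
  have : Nonempty (Fin n) := ⟨⟨0, hn⟩⟩
  rw [pr_snd fun v => v ∈ S, pr_eq_card_filter]
  simp

/-- In a block of search, settlement and truncation only the search is random; the other two
operations are treated for all inputs. -/
theorem Hoare.first {P Q : Abs n w → Prop} {o o' o'' : Op} {δ : ℝ} (h : ∀ σ, P σ →
    pr (fun x : Input n E => ¬ ∀ y z : Input n E,
      Q (absStep N o'' (absStep N o' (absStep N o σ x) y) z)) ≤ δ) :
    Hoare N E P [o, o', o''] Q δ := by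
  have h1 : Hoare N E P [o]
    (fun σ => ∀ y z : Input n E, Q (absStep N o'' (absStep N o' σ y) z)) δ := Hoare.single h
  have h2 : Hoare N E (fun σ => ∀ y z : Input n E, Q (absStep N o'' (absStep N o' σ y) z)) [o']
    (fun σ => ∀ z : Input n E, Q (absStep N o'' σ z)) 0 := Hoare.sure fun σ h y => h y
  have h3 : Hoare N E (fun σ => ∀ z : Input n E, Q (absStep N o'' σ z)) [o''] Q 0 :=
    Hoare.sure fun σ h z => h z
  simpa using h1.append (h2.append h3 le_rfl) (by simp)

/-- The `k` contacts of one cluster all miss another one with probability at most `(1 - k / n) ^ k ≤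
exp (-(k * k / n))`; a union bound over the `L * L` ordered pairs follows. -/
theorem hoare_mergeAll (hn : 0 < n) {L k' c : ℕ} (hL : 1 ≤ L) (hk' : 1 ≤ k') (hkL : k' ≤ k * L) :
    Hoare N E (fun σ => Uniform N k σ ∧ (leaders σ).card = L ∧ σ.cost ≤ c)
      [.search true, .settle true, .trunc k']
      (fun σ => Uniform N k' σ ∧ (leaders σ).card = 1 ∧ σ.cost ≤ c + 5 * (k * L))
      (L * (L * Real.exp (-((k : ℝ) * k / n)))) := by
  classical
  have : Nonempty (Fin n) := ⟨⟨0, hn⟩⟩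
  refine Hoare.first fun σ ⟨hσ, hσL, hc⟩ => ?_
  have hmiss : ∀ a ∈ leaders σ, ∀ b ∈ leaders σ,
      pr (fun x : Input n E => ∀ v ∈ cluster σ a, (x v).2 ∉ cluster σ b) ≤
        Real.exp (-((k : ℝ) * k / n)) := by
    intro a ha b hb
    have h1 := pr_forall_le_pow (cluster σ a)
      (fun (_ : Input n E) (c : (Fin E → Bool) × Fin n) => c.2 ∉ cluster σ b)
      (ρ := Real.exp (-(k / n : ℝ))) (fun _ => fun _ _ _ => rfl) fun x => by
        rw [pr_not, pr_contact hn, hσ.card b hb]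
        linarith [Real.add_one_le_exp (-(k / n : ℝ))]
    rw [hσ.card a ha, ← Real.exp_nat_mul] at h1
    convert h1 using 2
    ring
  have h2 := pr_exists_le_card_mul (leaders σ)
    (fun a (x : Input n E) => ∃ b ∈ leaders σ, ∀ v ∈ cluster σ a, (x v).2 ∉ cluster σ b)
    fun a ha => pr_exists_le_card_mul (leaders σ)
      (fun b (x : Input n E) => ∀ v ∈ cluster σ a, (x v).2 ∉ cluster σ b) fun b hb => hmiss a ha b hb
  rw [hσL] at h2
  refine (pr_mono fun x hx => ?_).trans h2
  by_contra hcon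
  push Not at hcon
  refine hx fun y z => ?_
  obtain ⟨h3, h4⟩ := mergeAll_spec (x := x) (y := y) (z := z) hσ hk'
    (Finset.card_pos.1 (by omega)) (hσL ▸ hkL) hcon
  refine ⟨h3, h4, (merge_cost hσ).trans ?_⟩
  rw [hσL]
  omega

/-! ### Merging inactive clusters into active ones -/

/-- The nodes in active clusters. -/
def activeNodes (σ : Abs n w) : Finset (Fin n) :=
  Finset.univ.filter fun v => σ.mem v ≠ none ∧ σ.act v = true

/-- The first node of the cluster of `a` that reaches an active cluster reaches that of `b`. -/
def Selects (N : Network n w) (σ : Abs n w) (a b : BitVec w) (x : Input n E) : Prop :=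
  ∃ v ∈ cluster σ a, (x v).2 ∈ cluster σ b ∧
    ∀ u ∈ cluster σ a, N.id u < N.id v → (x u).2 ∉ activeNodes σ

theorem mem_activeNodes (hσ : Coherent σ) {v : Fin n} :
    v ∈ activeNodes σ ↔ ∃ a ∈ active σ, v ∈ cluster σ a := by
  simp only [activeNodes, Finset.mem_filter, Finset.mem_univ, true_and, mem_cluster,
    Option.ne_none_iff_exists']
  constructor
  · rintro ⟨⟨a, ha⟩, hv⟩
    exact ⟨a, (hσ v a ha).1 hv, ha⟩
  · rintro ⟨a, ha, hv⟩
    exact ⟨⟨a, hv⟩, (hσ v a hv).2 ha⟩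

theorem active_subset : active σ ⊆ leaders σ := Finset.filter_subset _ _

theorem card_activeNodes (h : Uniform N k σ) (hσ : Coherent σ) :
    (activeNodes σ).card = k * (active σ).card := by
  classical
  have : activeNodes σ = (active σ).biUnion (cluster σ) := by
    ext v
    rw [mem_activeNodes hσ, Finset.mem_biUnion]
  rw [this, Finset.card_biUnion fun a _ b _ h => cluster_disjoint h,
    Finset.sum_congr rfl fun a ha => h.card a (active_subset ha)]
  simp [mul_comm]

/-- The lexicographically smallest report is that of the successful member with the smallest ID, so
the whole cluster follows its find. -/
theorem Selects.settle_mem (h : Uniform N k σ) (hσ : Coherent σ) {a b : BitVec w} {x y : Input n E}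
    (ha : a ∉ active σ) (hb : b ∈ active σ) (hs : Selects N σ a b x) {v : Fin n}
    (hv : σ.mem v = some a) :
    (absStep N (.settle false) (absStep N (.search false) σ x) y).mem v = some b := by
  have hact : ∀ u, σ.mem u = some a → σ.act u = false := fun u hu => by
    rw [← Bool.not_eq_true, hσ u a hu]; exact ha
  rw [Gossip.settle_mem h hv, if_pos (show searcher false σ v from Or.inr (hact v hv))]
  obtain ⟨t, ht, htb, hmin⟩ := hs
  rw [mem_cluster] at ht htb
  have : pickMin (reports N false (absStep N (.search false) σ x) a) =
      some (toLex (N.id t, b)) := by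
    refine pickMin_eq ?_ fun q hq => ?_
    · rw [mem_reports h]
      exact ⟨t, ht, Or.inr (hact t ht), Or.inr ((hσ _ _ htb).2 hb), htb, by simp⟩
    · rw [mem_reports h] at hq
      obtain ⟨u, hu, -, hu1, hu2, hu3⟩ := hq
      simp only [Bool.false_eq_true, false_or, if_false] at hu1 hu3
      have hle : N.id t ≤ N.id u := by
        by_contra hlt
        refine hmin u (mem_cluster.2 hu) (not_le.1 hlt) ?_
        simp [activeNodes, hu1, hu2]
      rw [← toLex_ofLex q, Prod.Lex.toLex_le_toLex']
      refine ⟨hu3 ▸ hle, fun heq => ?_⟩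
      have : t = u := N.id.injective (heq.trans hu3)
      subst this
      rw [htb] at hu2
      exact (Option.some.inj hu2).le
  rw [this]
  rfl

theorem mem_active_of_settle (h : Uniform N k σ) (hσ : Coherent σ) {x y : Input n E} {v : Fin n}
    {b : BitVec w}
    (hv : (absStep N (.settle false) (absStep N (.search false) σ x) y).mem v = some b) :
    b ∈ active σ := by
  cases hm : σ.mem v with
  | none => rw [settle_mem_none h hm] at hv; simp at hv
  | some a =>
    rw [Gossip.settle_mem h hm] at hv
    split_ifs at hv with hs
    · rw [Option.map_eq_some_iff] at hv
      obtain ⟨q, hq, rfl⟩ := hv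
      obtain ⟨u, -, -, hu1, hu2, -⟩ := (mem_reports h).1 (pickMin_mem hq)
      simp only [Bool.false_eq_true, false_or] at hu1
      exact (hσ _ _ hu2).1 hu1
    · cases hv
      refine (hσ v _ hm).1 ?_
      simpa [searcher] using hs

open scoped Classical in
-- Each active cluster receives the `k` members of at least `M` inactive clusters, which by itself
-- is enough to survive the truncation. No other leader is followed any more.
theorem merge_spec (h : Uniform N k σ) (hσ : Coherent σ) {k' M : ℕ} (hk' : 1 ≤ k')
    {x y z : Input n E} (hkM : k' ≤ k * M) (hx : ∀ b ∈ active σ,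
      M ≤ ((leaders σ \ active σ).filter fun a => Selects N σ a b x).card) :
    Uniform N k'
      (absStep N (.trunc k') (absStep N (.settle false) (absStep N (.search false) σ x) y) z) ∧
    leaders (absStep N (.trunc k')
      (absStep N (.settle false) (absStep N (.search false) σ x) y) z) = active σ := by
  obtain ⟨h1, h2⟩ := trunc_spec (x := z) (k := k')
    (h.wf.absStep (x := x) (o := .search false)|>.absStep (x := y) (o := .settle false)) hk'
  refine ⟨h1, ?_⟩
  have hcl : ∀ v, (absStep N (.settle false) (absStep N (.search false) σ x) y).cl v =
      (absStep N (.settle false) (absStep N (.search false) σ x) y).mem v := by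
    intro v
    rw [Abs.cl, settle_cand h, Option.or_none]
  ext b
  rw [h2]
  constructor
  · intro hb
    obtain ⟨v, hv⟩ := Finset.card_pos.1 (hk'.trans hb)
    rw [mem_candidates, hcl] at hv
    exact mem_active_of_settle h hσ hv
  · intro hb
    refine hkM.trans ((Nat.mul_le_mul_left k (hx b hb)).trans ?_)
    set S := (leaders σ \ active σ).filter fun a => Selects N σ a b x
    have : k * S.card = (S.biUnion (cluster σ)).card := by
      rw [Finset.card_biUnion fun a _ b _ h => cluster_disjoint h,
        Finset.sum_congr rfl fun a ha => h.card a
          (Finset.mem_sdiff.1 (Finset.mem_filter.1 ha).1).1]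
      rw [Finset.sum_const, smul_eq_mul, mul_comm]
    rw [this]
    refine Finset.card_le_card fun v hv => ?_
    obtain ⟨a, ha, hva⟩ := Finset.mem_biUnion.1 hv
    rw [mem_candidates, hcl]
    obtain ⟨ha1, ha2⟩ := Finset.mem_filter.1 ha
    exact Selects.settle_mem h hσ (Finset.mem_sdiff.1 ha1).2 hb ha2 (mem_cluster.1 hva)

theorem ind_and (P Q : Prop) : ind (P ∧ Q) = ind P * ind Q := by
  by_cases hP : P <;> by_cases hQ : Q <;> simp [ind, hP, hQ]

theorem ind_forall {ι : Type*} (T : Finset ι) (P : ι → Prop) :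
    ind (∀ i ∈ T, P i) = ∏ i ∈ T, ind (P i) := by
  by_cases h : ∀ i ∈ T, P i
  · rw [ind_true h, Finset.prod_eq_one fun i hi => ind_true (h i hi)]
  · rw [ind_false h]
    push Not at h
    obtain ⟨i, hi, hP⟩ := h
    exact (Finset.prod_eq_zero hi (ind_false hP)).symm

theorem sum_ind_le {ι : Type*} (T : Finset ι) (P : ι → Prop)
    (h : ∀ i ∈ T, ∀ j ∈ T, P i → P j → i = j) : ∑ i ∈ T, ind (P i) ≤ ind (∃ i ∈ T, P i) := by
  by_cases hP : ∃ i ∈ T, P i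
  · rw [ind_true hP]
    obtain ⟨i, hi, hPi⟩ := hP
    rw [Finset.sum_eq_single_of_mem i hi fun j hj hji =>
      ind_false fun hPj => hji (h j hj i hi hPj hPi)]
    exact ind_le_one _
  · rw [Finset.sum_eq_zero fun i hi => ind_false fun hPi => hP ⟨i, hi, hPi⟩]
    exact ind_nonneg _

/-- The cases are distinguished by the first successful member. For the member of rank `i`, that
member must hit the cluster of `b` while the `i` members before it miss all active clusters, and
these contacts are independent. The cases exclude each other because a hit of `b` is also a hit of
an active cluster. -/
theorem le_pr_selects (hn : 0 < n) (h : Uniform N k σ) (hσ : Coherent σ) {a b : BitVec w}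
    (ha : a ∈ leaders σ) (hb : b ∈ active σ) :
    (k / n : ℝ) * ∑ i ∈ Finset.range k, (1 - k * (active σ).card / n : ℝ) ^ i ≤
      pr (Selects N σ a b (E := E)) := by
  classical
  have : Nonempty (Fin n) := ⟨⟨0, hn⟩⟩
  set q := (1 - k * (active σ).card / n : ℝ)
  have hsum : ∑ i ∈ Finset.range k, q ^ i = ∑ v ∈ cluster σ a,
      q ^ ((cluster σ a).filter fun u => N.id u < N.id v).card := by
    rw [← h.card a ha, ← Finset.card_map N.id, ← sum_pow_rank, Finset.sum_map]
    refine Finset.sum_congr rfl fun v _ => ?_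
    congr 1
    rw [← Finset.card_map N.id]
    congr 1
    ext u
    simp only [Finset.mem_filter, Finset.mem_map]
    constructor
    · rintro ⟨⟨t, ht, rfl⟩, hlt⟩
      exact ⟨t, ⟨ht, hlt⟩, rfl⟩
    · rintro ⟨t, ⟨ht, hlt⟩, rfl⟩
      exact ⟨⟨t, ht, rfl⟩, hlt⟩
  let F : Fin n → Input n E → Prop := fun v x => (x v).2 ∈ cluster σ b ∧
    ∀ u ∈ cluster σ a, N.id u < N.id v → (x u).2 ∉ activeNodes σ
  have hF : ∀ v, avg (fun x => ind (F v x)) =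
      (k / n : ℝ) * q ^ ((cluster σ a).filter fun u => N.id u < N.id v).card := by
    intro v
    set T := (cluster σ a).filter fun u => N.id u < N.id v with hT
    have hvT : v ∉ T := by simp [hT]
    let f : Fin n → (Fin E → Bool) × Fin n → ℝ := fun u c =>
      if u = v then ind (c.2 ∈ cluster σ b) else ind (c.2 ∉ activeNodes σ)
    have h1 : ∀ x : Input n E, ind (F v x) = ∏ u ∈ insert v T, f u (x u) := by
      intro x
      rw [Finset.prod_insert hvT]
      simp only [f, if_true]
      have : F v x ↔ (x v).2 ∈ cluster σ b ∧ ∀ u ∈ T, (x u).2 ∉ activeNodes σ := by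
        simp only [F, hT, Finset.mem_filter, and_imp]
      rw [this, ind_and, ind_forall]
      congr 1
      refine Finset.prod_congr rfl fun u hu => ?_
      rw [if_neg]
      rintro rfl
      exact hvT hu
    simp only [h1]
    rw [avg_prod_apply _ f, Finset.prod_insert hvT]
    simp only [f, if_true]
    congr 1
    · refine (pr_contact hn _).trans ?_
      rw [h.card b (active_subset hb)]
    · rw [← Finset.prod_const]
      refine Finset.prod_congr rfl fun u hu => ?_
      have huv : u ≠ v := by rintro rfl; exact hvT hu
      simp only [if_neg huv]
      refine (pr_not fun c : (Fin E → Bool) × Fin n => c.2 ∈ activeNodes σ).trans ?_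
      rw [pr_contact hn, card_activeNodes h hσ]
      push_cast
      rfl
  rw [hsum, Finset.mul_sum, ← Finset.sum_congr rfl fun v _ => hF v, ← avg_sum]
  refine avg_mono fun x => sum_ind_le _ _ fun i hi j hj hPi hPj => ?_
  by_contra hij
  have hsub : ∀ v, (x v).2 ∈ cluster σ b → (x v).2 ∈ activeNodes σ := fun v hv =>
    (mem_activeNodes hσ).2 ⟨b, hb, hv⟩
  rcases lt_or_gt_of_ne (fun heq => hij (N.id.injective heq)) with hlt | hlt
  · exact hPj.2 i hi hlt (hsub i hPi.1)
  · exact hPi.2 j hj hlt (hsub j hPj.1)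

/-- With `y` the proportion of active nodes, the geometric series sums to `(1 - (1 - y) ^ k) / A`,
where `A` is the number of active clusters. Since `k * y ≥ 1`, some member succeeds with probability
at least `1/2`, and equal sizes make the target uniform. -/
theorem inv_le_pr_selects (hn : 0 < n) (h : Uniform N k σ) (hσ : Coherent σ) {a b : BitVec w}
    (ha : a ∈ leaders σ) (hb : b ∈ active σ)
    (hk : (n : ℝ) ≤ k * (k * (active σ).card)) :
    1 / (2 * (active σ).card) ≤ pr (Selects N σ a b (E := E)) := by
  refine le_trans ?_ (le_pr_selects hn h hσ ha hb)
  have hn' : (0 : ℝ) < n := by exact_mod_cast hn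
  have hA : (0 : ℝ) < (active σ).card := by exact_mod_cast Finset.card_pos.2 ⟨b, hb⟩
  have hkA : (k * (active σ).card : ℝ) ≤ n := by
    have := (card_activeNodes h hσ).symm.trans_le (Finset.card_le_univ _)
    rw [Fintype.card_fin] at this
    exact_mod_cast this
  have hk0 : (0 : ℝ) < k := by
    by_contra hk0
    have : (k : ℝ) = 0 := le_antisymm (not_lt.1 hk0) k.cast_nonneg
    rw [this] at hk
    linarith
  set y := (k * (active σ).card / n : ℝ) with hy
  have hy0 : 0 < y := by positivity
  have hy1 : y ≤ 1 := (div_le_one hn').2 hkA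
  have hpow : (1 - y) ^ k ≤ 1 / 2 := by
    have h1 : (1 - y) ^ k ≤ Real.exp (-y) ^ k :=
      pow_le_pow_left₀ (by linarith) (by linarith [Real.add_one_le_exp (-y)]) k
    rw [← Real.exp_nat_mul] at h1
    have h2 : (k : ℝ) * -y ≤ -1 := by
      have : 1 ≤ k * y := by
        rw [hy, mul_div_assoc', le_div_iff₀ hn']
        linarith
      linarith
    have h3 := Real.exp_le_exp.2 h2
    have h4 : Real.exp (-1) ≤ 1 / 2 := by
      rw [Real.exp_neg, one_div]
      exact inv_anti₀ (by norm_num) (by linarith [Real.add_one_le_exp (1 : ℝ)])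
    linarith
  have hgeom : (∑ i ∈ Finset.range k, (1 - y) ^ i) * y = 1 - (1 - y) ^ k := by
    have := geom_sum_mul (1 - y) k
    linarith
  have h5 : (k / n : ℝ) = y / (active σ).card := by
    rw [hy]; field_simp
  rw [h5, div_mul_eq_mul_div, mul_comm y, hgeom, div_le_div_iff₀ (by positivity) hA]
  nlinarith

/-- The selection made by a cluster depends only on the contacts of its own members, so the number
of clusters choosing a given active one obeys the lower tail bound. The factor 4 in `hL` compensates
for the possible deficit of active clusters. -/
theorem hoare_merge (hn : 0 < n) {e L k' c : ℕ} (he : e ≤ E) (he3 : 6 ≤ e) (hk' : 1 ≤ k')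
    (hkk : k' ≤ k * 2 ^ (e - 6)) (hL : 4 * (n : ℝ) ≤ k * (k * (L * (1 / 2) ^ e))) :
    Hoare N E (fun σ => Uniform N k σ ∧ (leaders σ).card = L ∧ σ.cost ≤ c)
      [.flip e, .search false, .settle false, .trunc k']
      (fun σ => Uniform N k' σ ∧ σ.cost ≤ c + 6 * (k * L) ∧
        (L : ℝ) * (1 / 2) ^ e / 4 ≤ (leaders σ).card ∧
        ((leaders σ).card : ℝ) ≤ 4 * L * (1 / 2) ^ e)
      (Real.exp (-((L : ℝ) * (1 / 2) ^ e / 4)) + Real.exp (-(2 * L * (1 / 2) ^ e)) +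
        n * Real.exp (-(2 ^ e / 64))) := by
  classical
  have : Nonempty (Fin n) := ⟨⟨0, hn⟩⟩
  have hn' : (0 : ℝ) < n := by exact_mod_cast hn
  have hflip : Hoare N E (fun σ => Uniform N k σ ∧ (leaders σ).card = L ∧ σ.cost ≤ c) [.flip e]
      (fun σ => Uniform N k σ ∧ (leaders σ).card = L ∧ σ.cost ≤ c + k * L ∧ Coherent σ ∧
        (L : ℝ) * (1 / 2) ^ e / 4 ≤ (active σ).card ∧ ((active σ).card : ℝ) ≤ 4 * L * (1 / 2) ^ e)
      (Real.exp (-((L : ℝ) * (1 / 2) ^ e / 4)) + Real.exp (-(2 * L * (1 / 2) ^ e))) := by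
    intro σ ⟨h1, h2, h3⟩
    refine ((hoare_flip he hn (c := σ.cost)).mono (P' := fun τ => τ = σ) (by
      rintro τ rfl; exact ⟨h1, h2, rfl⟩) ?_ le_rfl) σ rfl
    rintro τ ⟨h4, h5, h6, h7⟩
    exact ⟨h4, h5, by omega, h7⟩
  refine Hoare.append (p := [.flip e]) hflip (Hoare.first fun σ ⟨hσ, hσL, hc, hco, ha1, ha2⟩ => ?_)
    (by positivity)
  set A := (active σ).card with hA
  have hT : (leaders σ \ active σ).card = L - A := by
    rw [Finset.card_sdiff_of_subset active_subset, hσL]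
  have hAL : A ≤ L := hσL ▸ Finset.card_le_card active_subset
  have hhalf : (1 / 2 : ℝ) ^ e ≤ 1 / 64 := by
    calc (1 / 2 : ℝ) ^ e ≤ (1 / 2) ^ 6 := pow_le_pow_of_le_one (by norm_num) (by norm_num) he3
      _ = 1 / 64 := by norm_num
  have hAL2 : (A : ℝ) ≤ L / 2 := by nlinarith [L.cast_nonneg (α := ℝ)]
  have hinv : (1 / 2 : ℝ) ^ e * 2 ^ e = 1 := by rw [← mul_pow]; norm_num
  have hkA : (n : ℝ) ≤ k * (k * (active σ).card) := by
    have h1 : (L * (1 / 2) ^ e : ℝ) ≤ 4 * A := by linarith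
    have h2 : (k : ℝ) * (k * (L * (1 / 2) ^ e)) ≤ k * (k * (4 * A)) := by gcongr
    linarith
  have hsel : ∀ b ∈ active σ, pr (fun x : Input n E =>
      (((leaders σ \ active σ).filter fun a => Selects N σ a b x).card : ℝ) < 2 ^ e / 64) ≤
        Real.exp (-(2 ^ e / 64)) := by
    intro b hb
    have hA0 : (0 : ℝ) < A := by exact_mod_cast Finset.card_pos.2 ⟨b, hb⟩
    have h1 := lower_tail (leaders σ \ active σ) (fun a => (cluster σ a : Set (Fin n)))
      (fun a (x : Input n E) => Selects N σ a b x) (p := 1 / (2 * A)) (by positivity)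
      (fun a _ a' _ h => Finset.disjoint_coe.2 (cluster_disjoint h))
      (fun a _ x y hxy => by
        refine propext (exists_congr fun v => and_congr_right fun hv => ?_)
        rw [hxy v (Finset.mem_coe.2 hv)]
        refine and_congr_right fun _ => forall_congr' fun u => forall_congr' fun hu => ?_
        rw [hxy u (Finset.mem_coe.2 hu)])
      fun a ha => inv_le_pr_selects hn hσ hco (Finset.mem_sdiff.1 ha).1 hb hkA
    -- At least `L / 2` clusters are inactive and `A ≤ 4 * L / 2 ^ e`, so the lower bound on the
    -- mean is at least `2 ^ e / 16`; the tail bound keeps a quarter of it.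
    have h2 : (2 ^ e / 64 : ℝ) ≤ (leaders σ \ active σ).card * (1 / (2 * A)) / 4 := by
      rw [hT, Nat.cast_sub hAL, mul_one_div, div_div, div_le_div_iff₀ (by norm_num) (by positivity)]
      have : (A : ℝ) * 2 ^ e ≤ 4 * L := by
        calc (A : ℝ) * 2 ^ e ≤ 4 * L * (1 / 2) ^ e * 2 ^ e := by gcongr
          _ = 4 * L := by rw [mul_assoc, hinv, mul_one]
      nlinarith
    refine le_trans (pr_mono fun x hx => ?_) (h1.trans (Real.exp_le_exp.2 (by linarith)))
    refine lt_of_eq_of_lt (by congr!) (hx.trans_le h2)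
  have hun := pr_exists_le_card_mul (active σ) (fun b (x : Input n E) =>
    (((leaders σ \ active σ).filter fun a => Selects N σ a b x).card : ℝ) < 2 ^ e / 64) hsel
  have hAn : (A : ℝ) ≤ n := by
    have hk0 : k ≠ 0 := by
      rintro rfl
      simp at hL
      omega
    have := (card_activeNodes hσ hco).symm.trans_le (Finset.card_le_univ _)
    rw [Fintype.card_fin] at this
    exact_mod_cast (Nat.le_mul_of_pos_left A (Nat.pos_of_ne_zero hk0)).trans this
  refine (pr_mono fun x hx => ?_).trans (hun.trans (by gcongr))
  by_contra hcon
  push Not at hcon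
  refine hx fun y z => ?_
  obtain ⟨h3, h4⟩ := merge_spec (x := x) (y := y) (z := z) (M := 2 ^ (e - 6)) hσ hco hk' hkk
    fun b hb => by
      have h5 : ((2 ^ (e - 6) : ℕ) : ℝ) = 2 ^ e / 64 := by
        obtain ⟨d, rfl⟩ := Nat.exists_eq_add_of_le he3
        rw [Nat.add_sub_cancel_left, pow_add]
        push_cast
        ring
      have := h5.trans_le (hcon b hb)
      have h6 := Nat.cast_le.1 this
      exact h6.trans_eq (by congr!)
  refine ⟨h3, ?_, ?_, ?_⟩
  · refine (merge_cost hσ).trans ?_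
    rw [hσL]
    omega
  · rw [h4]; exact ha1
  · rw [h4]; exact ha2

end Merge

/-! ### Growth of clusters by invitations -/

section Grow

variable {n w E : ℕ} {N : Network n w} {σ : Abs n w} {k : ℕ}

theorem recruit_spec {x : Input n E} : (absStep N .recruit σ x).mem = σ.mem ∧
    (∀ u a, (absStep N .recruit σ x).cand u = some a →
      σ.cand u = some a ∨ ∃ v, σ.mem v = some a ∧ (x v).2 = u) ∧
    (∀ u, σ.cand u ≠ none → (absStep N .recruit σ x).cand u ≠ none) ∧
    ∀ u v, u ∉ N.failed → σ.mem u = none → σ.mem v ≠ none → (x v).2 = u →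
      (absStep N .recruit σ x).cand u ≠ none := by
  have hmem : (absStep N .recruit σ x).mem = σ.mem := by funext v; simp [absStep, newMem]
  have hcand : ∀ u, u ∉ N.failed → (absStep N .recruit σ x).cand u =
      if σ.cl u = none then pickMin (invitations σ x u) else σ.cand u := by
    intro u hu
    rw [absStep_cand hu]
    simp only [newCand]
  have hper : ∀ u, σ.cand u ≠ none → (absStep N .recruit σ x).cand u ≠ none := by
    intro u hu
    by_cases hf : u ∈ N.failed
    · rwa [(absStep_failed hf).2.1]
    · rw [hcand u hf, if_neg]
      · exact hu
      · simp [Abs.cl, hu]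
  refine ⟨hmem, fun u a h => ?_, hper, fun u v hu hmu hv huv => ?_⟩
  · by_cases hf : u ∈ N.failed
    · rw [(absStep_failed hf).2.1] at h
      exact Or.inl h
    · rw [hcand u hf] at h
      split_ifs at h with hc
      · have := pickMin_mem h
        simp only [invitations, Finset.mem_filter, Finset.mem_univ, true_and] at this
        exact Or.inr this
      · exact Or.inl h
  · by_cases hcu : σ.cand u = none
    · obtain ⟨a, ha⟩ := Option.ne_none_iff_exists'.1 hv
      rw [hcand u hu, if_pos (by simp [Abs.cl, hmu, hcu]), pickMin, dif_pos]
      · simp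
      · refine ⟨a, ?_⟩
        simp only [invitations, Finset.mem_filter, Finset.mem_univ, true_and]
        exact ⟨v, ha, huv⟩
    · exact hper u hcu

theorem recruits_spec (B : ℕ) (ξ : ℕ → Input n E) (σ : Abs n w) :
    (exec N (.replicate B .recruit) ξ σ).mem = σ.mem ∧
    (∀ u a, (exec N (.replicate B .recruit) ξ σ).cand u = some a →
      σ.cand u = some a ∨ ∃ i < B, ∃ v, σ.mem v = some a ∧ (ξ i v).2 = u) ∧
    (∀ u, σ.cand u ≠ none → (exec N (.replicate B .recruit) ξ σ).cand u ≠ none) ∧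
    (∀ i < B, ∀ u v, u ∉ N.failed → σ.mem u = none → σ.mem v ≠ none → (ξ i v).2 = u →
      (exec N (.replicate B .recruit) ξ σ).cand u ≠ none) ∧
    (exec N (.replicate B .recruit) ξ σ).cost = σ.cost + B * (members σ).card ∧
    (WF N σ → WF N (exec N (.replicate B .recruit) ξ σ)) := by
  induction B generalizing ξ σ with
  | zero => simp [exec]
  | succ B ih =>
    obtain ⟨h1, h2, h3, h4⟩ := recruit_spec (N := N) (σ := σ) (x := ξ 0)
    obtain ⟨i1, i2, i3, i4, i5, i6⟩ := ih (fun i => ξ (i + 1)) (absStep N .recruit σ (ξ 0))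
    rw [List.replicate_succ, exec]
    refine ⟨i1.trans h1, fun u a h => ?_, fun u hu => i3 u (h3 u hu),
      fun i hi u v hu hmu hmv huv => ?_, ?_, fun h => i6 h.absStep⟩
    · rcases i2 u a h with h | ⟨i, hi, v, hv, hvu⟩
      · rcases h2 u a h with h | ⟨v, hv, hvu⟩
        · exact Or.inl h
        · exact Or.inr ⟨0, by omega, v, hv, hvu⟩
      · exact Or.inr ⟨i + 1, by omega, v, h1 ▸ hv, hvu⟩
    · cases i with
      | zero => exact i3 u (h4 u v hu hmu hmv huv)
      | succ i => exact i4 i (by omega) u v hu (h1 ▸ hmu) (h1 ▸ hmv) huv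
    · have : members (absStep N .recruit σ (ξ 0)) = members σ := by simp only [members, h1]
      rw [i5, this]
      change σ.cost + (members σ).card + _ = _
      ring

/-- The binomial coefficient is at most `(e * B) ^ m`, with logarithm `m * (1 + log B)`. The
hypothesis lets the gain `r * (B - 1) * m` exceed this by `16 * m`. -/
theorem choose_mul_exp_le {B m : ℕ} (hB : 1 ≤ B) {r : ℝ} (hr : 17 + Real.log B ≤ r * (B - 1)) :
    ((B * m).choose m : ℝ) * Real.exp (-r) ^ (B * m - m) ≤ Real.exp (-(16 * m)) := by
  have hB0 : (0 : ℝ) < B := by exact_mod_cast hB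
  have h1 : ((B * m).choose m : ℝ) ≤ Real.exp (m * (1 + Real.log B)) := by
    calc ((B * m).choose m : ℝ) ≤ ((B * m : ℕ) : ℝ) ^ m / m.factorial := Nat.choose_le_pow_div _ _
      _ = B ^ m * ((m : ℝ) ^ m / m.factorial) := by push_cast; rw [mul_pow]; ring
      _ ≤ B ^ m * Real.exp m := by
        gcongr
        exact Real.pow_div_factorial_le_exp _ (Nat.cast_nonneg m) m
      _ = Real.exp (m * (1 + Real.log B)) := by
        rw [mul_add, Real.exp_add, mul_one, Real.exp_nat_mul, Real.exp_log hB0, mul_comm]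
  have h2 : Real.exp (-r) ^ (B * m - m) = Real.exp (m * (-(r * (B - 1)))) := by
    rw [← Real.exp_nat_mul, Nat.cast_sub (Nat.le_mul_of_pos_left m hB)]
    push_cast
    congr 1
    ring
  rw [h2]
  refine (mul_le_mul_of_nonneg_right h1 (Real.exp_nonneg _)).trans ?_
  rw [← Real.exp_add, ← mul_add]
  refine Real.exp_le_exp.2 ?_
  nlinarith [m.cast_nonneg (α := ℝ)]

open scoped Classical in
/-- The nodes that belong to clusters with leaders in `S`. -/
noncomputable def unionOf (σ : Abs n w) (S : Finset (BitVec w)) : Finset (Fin n) :=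
  S.biUnion (cluster σ)

theorem card_unionOf (h : Uniform N k σ) {S : Finset (BitVec w)} (hS : S ⊆ leaders σ) :
    (unionOf σ S).card = k * S.card := by
  rw [unionOf, Finset.card_biUnion fun a _ b _ h => cluster_disjoint h,
    Finset.sum_congr rfl fun a ha => h.card a (hS ha)]
  rw [Finset.sum_const, smul_eq_mul, mul_comm]

theorem unionOf_subset {S : Finset (BitVec w)} : unionOf σ S ⊆ members σ := by
  intro v hv
  obtain ⟨a, -, ha⟩ := Finset.mem_biUnion.1 hv
  simp [members, mem_cluster.1 ha]

open scoped Classical in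
/-- The nodes that cannot be recruited by a contact that is not in `Y` for the clusters with
leaders in `S`, given that those recruit only nodes contacted through `Y`. -/
noncomputable def blocked (N : Network n w) (σ : Abs n w) {B : ℕ} (S : Finset (BitVec w))
    (Y : Finset (Fin B × Fin n)) (x : Fin B × Fin n → (Fin E → Bool) × Fin n) : Finset (Fin n) :=
  N.failed ∪ members σ ∪
    (Y ∪ (Finset.univ ×ˢ (members σ \ unionOf σ S))).image fun j => (x j).2

open scoped Classical in
-- Encoding of failure. If no cluster in `S` doubles, together they recruit at most `k * S.card`
-- nodes, so a set `Y` of that many contacts accounts for all their recruits. Each of the remaining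
-- `(B - 1) * k * S.card` contacts is wasted on a node that is failed, already clustered, or
-- contacted otherwise.
theorem stuck_spec (hn : 0 < n) (h : Uniform N k σ) {B : ℕ} (hB : 1 ≤ B) {S : Finset (BitVec w)}
    (hS : S ⊆ leaders σ) (ξ : Fin B → Input n E)
    (hx : ∀ a ∈ S, (candidates (exec N (.replicate B .recruit) (extend ξ) σ) a).card < 2 * k) :
    ∃ Y ∈ ((Finset.univ : Finset (Fin B)) ×ˢ unionOf σ S).powersetCard (k * S.card),
      ∀ j ∈ ((Finset.univ : Finset (Fin B)) ×ˢ unionOf σ S) \ Y,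
        (ξ j.1 j.2).2 ∈ blocked N σ S Y (fun j => ξ j.1 j.2) := by
  obtain ⟨h1, h2, -, h4, -, -⟩ := recruits_spec (N := N) B (extend ξ) σ
  set τ := exec N (.replicate B .recruit) (extend ξ) σ
  set V := (Finset.univ : Finset (Fin B)) ×ˢ unionOf σ S with hV
  let R := Finset.univ.filter fun u => σ.mem u = none ∧ ∃ a ∈ S, τ.cand u = some a
  have hext : ∀ (i : ℕ) (hi : i < B), extend ξ i = ξ ⟨i, hi⟩ := fun i hi => by
    rw [extend, dif_pos hi]
  have hR : R.card ≤ k * S.card := by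
    have : R = S.biUnion fun a => Finset.univ.filter fun u => σ.mem u = none ∧ τ.cand u = some a := by
      ext u
      simp only [R, Finset.mem_filter, Finset.mem_univ, true_and, Finset.mem_biUnion]
      exact ⟨fun ⟨h, a, ha, h'⟩ => ⟨a, ha, h, h'⟩, fun ⟨a, ha, h, h'⟩ => ⟨h, a, ha, h'⟩⟩
    rw [this, mul_comm]
    refine Finset.card_biUnion_le_card_mul _ _ _ fun a ha => ?_
    have h5 := hx a ha
    have h6 : candidates τ a = cluster σ a ∪
        Finset.univ.filter fun u => σ.mem u = none ∧ τ.cand u = some a := by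
      ext u
      simp only [mem_candidates, Finset.mem_union, mem_cluster, Finset.mem_filter,
        Finset.mem_univ, true_and, Abs.cl, h1]
      cases σ.mem u <;> simp
    rw [h6, Finset.card_union_of_disjoint, h.card a (hS ha)] at h5
    · omega
    · rw [Finset.disjoint_left]
      intro u hu hu'
      rw [mem_cluster] at hu
      simp [hu] at hu'
  have hhit : ∀ u ∈ R, ∃ j ∈ V, (ξ j.1 j.2).2 = u := by
    intro u hu
    obtain ⟨-, a, ha, hua⟩ := (Finset.mem_filter.1 hu).2
    rcases h2 u a hua with h | ⟨i, hi, v, hv, hvu⟩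
    · rw [‹Uniform N k σ›.cand] at h
      simp at h
    · rw [hext i hi] at hvu
      refine ⟨(⟨i, hi⟩, v), ?_, hvu⟩
      rw [hV, Finset.mem_product]
      exact ⟨Finset.mem_univ _, Finset.mem_biUnion.2 ⟨a, ha, mem_cluster.2 hv⟩⟩
  have : Nonempty (Fin B × Fin n) := ⟨⟨0, hB⟩, ⟨0, hn⟩⟩
  choose! f hf hfu using hhit
  have hsub : R.image f ⊆ V := by
    intro j hj
    obtain ⟨u, hu, rfl⟩ := Finset.mem_image.1 hj
    exact hf u hu
  have hVc : V.card = B * (k * S.card) := by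
    rw [hV, Finset.card_product, card_unionOf h hS, Finset.card_univ, Fintype.card_fin]
  -- One successful contact per recruit is chosen, and the set is padded to a fixed cardinality so
  -- that the later union bound ranges over subsets of one size.
  obtain ⟨Y, hY1, hY2, hY3⟩ := Finset.exists_subsuperset_card_eq hsub
    (Finset.card_image_le.trans hR) (hVc ▸ Nat.le_mul_of_pos_left _ hB)
  refine ⟨Y, Finset.mem_powersetCard.2 ⟨hY2, hY3⟩, fun j hj => ?_⟩
  obtain ⟨hjV, -⟩ := Finset.mem_sdiff.1 hj
  set u := (ξ j.1 j.2).2 with hu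
  simp only [blocked, Finset.mem_union, Finset.mem_image]
  by_cases hf' : u ∈ N.failed
  · exact Or.inl (Or.inl hf')
  by_cases hm : σ.mem u = none
  swap
  · exact Or.inl (Or.inr (by simp [members, hm]))
  right
  have hjm : σ.mem j.2 ≠ none := by
    have := unionOf_subset (Finset.mem_product.1 hjV).2
    simpa [members] using this
  obtain ⟨b, hb⟩ := Option.ne_none_iff_exists'.1
    (h4 j.1 j.1.2 u j.2 hf' hm hjm (by rw [hext _ j.1.2]))
  -- A contacted free node ends up with some invitation. If it comes from `S`, the node is reached
  -- through `Y`; if not, it was contacted by a cluster outside `S`. In both cases it is blocked.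
  by_cases hbS : b ∈ S
  · have huR : u ∈ R := by simp [R, hm, hb, hbS]
    exact ⟨f u, Or.inl (hY1 (Finset.mem_image_of_mem f huR)), hfu u huR⟩
  · rcases h2 u b hb with h | ⟨i, hi, v, hv, hvu⟩
    · rw [‹Uniform N k σ›.cand] at h
      simp at h
    · refine ⟨(⟨i, hi⟩, v), Or.inr ?_, by rw [← hvu, hext i hi]⟩
      rw [Finset.mem_product, Finset.mem_sdiff]
      refine ⟨Finset.mem_univ _, by simp [members, hv], fun hvS => ?_⟩
      obtain ⟨a, ha, hva⟩ := Finset.mem_biUnion.1 hvS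
      rw [mem_cluster, hv] at hva
      exact hbS (Option.some.inj hva ▸ ha)

open scoped Classical in
-- By `hsize` the blocked set always has at most `(1 - r) * n` nodes, so each wasted contact costs a
-- factor `1 - r ≤ exp (-r)`. The union bound over `Y` is absorbed by `choose_mul_exp_le`.
theorem pr_stuck_le (hn : 0 < n) (h : Uniform N k σ) {B : ℕ} (hB : 1 ≤ B) {r : ℝ}
    (hr : 17 + Real.log B ≤ r * (B - 1))
    (hsize : (N.failed.card : ℝ) + (1 + B) * (k * (leaders σ).card) ≤ (1 - r) * n)
    {S : Finset (BitVec w)} (hS : S ⊆ leaders σ) :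
    pr (fun ξ : Fin B → Input n E =>
      ∀ a ∈ S, (candidates (exec N (.replicate B .recruit) (extend ξ) σ) a).card < 2 * k) ≤
      Real.exp (-(16 * (k * S.card : ℕ))) := by
  have : Nonempty (Fin n) := ⟨⟨0, hn⟩⟩
  have hn' : (0 : ℝ) < n := by exact_mod_cast hn
  set V := (Finset.univ : Finset (Fin B)) ×ˢ unionOf σ S with hV
  have hVc : V.card = B * (k * S.card) := by
    rw [hV, Finset.card_product, card_unionOf h hS, Finset.card_univ, Fintype.card_fin]
  have hY : ∀ Y ∈ V.powersetCard (k * S.card),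
      pr (fun x : Fin B × Fin n → (Fin E → Bool) × Fin n =>
        ∀ j ∈ V \ Y, (x j).2 ∈ blocked N σ S Y x) ≤
        Real.exp (-r) ^ (B * (k * S.card) - k * S.card) := by
    intro Y hY
    obtain ⟨hYV, hYc⟩ := Finset.mem_powersetCard.1 hY
    rw [← hVc, ← hYc, ← Finset.card_sdiff_of_subset hYV]
    refine pr_forall_le_pow (V \ Y) (fun x c => c.2 ∈ blocked N σ S Y x) (fun c x y hxy => ?_)
      fun x => ?_
    -- Only contacts in `Y` or from clusters outside `S` enter the blocked set, so it is independent
    -- of the contacts in `V \ Y`.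
    · have : blocked N σ S Y x = blocked N σ S Y y := by
        unfold blocked
        congr 1
        refine Finset.image_congr fun j hj => ?_
        rw [hxy j]
        simp only [Finset.coe_union, Set.mem_union, Finset.mem_coe, Finset.mem_product,
          Finset.mem_sdiff] at hj
        simp only [Set.mem_compl_iff, Finset.mem_coe, Finset.mem_sdiff, hV, Finset.mem_product,
          not_and, not_not]
        tauto
      simp only [this]
    · rw [pr_contact hn, div_le_iff₀ hn']
      have hcard : ((blocked N σ S Y x).card : ℝ) ≤
          N.failed.card + (1 + B) * (k * (leaders σ).card) := by
        have hZ : (Finset.univ ×ˢ (members σ \ unionOf σ S) : Finset (Fin B × Fin n)).card =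
            B * (k * (leaders σ).card - k * S.card) := by
          rw [Finset.card_product, Finset.card_sdiff_of_subset unionOf_subset, h.card_members,
            card_unionOf h hS, Finset.card_univ, Fintype.card_fin]
        have h1 : (blocked N σ S Y x).card ≤ N.failed.card + k * (leaders σ).card +
            (k * S.card + B * (k * (leaders σ).card - k * S.card)) := by
          refine (Finset.card_union_le _ _).trans (add_le_add ?_ (Finset.card_image_le.trans ?_))
          · refine (Finset.card_union_le _ _).trans ?_
            rw [h.card_members]
          · refine (Finset.card_union_le _ _).trans ?_
            rw [hYc, hZ]
        have hSL : k * S.card ≤ k * (leaders σ).card := Nat.mul_le_mul_left k (Finset.card_le_card hS)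
        obtain ⟨d, hd⟩ := Nat.exists_eq_add_of_le hSL
        have h2 : k * S.card + B * (k * (leaders σ).card - k * S.card) ≤
            B * (k * (leaders σ).card) := by
          rw [hd, Nat.add_sub_cancel_left, mul_add]
          have := Nat.le_mul_of_pos_left (k * S.card) hB
          omega
        have h3 : (blocked N σ S Y x).card ≤
            N.failed.card + (1 + B) * (k * (leaders σ).card) := by
          rw [add_mul, one_mul]
          omega
        exact_mod_cast h3
      have h4 : 1 - r ≤ Real.exp (-r) := by linarith [Real.add_one_le_exp (-r)]
      nlinarith
  have hun := pr_exists_le_card_mul _ _ hY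
  rw [Finset.card_powersetCard, hVc] at hun
  refine le_trans ?_ (hun.trans (choose_mul_exp_le hB hr))
  -- All `B` rounds are treated as a single family of independent contacts, indexed by round and
  -- node.
  rw [pr, ← avg_equiv (Equiv.curry (Fin B) (Fin n) ((Fin E → Bool) × Fin n))]
  refine avg_mono fun x => ind_mono fun hx => ?_
  exact stuck_spec hn h hB hS _ hx

/-- The operations that double the size of clusters. -/
def grow (B k : ℕ) : List Op := List.replicate B .recruit ++ [.trunc (2 * k)]

/-- If `s` clusters are lost, some set of `s` leaders is stuck; there are at most `2 ^ L` such sets.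
The cost is `B * (k * L)` for the invitations and twice `(B + 1) * (k * L)` for the truncation. -/
theorem hoare_grow (hn : 0 < n) (hk : 1 ≤ k) {B L c s : ℕ} (hB : 1 ≤ B) {r : ℝ}
    (hr : 17 + Real.log B ≤ r * (B - 1))
    (hsize : (N.failed.card : ℝ) + (1 + B) * (k * L) ≤ (1 - r) * n) :
    Hoare N E (fun σ => Uniform N k σ ∧ (leaders σ).card = L ∧ σ.cost ≤ c) (grow B k)
      (fun σ => Uniform N (2 * k) σ ∧ (leaders σ).card ≤ L ∧ L < (leaders σ).card + s ∧
        σ.cost ≤ c + (3 * B + 2) * (k * L)) (2 ^ L * Real.exp (-(16 * (k * s : ℕ)))) := by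
  classical
  have : Nonempty (Fin n) := ⟨⟨0, hn⟩⟩
  intro σ ⟨hσ, hL, hc⟩
  rw [grow, fail_replicate]
  have hun := pr_exists_le_card_mul ((leaders σ).powersetCard s) (fun S (ξ : Fin B → Input n E) =>
    ∀ a ∈ S, (candidates (exec N (.replicate B .recruit) (extend ξ) σ) a).card < 2 * k)
    (c := Real.exp (-(16 * (k * s : ℕ)))) fun S hS => by
      obtain ⟨hS, hSs⟩ := Finset.mem_powersetCard.1 hS
      have := pr_stuck_le (E := E) hn hσ hB hr (by rw [hL]; exact hsize) hS
      rwa [hSs] at this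
  have hcs : ((leaders σ).powersetCard s).card ≤ 2 ^ L := by
    rw [Finset.card_powersetCard, hL]
    exact Nat.choose_le_two_pow _ _
  have hcs' : (((leaders σ).powersetCard s).card : ℝ) ≤ 2 ^ L := by exact_mod_cast hcs
  refine le_trans ?_ (hun.trans (mul_le_mul_of_nonneg_right hcs' (Real.exp_nonneg _)))
  refine avg_mono fun ξ => ?_
  rw [fail, ← avg_const (α := Input n E) (ind _)]
  refine avg_mono fun z => ?_
  rw [fail]
  refine ind_mono fun hx => ?_
  by_contra hcon
  push Not at hcon
  refine hx ?_
  obtain ⟨h1, h2, -, -, h5, h6⟩ := recruits_spec (N := N) B (extend ξ) σ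
  set τ := exec N (.replicate B .recruit) (extend ξ) σ
  obtain ⟨t1, t2⟩ := trunc_spec (x := z) (k := 2 * k) (h6 hσ.wf) (by omega)
  have hsub : leaders (absStep N (.trunc (2 * k)) τ z) ⊆ leaders σ := by
    intro a ha
    rw [t2] at ha
    obtain ⟨v, hv⟩ := Finset.card_pos.1 (show 0 < (candidates τ a).card by omega)
    rw [mem_candidates, Abs.cl, h1] at hv
    cases hm : σ.mem v with
    | some b =>
      rw [hm] at hv
      exact mem_leaders_of (hm.trans hv)
    | none =>
      rw [hm, Option.none_or] at hv
      rcases h2 v a hv with h | ⟨i, -, u, hu, -⟩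
      · rw [hσ.cand] at h
        simp at h
      · exact mem_leaders_of hu
  refine ⟨t1, hL ▸ Finset.card_le_card hsub, ?_, ?_⟩
  · by_contra hlt
    have hlt' : s ≤ (leaders σ \ leaders (absStep N (.trunc (2 * k)) τ z)).card := by
      rw [Finset.card_sdiff_of_subset hsub, hL]
      omega
    obtain ⟨S, hS, hSs⟩ := Finset.exists_subset_card_eq hlt'
    obtain ⟨a, ha, hak⟩ := hcon S
      (Finset.mem_powersetCard.2 ⟨hS.trans Finset.sdiff_subset, hSs⟩)
    exact (Finset.mem_sdiff.1 (hS ha)).2 ((t2 a).2 hak)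
  · change τ.cost + 2 * (Finset.univ.filter fun v => τ.cl v ≠ none).card ≤ _
    have hcl : (Finset.univ.filter fun v => τ.cl v ≠ none).card ≤ k * L + B * (k * L) := by
      have hs : (Finset.univ.filter fun v => τ.cl v ≠ none) ⊆ members σ ∪
          ((Finset.univ : Finset (Fin B)) ×ˢ members σ).image fun j => (ξ j.1 j.2).2 := by
        intro v hv
        simp only [Finset.mem_filter, Finset.mem_univ, true_and] at hv
        rw [Finset.mem_union]
        by_cases hm : σ.mem v = none
        · right
          rw [Abs.cl, h1, hm, Option.none_or] at hv
          obtain ⟨a, ha⟩ := Option.ne_none_iff_exists'.1 hv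
          rcases h2 v a ha with h | ⟨i, hi, u, hu, huv⟩
          · rw [hσ.cand] at h
            simp at h
          · refine Finset.mem_image.2 ⟨(⟨i, hi⟩, u), ?_, ?_⟩
            · simp [members, hu]
            · rw [← huv, extend, dif_pos hi]
        · left; simp [members, hm]
      refine (Finset.card_le_card hs).trans ((Finset.card_union_le _ _).trans ?_)
      rw [hσ.card_members, hL]
      refine add_le_add le_rfl (Finset.card_image_le.trans ?_)
      rw [Finset.card_product, hσ.card_members, hL, Finset.card_univ, Fintype.card_fin]
    rw [h5, hσ.card_members, hL]
    nlinarith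

end Grow

/-! ### A single cluster and one round of joining -/

section Join

variable {n w E : ℕ} {N : Network n w} {σ : Abs n w}

/-- There is exactly one cluster, and its leader belongs to it. -/
def Clustered (N : Network n w) (σ : Abs n w) : Prop := WF N σ ∧ ∃ u, OneCluster N u σ

theorem card_all (h : WF N σ) :
    (members σ).card + (outsiders N σ).card + N.failed.card = n := by
  classical
  have h1 : members σ ∪ outsiders N σ ∪ N.failed = Finset.univ := by
    ext v
    simp only [members, outsiders, Finset.mem_union, Finset.mem_filter, Finset.mem_univ, true_and,
      iff_true]
    tauto
  have h2 : Disjoint (members σ) (outsiders N σ) := by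
    rw [Finset.disjoint_left]
    intro v hv hv'
    simp only [members, outsiders, Finset.mem_filter, Finset.mem_univ, true_and] at hv hv'
    exact hv hv'.2
  have h3 : Disjoint (members σ ∪ outsiders N σ) N.failed := by
    rw [Finset.disjoint_left]
    intro v hv hvf
    simp only [members, outsiders, Finset.mem_union, Finset.mem_filter, Finset.mem_univ,
      true_and] at hv
    rcases hv with hv | hv
    · exact hv (h.mem_failed v hvf)
    · exact hv.1 hvf
  rw [← Finset.card_union_of_disjoint h2, ← Finset.card_union_of_disjoint h3, h1,
    Finset.card_univ, Fintype.card_fin]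

/-- A leader need not belong to its cluster: truncation by ID may drop it, and a settlement may have
moved it elsewhere. With a single cluster it can be restored without harm, as fault tolerance and
`share` require. -/
theorem crown_spec {k : ℕ} (h : Uniform N k σ) (hL : (leaders σ).card = 1) {x : Input n E} :
    Clustered N (absStep N .crown σ x) ∧ k ≤ (members (absStep N .crown σ x)).card ∧
      (absStep N .crown σ x).cost = σ.cost + k := by
  classical
  obtain ⟨a, ha⟩ := Finset.card_eq_one.1 hL
  have hal : ∀ v b, σ.mem v = some b → b = a := fun v b hv => by
    have := mem_leaders_of hv
    rwa [ha, Finset.mem_singleton] at this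
  obtain ⟨v₀, hv₀⟩ := mem_leaders.1 (ha ▸ Finset.mem_singleton_self a)
  obtain ⟨u, hu, hua⟩ := h.wf.mem_leader v₀ a hv₀
  have hmem : ∀ v, v ∉ N.failed → (absStep N .crown σ x).mem v =
      if ∃ t, σ.mem t = some (N.id v) then some (N.id v) else σ.mem v := fun v hv => by
    rw [absStep_mem hv]
    simp only [newMem]
  have hkeep : ∀ v, σ.mem v ≠ none → (absStep N .crown σ x).mem v ≠ none := by
    intro v hv
    rw [hmem v fun hf => hv (h.wf.mem_failed v hf)]
    split_ifs
    · simp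
    · exact hv
  refine ⟨⟨h.wf.absStep, u, ?_, fun v => ?_⟩, ?_, ?_⟩
  · rw [hmem u hu, if_pos ⟨v₀, hua ▸ hv₀⟩]
  · by_cases hf : v ∈ N.failed
    · exact Or.inl (h.wf.absStep.mem_failed v hf)
    · rw [hmem v hf]
      split_ifs with hc
      · obtain ⟨t, ht⟩ := hc
        right
        rw [hal t _ ht, hua]
      · cases hv : σ.mem v with
        | none => exact Or.inl rfl
        | some b => right; rw [hal v b hv, hua]
  · have : (members σ).card = k := by rw [h.card_members, hL, mul_one]
    rw [← this]
    refine Finset.card_le_card fun v hv => ?_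
    simp only [members, Finset.mem_filter, Finset.mem_univ, true_and] at hv ⊢
    exact hkeep v hv
  · change σ.cost + (members σ).card = _
    rw [h.card_members, hL, mul_one]

open scoped Classical in
theorem join_spec (h : Clustered N σ) {x : Input n E} :
    Clustered N (absStep N .join σ x) ∧
      outsiders N (absStep N .join σ x) = (outsiders N σ).filter (fun v => (x v).2 ∉ members σ) ∧
      (absStep N .join σ x).cost = σ.cost + (outsiders N σ).card := by
  obtain ⟨hw, u, hu, hall⟩ := h
  have hmem : ∀ v, v ∉ N.failed → (absStep N .join σ x).mem v =
      (σ.mem v).or (σ.mem (x v).2) := fun v hv => by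
    rw [absStep_mem hv]
    simp only [newMem]
  refine ⟨⟨hw.absStep, u, ?_, fun v => ?_⟩, ?_, rfl⟩
  · rw [hmem u fun hf => by simp [hw.mem_failed u hf] at hu, hu, Option.some_or]
  · by_cases hf : v ∈ N.failed
    · exact Or.inl (hw.absStep.mem_failed v hf)
    · rw [hmem v hf]
      rcases hall v with hv | hv
      · rw [hv, Option.none_or]
        exact hall _
      · rw [hv, Option.some_or]
        exact Or.inr rfl
  · ext v
    simp only [outsiders, members, Finset.mem_filter, Finset.mem_univ, true_and, ne_eq, not_not,
      and_assoc]
    refine and_congr_right fun hf => ?_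
    rw [hmem v hf, Option.or_eq_none_iff]

theorem pr_miss (hn : 0 < n) (h : WF N σ) (v : Fin n) :
    pr (fun x : Input n E => (x v).2 ∉ members σ) =
      (N.failed.card + (outsiders N σ).card) / n := by
  have : Nonempty (Fin n) := ⟨v⟩
  have hn' : (0 : ℝ) < n := by exact_mod_cast hn
  rw [pr_not, pr_apply v fun a : (Fin E → Bool) × Fin n => a.2 ∈ members σ]
  rw [pr_contact hn, eq_div_iff hn'.ne', sub_mul, div_mul_cancel₀ _ hn'.ne', one_mul]
  have : ((members σ).card + (outsiders N σ).card + N.failed.card : ℝ) = n := by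
    exact_mod_cast card_all h
  linarith

theorem card_outsiders_join_le (h : Clustered N σ) {x : Input n E} :
    (outsiders N (absStep N .join σ x)).card ≤ (outsiders N σ).card := by
  classical
  rw [(join_spec h).2.1]
  exact Finset.card_filter_le _ _

/-- This is the estimate for many outsiders: each joins with probability at least `q`, and a quarter
of the corresponding mean is guaranteed. -/
theorem pr_join_lower (h : Clustered N σ) {q t : ℝ} (hn : 0 < n) (hq0 : 0 ≤ q)
    (hq : q * n ≤ (members σ).card) (ht : t ≤ q * (outsiders N σ).card / 4) :
    pr (fun x : Input n E => ¬ ((outsiders N (absStep N .join σ x)).card : ℝ) ≤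
      (1 - q / 4) * (outsiders N σ).card) ≤ Real.exp (-t) := by
  classical
  have : Nonempty (Fin n) := ⟨⟨0, hn⟩⟩
  have hn' : (0 : ℝ) < n := by exact_mod_cast hn
  have h1 := lower_tail (outsiders N σ) (fun v => {v})
    (fun v (x : Input n E) => (x v).2 ∈ members σ) (p := q) hq0
    (fun i _ j _ hij => by simpa [Function.onFun] using hij)
    (fun v _ x y hxy => by simp only [hxy v rfl])
    (fun v _ => by
      rw [pr_apply v fun a : (Fin E → Bool) × Fin n => a.2 ∈ members σ, pr_contact hn,
        le_div_iff₀ hn']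
      exact hq)
  refine le_trans (pr_mono fun x hx => ?_) (h1.trans (Real.exp_le_exp.2 (by linarith)))
  rw [(join_spec h).2.1, not_le] at hx
  have h2 := Finset.card_filter_add_card_filter_not (s := outsiders N σ)
    (fun v => (x v).2 ∈ members σ)
  have h3 : (((outsiders N σ).filter fun v => (x v).2 ∈ members σ).card : ℝ) +
      ((outsiders N σ).filter fun v => (x v).2 ∉ members σ).card = (outsiders N σ).card := by
    rw [← h2]
    push_cast
    congr!
  refine lt_of_eq_of_lt (by congr!) (show (((outsiders N σ).filter fun v =>
    (x v).2 ∈ members σ).card : ℝ) < _ from ?_)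
  linarith

/-- This is the estimate for few outsiders: a node stays outside only if it hits a failed node or
another outsider, so `m` turns into about `m * (F + m) / n`. -/
theorem pr_join_upper (h : Clustered N σ) {t : ℝ} (hn : 0 < n) :
    pr (fun x : Input n E => ¬ ((outsiders N (absStep N .join σ x)).card : ℝ) ≤
      4 * (outsiders N σ).card * ((N.failed.card + (outsiders N σ).card) / n) + t) ≤
      Real.exp (-t) := by
  classical
  have : Nonempty (Fin n) := ⟨⟨0, hn⟩⟩
  have h1 := upper_tail (outsiders N σ) (fun v => {v})
    (fun v (x : Input n E) => (x v).2 ∉ members σ) (q := (N.failed.card + (outsiders N σ).card) / n)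
    (4 * (outsiders N σ).card * ((N.failed.card + (outsiders N σ).card) / n) + t)
    (fun i _ j _ hij => by simpa [Function.onFun] using hij)
    (fun v _ x y hxy => by simp only [hxy v rfl])
    (fun v _ => (pr_miss hn h.1 v).le)
  refine le_trans (pr_mono fun x hx => ?_) (h1.trans (Real.exp_le_exp.2 ?_))
  · rw [(join_spec h).2.1, not_le] at hx
    exact hx.le.trans_eq (by congr!)
  · have : (0 : ℝ) ≤ (outsiders N σ).card * ((N.failed.card + (outsiders N σ).card) / n) := by
      positivity
    linarith

theorem avg_join (h : Clustered N σ) (hn : 0 < n) :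
    avg (fun x : Input n E => ((outsiders N (absStep N .join σ x)).card : ℝ)) =
      (outsiders N σ).card * ((N.failed.card + (outsiders N σ).card) / n) := by
  classical
  have h1 : ∀ x : Input n E, ((outsiders N (absStep N .join σ x)).card : ℝ) =
      ∑ v ∈ outsiders N σ, ind ((x v).2 ∉ members σ) := by
    intro x
    rw [(join_spec h).2.1, Finset.card_filter]
    push_cast
    refine Finset.sum_congr rfl fun v _ => ?_
    unfold ind
    congr!
  simp only [h1]
  rw [avg_sum]
  refine (Finset.sum_congr rfl fun v _ => pr_miss hn h.1 v).trans ?_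
  simp

/-- First moment: every round multiplies the expected number of outsiders by at most `y`, and the
indicator that one is left is at most their number. -/
theorem fail_joins_le (hn : 0 < n) {y : ℝ} {m J c : ℕ} (h : Clustered N σ)
    (hm : (outsiders N σ).card ≤ m) (hy : (N.failed.card + m : ℝ) / n ≤ y)
    (hc : σ.cost + J * m ≤ c) :
    fail N E (.replicate J .join) σ
      (fun τ => Clustered N τ ∧ (outsiders N τ).card = 0 ∧ τ.cost ≤ c) ≤
      (outsiders N σ).card * y ^ J := by
  have : Nonempty (Fin n) := ⟨⟨0, hn⟩⟩
  have hy0 : 0 ≤ y := le_trans (by positivity) hy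
  induction J generalizing σ with
  | zero =>
    rw [List.replicate_zero, fail, pow_zero, mul_one]
    by_cases h0 : (outsiders N σ).card = 0
    · rw [ind_false (not_not.2 ⟨h, h0, by simpa using hc⟩)]
      positivity
    · refine (ind_le_one _).trans ?_
      exact_mod_cast Nat.one_le_iff_ne_zero.2 h0
  | succ J ih =>
    rw [List.replicate_succ, fail]
    have h1 : ∀ x : Input n E, fail N E (.replicate J .join) (absStep N .join σ x)
        (fun τ => Clustered N τ ∧ (outsiders N τ).card = 0 ∧ τ.cost ≤ c) ≤
        y ^ J * (outsiders N (absStep N .join σ x)).card := by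
      intro x
      rw [mul_comm]
      refine ih (join_spec h).1 ((card_outsiders_join_le h).trans hm) ?_
      rw [(join_spec h).2.2]
      rw [add_mul] at hc
      omega
    refine (avg_mono h1).trans ?_
    rw [avg_mul_left, avg_join h hn, mul_comm, mul_assoc]
    have h2 : (N.failed.card + (outsiders N σ).card : ℝ) / n ≤ y := by
      refine le_trans ?_ hy
      gcongr
    have h3 : (0 : ℝ) ≤ (outsiders N σ).card := by positivity
    have h4 : 0 ≤ y ^ J := by positivity
    calc ((outsiders N σ).card : ℝ) * (((N.failed.card + (outsiders N σ).card : ℝ) / n) * y ^ J)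
        ≤ (outsiders N σ).card * (y * y ^ J) := by gcongr
      _ = _ := by ring

end Join

/-! ### Decay of the number of outsiders -/

section Joins

variable {n w E : ℕ} {N : Network n w}

theorem Hoare.replicate {P : ℕ → Abs n w → Prop} {o : Op} {δ : ℝ} (h0 : 0 ≤ δ) (m : ℕ)
    (h : ∀ j < m, Hoare N E (P j) [o] (P (j + 1)) δ) :
    Hoare N E (P 0) (.replicate m o) (P m) (m * δ) := by
  induction m with
  | zero => simpa using Hoare.nil fun σ hσ => hσ
  | succ m ih =>
    rw [List.replicate_succ']
    refine ((ih fun j hj => h j (by omega)).append (h m (by omega)) h0).mono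
      (fun _ hσ => hσ) (fun _ hσ => hσ) ?_
    push_cast
    linarith

variable {q t c M : ℝ} {J : ℕ}

theorem members_join (h : Clustered N σ) {x : Input n E} :
    (members σ).card ≤ (members (absStep N .join σ x)).card := by
  have h1 := card_all h.1
  have h2 := card_all (join_spec h (x := x)).1.1
  have h3 := card_outsiders_join_le h (x := x)
  omega

/-- Joining a cluster of linear size. -/
theorem hoare_join_first (hn : 0 < n) (hq0 : 0 < q) (hq1 : q ≤ 1) (ht : 0 ≤ t) (J : ℕ) :
    Hoare N E (fun σ => Clustered N σ ∧ q * n ≤ (members σ).card ∧ (σ.cost : ℝ) ≤ c)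
      (.replicate J .join)
      (fun σ => Clustered N σ ∧
        ((outsiders N σ).card : ℝ) ≤ max ((1 - q / 4) ^ J * n) (4 * t / q) ∧
        (σ.cost : ℝ) ≤ c + 4 * n / q + J * (4 * t / q)) (J * Real.exp (-t)) := by
  have : Nonempty (Fin n) := ⟨⟨0, hn⟩⟩
  have hn' : (0 : ℝ) < n := by exact_mod_cast hn
  have hq' : 0 ≤ 1 - q / 4 := by linarith
  have htq : 0 ≤ 4 * t / q := by positivity
  -- Geometric decay down to the floor `4 * t / q`, below which the lower tail no longer yields `exp
  -- (-t)`.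
  let b : ℕ → ℝ := fun j => max ((1 - q / 4) ^ j * n) (4 * t / q)
  refine (Hoare.replicate (P := fun j σ => Clustered N σ ∧ q * n ≤ (members σ).card ∧
    ((outsiders N σ).card : ℝ) ≤ b j ∧
    (σ.cost : ℝ) ≤ c + ∑ i ∈ Finset.range j, b i) (Real.exp_nonneg (-t)) J
    fun j _ => ?_).mono ?_ ?_ le_rfl
  · refine Hoare.single fun σ ⟨h1, h2, h3, h4⟩ => ?_
    have hbase : ∀ x : Input n E, ((outsiders N (absStep N .join σ x)).card : ℝ) ≤ b (j + 1) →
        Clustered N (absStep N .join σ x) ∧ q * n ≤ (members (absStep N .join σ x)).card ∧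
        ((outsiders N (absStep N .join σ x)).card : ℝ) ≤ b (j + 1) ∧
        ((absStep N .join σ x).cost : ℝ) ≤ c + ∑ i ∈ Finset.range (j + 1), b i := by
      intro x hx
      refine ⟨(join_spec h1).1, h2.trans (Nat.cast_le.2 (members_join h1)), hx, ?_⟩
      rw [(join_spec h1).2.2, Finset.sum_range_succ]
      push_cast
      linarith
    by_cases hm : t ≤ q * (outsiders N σ).card / 4
    · refine (pr_mono fun x hx => ?_).trans (pr_join_lower h1 hn hq0.le h2 hm)
      intro hle
      refine hx (hbase x (hle.trans ?_))
      refine (mul_le_mul_of_nonneg_left h3 hq').trans ?_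
      rw [mul_max_of_nonneg _ _ hq']
      refine max_le_max ?_ ?_
      · rw [pow_succ]; linarith
      · nlinarith
    -- Below the floor nothing random is needed, since the number of outsiders never increases.
    · refine le_trans ((pr_mono (Q := fun _ => False) fun x hx => hx (hbase x ?_)).trans
        (by rw [pr]; simp only [ind_false not_false]; rw [avg_const])) (Real.exp_nonneg _)
      refine (Nat.cast_le.2 (card_outsiders_join_le h1)).trans (le_max_of_le_right ?_)
      rw [le_div_iff₀ hq0]
      linarith
  · rintro σ ⟨h1, h2, h3⟩
    refine ⟨h1, h2, ?_, by simpa using h3⟩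
    refine le_max_of_le_left ?_
    rw [pow_zero, one_mul]
    have := card_all h1.1
    exact_mod_cast (by omega : (outsiders N σ).card ≤ n)
  · rintro σ ⟨h1, -, h3, h4⟩
    refine ⟨h1, h3, h4.trans ?_⟩
    -- Each round costs one PULL per outsider; the geometric series keeps the total linear although
    -- `J` is unbounded.
    have hsum : ∑ i ∈ Finset.range J, b i ≤ 4 * n / q + J * (4 * t / q) := by
      calc ∑ i ∈ Finset.range J, b i
          ≤ ∑ i ∈ Finset.range J, ((1 - q / 4) ^ i * n + 4 * t / q) := by
            refine Finset.sum_le_sum fun i _ => max_le ?_ ?_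
            · linarith
            · have : 0 ≤ (1 - q / 4) ^ i * n := by positivity
              linarith
        _ = (∑ i ∈ Finset.range J, (1 - q / 4) ^ i) * n + J * (4 * t / q) := by
            rw [Finset.sum_add_distrib, Finset.sum_mul]
            simp
        _ ≤ 4 * n / q + J * (4 * t / q) := by
            have hg := geom_sum_mul (1 - q / 4) J
            have h0 : 0 ≤ (1 - q / 4) ^ J := by positivity
            have : ∑ i ∈ Finset.range J, (1 - q / 4) ^ i ≤ 4 / q := by
              rw [le_div_iff₀ hq0]
              linarith
            have := mul_le_mul_of_nonneg_right this hn'.le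
            rw [div_mul_eq_mul_div] at this
            linarith
    linarith

/-- Joining when few nodes are missing. -/
theorem hoare_join_second (hn : 0 < n) (hM : 32 * M ≤ n) (hJ : n < 2 ^ 2 ^ J) :
    Hoare N E (fun σ => Clustered N σ ∧ ((outsiders N σ).card : ℝ) ≤ M ∧ (σ.cost : ℝ) ≤ c)
      (.replicate J .join)
      (fun σ => Clustered N σ ∧ ((outsiders N σ).card : ℝ) ≤ M ∧
        ((outsiders N σ).card ≤ N.failed.card ∨ ((outsiders N σ).card : ℝ) ≤ 2 * t) ∧
        (σ.cost : ℝ) ≤ c + J * M) (J * Real.exp (-t)) := by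
  have : Nonempty (Fin n) := ⟨⟨0, hn⟩⟩
  have hn' : (0 : ℝ) < n := by exact_mod_cast hn
  -- As long as `m` exceeds both `F` and `2 * t`, the next number is at most `16 * m * m / n`, so
  -- `16 * m / n` is at least squared in every round. The hypothesis `32 * M ≤ n` starts this at `j
  -- = 0`.
  refine (Hoare.replicate (P := fun j σ => Clustered N σ ∧ ((outsiders N σ).card : ℝ) ≤ M ∧
    ((outsiders N σ).card ≤ N.failed.card ∨ ((outsiders N σ).card : ℝ) ≤ 2 * t ∨
      16 * ((outsiders N σ).card : ℝ) * 2 ^ 2 ^ j ≤ n) ∧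
    (σ.cost : ℝ) ≤ c + j * M) (Real.exp_nonneg (-t)) J
    fun j _ => ?_).mono ?_ ?_ le_rfl
  · refine Hoare.single fun σ ⟨h1, h2, h3, h4⟩ => ?_
    refine (pr_mono fun x hx => ?_).trans (pr_join_upper h1 hn)
    intro hle
    have hmono := card_outsiders_join_le h1 (x := x)
    have hmono' : ((outsiders N (absStep N .join σ x)).card : ℝ) ≤ (outsiders N σ).card := by
      exact_mod_cast hmono
    refine hx ⟨(join_spec h1).1, hmono'.trans h2, ?_, ?_⟩
    swap
    · rw [(join_spec h1).2.2]
      push_cast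
      linarith
    by_cases hF : (outsiders N σ).card ≤ N.failed.card
    · exact Or.inl (hmono.trans hF)
    by_cases h2t : ((outsiders N σ).card : ℝ) ≤ 2 * t
    · exact Or.inr (Or.inl (hmono'.trans h2t))
    have h5 : 16 * ((outsiders N σ).card : ℝ) * 2 ^ 2 ^ j ≤ n := by tauto
    right
    set m : ℝ := ((outsiders N σ).card : ℝ)
    set m' : ℝ := ((outsiders N (absStep N .join σ x)).card : ℝ)
    have hm0 : 0 ≤ m := Nat.cast_nonneg _
    have hF' : (N.failed.card : ℝ) ≤ m := Nat.cast_le.2 (not_le.1 hF).le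
    have h6 : m' ≤ 8 * m * m / n + t := by
      refine hle.trans ?_
      have : 4 * m * ((N.failed.card + m) / n) ≤ 4 * m * ((m + m) / n) := by gcongr
      refine (add_le_add_left this t).trans (le_of_eq ?_)
      ring
    by_cases h7 : 8 * m * m / n ≤ t
    · left; linarith
    · right
      have h8 : m' ≤ 16 * m * m / n := by
        have : 16 * m * m / n = 2 * (8 * m * m / n) := by ring
        linarith
      rw [pow_succ 2 j, pow_mul]
      set X : ℝ := 2 ^ 2 ^ j
      have hX : 0 ≤ X := by positivity
      calc 16 * m' * X ^ 2 ≤ 16 * (16 * m * m / n) * X ^ 2 := by gcongr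
        _ = (16 * m * X) * (16 * m * X) / n := by ring
        _ ≤ n * n / n := by gcongr
        _ = n := by field_simp
  · rintro σ ⟨h1, h2, h3⟩
    refine ⟨h1, h2, Or.inr (Or.inr ?_), by simpa using h3⟩
    norm_num
    linarith
  · rintro σ ⟨h1, h2, h3, h4⟩
    refine ⟨h1, h2, ?_, h4⟩
    rcases h3 with h | h | h
    · exact Or.inl h
    · exact Or.inr h
    -- Here `m` is less than 1, so no outsider is left.
    · left
      have h5 : (n : ℝ) < 2 ^ 2 ^ J := by exact_mod_cast hJ
      by_contra hlt
      have h6 : (1 : ℝ) ≤ (outsiders N σ).card := by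
        exact_mod_cast (by omega : 1 ≤ (outsiders N σ).card)
      nlinarith

/-- One more step. -/
theorem hoare_join_third (hn : 0 < n) (ht : 0 ≤ t) :
    Hoare N E (fun σ => Clustered N σ ∧ ((outsiders N σ).card : ℝ) ≤ M ∧
        ((outsiders N σ).card ≤ N.failed.card ∨ ((outsiders N σ).card : ℝ) ≤ 2 * t) ∧
        (σ.cost : ℝ) ≤ c) [.join]
      (fun σ => Clustered N σ ∧ ((outsiders N σ).card : ℝ) ≤ M ∧
        ((outsiders N σ).card : ℝ) ≤ 8 * M / n * N.failed.card + 2 * t ∧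
        (σ.cost : ℝ) ≤ c + M) (Real.exp (-t)) := by
  have : Nonempty (Fin n) := ⟨⟨0, hn⟩⟩
  have hn' : (0 : ℝ) < n := by exact_mod_cast hn
  refine Hoare.single fun σ ⟨h1, h2, h3, h4⟩ => ?_
  refine (pr_mono fun x hx => ?_).trans (pr_join_upper h1 hn)
  intro hle
  have hmono' : ((outsiders N (absStep N .join σ x)).card : ℝ) ≤ (outsiders N σ).card := by
    exact_mod_cast card_outsiders_join_le h1 (x := x)
  have hm0 : (0 : ℝ) ≤ (outsiders N σ).card := Nat.cast_nonneg _
  have hM0 : 0 ≤ M := hm0.trans h2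
  refine hx ⟨(join_spec h1).1, hmono'.trans h2, ?_, ?_⟩
  swap
  · rw [(join_spec h1).2.2]
    push_cast
    linarith
  -- If `m ≤ F`, using `m ≤ M` for one factor and `m ≤ F` inside the miss probability turns `m` into
  -- `8 * M / n * F` plus `t`: this is what makes the loss `o(F)`.
  rcases h3 with h | h
  · refine hle.trans ?_
    have hF : ((outsiders N σ).card : ℝ) ≤ N.failed.card := by exact_mod_cast h
    have : 4 * ((outsiders N σ).card : ℝ) * ((N.failed.card + (outsiders N σ).card) / n) ≤
        4 * M * ((N.failed.card + N.failed.card) / n) := by gcongr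
    have h5 : 4 * M * ((N.failed.card + N.failed.card : ℝ) / n) = 8 * M / n * N.failed.card := by
      ring
    linarith
  · have : 0 ≤ 8 * M / n * N.failed.card := by positivity
    linarith

/-- The last nodes join. -/
theorem hoare_join_last (hn : 0 < n) (ht : 0 ≤ t) (hM : 32 * M ≤ n) {T δ : ℝ} (hT : 0 < T)
    (hδ0 : 0 ≤ δ) (hδ : n * ((2 * T + 2 * t) / n) ^ J ≤ δ) :
    Hoare N E (fun σ => Clustered N σ ∧ ((outsiders N σ).card : ℝ) ≤ M ∧
        ((outsiders N σ).card : ℝ) ≤ 8 * M / n * N.failed.card + 2 * t ∧ (σ.cost : ℝ) ≤ c)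
      (.replicate J .join)
      (fun σ => Clustered N σ ∧
        ((outsiders N σ).card : ℝ) ≤ (8 * M / n + 2 * t / T) * N.failed.card ∧
        (σ.cost : ℝ) ≤ c + J * M) δ := by
  have : Nonempty (Fin n) := ⟨⟨0, hn⟩⟩
  have hn' : (0 : ℝ) < n := by exact_mod_cast hn
  intro σ ⟨h1, h2, h3, h4⟩
  have hm0 : (0 : ℝ) ≤ (outsiders N σ).card := Nat.cast_nonneg _
  have hM0 : 0 ≤ M := hm0.trans h2
  -- With many failures the additive term `2 * t` is at most `(2 * t / T) * F`. With few, `F + m ≤ 2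
  -- * T + 2 * t`, so a PULL rarely misses and all outsiders disappear.
  by_cases hF : T ≤ N.failed.card
  · have h5 : ((outsiders N σ).card : ℝ) ≤ (8 * M / n + 2 * t / T) * N.failed.card := by
      refine h3.trans ?_
      rw [add_mul]
      have : 2 * t ≤ 2 * t / T * N.failed.card := by
        rw [div_mul_eq_mul_div, le_div_iff₀ hT]
        gcongr
      linarith
    have h6 := Hoare.replicate (N := N) (E := E) (o := .join) (P := fun j σ => Clustered N σ ∧
      ((outsiders N σ).card : ℝ) ≤ (8 * M / n + 2 * t / T) * N.failed.card ∧
      ((outsiders N σ).card : ℝ) ≤ M ∧ (σ.cost : ℝ) ≤ c + j * M) le_rfl J fun j _ =>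
        Hoare.sure fun σ ⟨g1, g2, g3, g4⟩ x => by
          have hmono' : ((outsiders N (absStep N .join σ x)).card : ℝ) ≤ (outsiders N σ).card := by
            exact_mod_cast card_outsiders_join_le g1 (x := x)
          refine ⟨(join_spec g1).1, hmono'.trans g2, hmono'.trans g3, ?_⟩
          rw [(join_spec g1).2.2]
          push_cast
          linarith
    refine (h6.mono (fun _ h => h) (fun σ h => ⟨h.1, h.2.1, h.2.2.2⟩) ?_) σ
      ⟨h1, h5, h2, by simpa using h4⟩
    simpa using hδ0
  · have h5 := fail_joins_le (E := E) (J := J) (c := σ.cost + J * (outsiders N σ).card)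
      (y := (2 * T + 2 * t) / n) hn h1 le_rfl (by
        refine div_le_div_of_nonneg_right ?_ hn'.le
        have : 8 * M / n * N.failed.card ≤ 1 * T := by
          gcongr
          · rw [div_le_one hn']; linarith
          · exact (not_le.1 hF).le
        linarith [not_le.1 hF]) le_rfl
    refine (fail_mono ?_ _ _).trans (h5.trans (le_trans ?_ hδ))
    · rintro τ ⟨g1, g2, g3⟩
      refine ⟨g1, ?_, ?_⟩
      · rw [g2]
        push_cast
        positivity
      · have g3' : (τ.cost : ℝ) ≤ σ.cost + J * (outsiders N σ).card := by exact_mod_cast g3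
        have : (J : ℝ) * (outsiders N σ).card ≤ J * M := by gcongr
        linarith
    · have : (outsiders N σ).card ≤ n := by
        have := card_all h1.1
        omega
      have : ((outsiders N σ).card : ℝ) ≤ n := by exact_mod_cast this
      gcongr

theorem hoare_joins (hn : 0 < n) (hq0 : 0 < q) (hq1 : q ≤ 1) (ht : 0 ≤ t) {J₁ J₂ J₃ : ℕ}
    (hM1 : (1 - q / 4) ^ J₁ * n ≤ M) (hM2 : 4 * t / q ≤ M) (hM : 32 * M ≤ n)
    (hJ₂ : n < 2 ^ 2 ^ J₂) {T δ : ℝ} (hT : 0 < T) (hδ0 : 0 ≤ δ)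
    (hδ : n * ((2 * T + 2 * t) / n) ^ J₃ ≤ δ) :
    Hoare N E (fun σ => Clustered N σ ∧ q * n ≤ (members σ).card ∧ (σ.cost : ℝ) ≤ c)
      (.replicate J₁ .join ++ (.replicate J₂ .join ++ ([.join] ++ .replicate J₃ .join)))
      (fun σ => Clustered N σ ∧
        ((outsiders N σ).card : ℝ) ≤ (8 * M / n + 2 * t / T) * N.failed.card ∧
        (σ.cost : ℝ) ≤ c + 4 * n / q + (J₁ + J₂ + 1 + J₃) * M)
      ((J₁ + J₂ + 1) * Real.exp (-t) + δ) := by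
  have e := Real.exp_nonneg (-t)
  have h1 := hoare_join_first (N := N) (E := E) (c := c) hn hq0 hq1 ht J₁
  have h1' := h1.mono (R := fun σ => Clustered N σ ∧ ((outsiders N σ).card : ℝ) ≤ M ∧
    (σ.cost : ℝ) ≤ c + 4 * n / q + J₁ * M) (fun _ h => h) (fun σ ⟨g1, g2, g3⟩ =>
      ⟨g1, g2.trans (max_le hM1 hM2), g3.trans (by gcongr)⟩) le_rfl
  have h2 := hoare_join_second (N := N) (E := E) (t := t) (c := c + 4 * n / q + J₁ * M) hn hM hJ₂
  have h3 := hoare_join_third (N := N) (E := E) (M := M)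
    (c := c + 4 * n / q + J₁ * M + J₂ * M) hn ht
  have h4 := hoare_join_last (N := N) (E := E) (c := c + 4 * n / q + J₁ * M + J₂ * M + M) hn ht hM
    hT hδ0 hδ
  refine (h1'.append (h2.append (h3.append h4 hδ0) (by positivity)) (by positivity)).mono
    (fun _ h => h) (fun σ ⟨g1, g2, g3⟩ => ⟨g1, g2, g3.trans (le_of_eq (by ring))⟩)
    (le_of_eq (by ring))

end Joins

/-! ### Scales in `n`, and clusters of polylogarithmic size -/

section Schedule

/-- `Λ` and `ℓ` are the rounded logarithm and double logarithm of the large number `n`. -/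
structure Large (n Λ ℓ : ℕ) : Prop where
  le_n : 2 ^ Λ ≤ n
  n_lt : n < 2 ^ (Λ + 1)
  le_Λ : 2 ^ ℓ ≤ Λ
  Λ_lt : Λ < 2 ^ (ℓ + 1)
  large : 1000 * (ℓ + 1) ≤ 2 ^ ℓ

variable {n w Λ ℓ : ℕ} {N : Network n w}

theorem Large.pos (H : Large n Λ ℓ) : 0 < n := lt_of_lt_of_le (by positivity) H.le_n

/-- Because of this, `exp (-4 ^ ℓ)`, whose exponent is quadratic in `2 ^ ℓ`, beats every fixed power
of `n`. -/
theorem Large.le_exp (H : Large n Λ ℓ) : (n : ℝ) ≤ Real.exp (2 * 2 ^ ℓ) := by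
  have h1 : n ≤ 2 ^ (2 * 2 ^ ℓ) := by
    refine H.n_lt.le.trans (Nat.pow_le_pow_right (by norm_num) ?_)
    have := H.Λ_lt
    rw [pow_succ] at this
    omega
  have h2 : (n : ℝ) ≤ 2 ^ (2 * 2 ^ ℓ) := by exact_mod_cast h1
  refine h2.trans ?_
  have h3 : (2 : ℝ) ^ (2 * 2 ^ ℓ) ≤ Real.exp 1 ^ (2 * 2 ^ ℓ) :=
    pow_le_pow_left₀ (by norm_num) (by linarith [Real.add_one_le_exp (1 : ℝ)]) _
  rw [← Real.exp_nat_mul] at h3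
  refine h3.trans (le_of_eq ?_)
  push_cast
  ring_nf

/-- All clusters have `2 ^ κ` members, and the number of members is neither too large nor too
small. -/
def Mass (N : Network n w) (ℓ κ D c : ℕ) (σ : Abs n w) : Prop :=
  Uniform N (2 ^ κ) σ ∧ n ≤ 2 ^ κ * (leaders σ).card * 2 ^ D ∧
    2 ^ κ * (leaders σ).card * 4 ^ ℓ ≤ 4 * n ∧ σ.cost ≤ c

theorem two_pow_le_exp (m : ℕ) : (2 : ℝ) ^ m ≤ Real.exp m := by
  calc (2 : ℝ) ^ m ≤ Real.exp 1 ^ m :=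
        pow_le_pow_left₀ (by norm_num) (by linarith [Real.add_one_le_exp (1 : ℝ)]) _
    _ = Real.exp m := by rw [← Real.exp_nat_mul, mul_one]

variable {p : ℝ} {B : ℕ}

/-- The larger the clusters, the fewer are lost: at most `L₀ / (8 * 2 ^ j)` in phase `j`, which sums
to at most a quarter. The cost doubles with the cluster size, so it is dominated by the last phase.
-/
theorem hoare_growth (hn : 0 < n) (hB : 1 ≤ B) (hr : 17 + Real.log B ≤ p / 2 * (B - 1))
    (hF : (N.failed.card : ℝ) ≤ (1 - p) * n) (J L₀ : ℕ)
    (hsize : (1 + B) * (2 ^ J * L₀) ≤ p / 2 * n) :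
    Hoare N Λ (fun σ => Uniform N 1 σ ∧ (leaders σ).card = L₀ ∧ σ.cost = 0)
      ((List.range J).flatMap fun j => grow B (2 ^ j))
      (fun σ => Uniform N (2 ^ J) σ ∧ (leaders σ).card ≤ L₀ ∧ L₀ ≤ 2 * (leaders σ).card ∧
        σ.cost ≤ (3 * B + 2) * (2 ^ J * L₀)) (J * Real.exp (-L₀)) := by
  refine (Hoare.loop (P := fun j σ => Uniform N (2 ^ j) σ ∧ (leaders σ).card ≤ L₀ ∧
    L₀ * (3 / 4 + (1 / 2) ^ j / 4) ≤ ((leaders σ).card : ℝ) ∧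
    σ.cost ≤ (3 * B + 2) * (2 ^ j * L₀)) (Real.exp_nonneg (-L₀)) J fun j hj => ?_).mono ?_ ?_ le_rfl
  · intro σ ⟨h1, h2, h3, h4⟩
    have hkL : (2 : ℝ) ^ j * (leaders σ).card ≤ 2 ^ J * L₀ := by
      have : 2 ^ j * (leaders σ).card ≤ 2 ^ J * L₀ :=
        Nat.mul_le_mul (Nat.pow_le_pow_right (by norm_num) hj.le) h2
      exact_mod_cast this
    -- The value of `s` makes `2 ^ j * s ≥ L₀ / 8`, so the error `exp (-(2 * L₀))` outweighs the `2
    -- ^ L` sets of the union bound; the final `+ 1` turns the strict bound on losses into `L₀ / (8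
    -- * 2 ^ j)`.
    refine ((hoare_grow (N := N) (E := Λ) hn (Nat.one_le_two_pow (n := j)) (L := (leaders σ).card)
      (c := σ.cost) (s := L₀ / (8 * 2 ^ j) + 1) hB hr ?_).mono (P' := fun τ => τ = σ) ?_ ?_ ?_) σ rfl
    · push_cast
      have : (1 + B : ℝ) * (2 ^ j * (leaders σ).card) ≤ (1 + B) * (2 ^ J * L₀) := by gcongr
      linarith
    · rintro τ rfl
      exact ⟨h1, rfl, le_rfl⟩
    · rintro τ ⟨g1, g2, g3, g4⟩
      refine ⟨by rw [pow_succ, mul_comm]; exact g1, g2.trans h2, ?_, ?_⟩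
      · have g5 : (leaders σ).card ≤ (leaders τ).card + L₀ / (8 * 2 ^ j) := by omega
        have g6 : ((leaders σ).card : ℝ) ≤ (leaders τ).card + L₀ / (8 * 2 ^ j) := by
          have h := Nat.cast_div_le (α := ℝ) (m := L₀) (n := 8 * 2 ^ j)
          have g5' : ((leaders σ).card : ℝ) ≤ (leaders τ).card + (L₀ / (8 * 2 ^ j) : ℕ) := by
            exact_mod_cast g5
          push_cast at h
          linarith
        have g7 : (L₀ : ℝ) / (8 * 2 ^ j) = L₀ * ((1 / 2) ^ j / 8) := by
          rw [one_div, inv_pow]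
          field_simp
        rw [pow_succ]
        linarith
      · refine g4.trans ?_
        have : 2 ^ j * (leaders σ).card ≤ 2 ^ j * L₀ := Nat.mul_le_mul_left _ h2
        rw [pow_succ]
        nlinarith
    · have h5 : L₀ ≤ 8 * 2 ^ j * (L₀ / (8 * 2 ^ j) + 1) := by
        rw [mul_add, mul_one]
        have := Nat.div_add_mod L₀ (8 * 2 ^ j)
        have := Nat.mod_lt L₀ (show 0 < 8 * 2 ^ j by positivity)
        omega
      have h6 : (2 * L₀ : ℝ) ≤ 16 * (2 ^ j * (L₀ / (8 * 2 ^ j) + 1) : ℕ) := by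
        have : 2 * L₀ ≤ 16 * (2 ^ j * (L₀ / (8 * 2 ^ j) + 1)) := by nlinarith
        exact_mod_cast this
      have h7 : (2 : ℝ) ^ (leaders σ).card ≤ Real.exp L₀ :=
        (two_pow_le_exp _).trans (Real.exp_le_exp.2 (by exact_mod_cast h2))
      calc (2 : ℝ) ^ (leaders σ).card * Real.exp (-(16 * (2 ^ j * (L₀ / (8 * 2 ^ j) + 1) : ℕ)))
          ≤ Real.exp L₀ * Real.exp (-(2 * L₀)) := by
            gcongr
        _ = Real.exp (-L₀) := by rw [← Real.exp_add]; congr 1; ring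
  · rintro σ ⟨h1, h2, h3⟩
    refine ⟨by simpa using h1, h2.le, ?_, ?_⟩
    · rw [h2]; norm_num
    · rw [h3]; exact Nat.zero_le _
  · rintro σ ⟨h1, h2, h3, h4⟩
    refine ⟨h1, h2, ?_, h4⟩
    have : (0 : ℝ) ≤ (1 / 2) ^ J := by positivity
    have h5 : (L₀ : ℝ) ≤ 2 * (leaders σ).card := by nlinarith [L₀.cast_nonneg (α := ℝ)]
    exact_mod_cast h5

/-- The operations that create clusters of polylogarithmic size. -/
def startOps (B ℓ : ℕ) : List Op :=
  [.elect (102 * ℓ)] ++ (List.range (100 * ℓ)).flatMap fun j => grow B (2 ^ j)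

/-- The exponents 102 and 100 differ so that the clusters cover only a fraction of order `4 ^ (-ℓ)`
of the nodes. The lower bound has `3 * ℓ` in place of `2 * ℓ`: the extra factor `2 ^ ℓ` absorbs `p`
and the constants. Every failure has probability at most `exp (-4 ^ ℓ)`, there being at least `4 ^
ℓ` leaders. -/
theorem hoare_start (H : Large n Λ ℓ) (hp0 : 0 < p) (hB : 1 ≤ B) (hr : 17 + Real.log B ≤ p / 2 * (B - 1))
    (hF : (N.failed.card : ℝ) ≤ (1 - p) * n) (hpB : 8 * (3 * B + 2) ≤ p * 2 ^ ℓ) :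
    Hoare N Λ (fun σ => σ = Abs.init n w) (startOps B ℓ) (Mass N ℓ (100 * ℓ) (3 * ℓ) n)
      ((2 + 100 * ℓ) * Real.exp (-4 ^ ℓ)) := by
  have hn := H.pos
  have hn' : (0 : ℝ) < n := by exact_mod_cast hn
  have hΛ : 112 * ℓ ≤ Λ := by have := H.large; have := H.le_Λ; omega
  have hx : (4 : ℝ) ^ ℓ = 2 ^ ℓ * 2 ^ ℓ := by rw [← mul_pow]; norm_num
  have hB' : (1 : ℝ) ≤ B := by exact_mod_cast hB
  have h40 : 40 ≤ p * 2 ^ ℓ := by linarith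
  have hfail : ((n - N.failed.card : ℕ) : ℝ) ≥ p * n := by
    have : N.failed.card ≤ n := by simpa using Finset.card_le_univ N.failed
    rw [Nat.cast_sub this]
    linarith
  have hpn : p * n * (1 / 2) ^ (102 * ℓ) / 4 ≥ 4 ^ ℓ := by
    have h1 : (2 : ℝ) ^ (102 * ℓ + 3 * ℓ) ≤ n := by
      have : 2 ^ (102 * ℓ + 3 * ℓ) ≤ n :=
        (Nat.pow_le_pow_right (by norm_num) (by omega)).trans H.le_n
      exact_mod_cast this
    have h2 : (2 : ℝ) ^ (102 * ℓ + 3 * ℓ) * (1 / 2) ^ (102 * ℓ) = 2 ^ ℓ * 4 ^ ℓ := by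
      rw [pow_add, mul_right_comm, ← mul_pow, hx, show (2 : ℝ) * (1 / 2) = 1 by norm_num, one_pow,
        one_mul]
      ring
    have h3 : (2 : ℝ) ^ ℓ * 4 ^ ℓ ≤ n * (1 / 2) ^ (102 * ℓ) := by
      rw [← h2]; gcongr
    have h4 : (0 : ℝ) < 4 ^ ℓ := by positivity
    nlinarith
  have hη := Real.exp_nonneg (-4 ^ ℓ)
  have helect := hoare_elect (N := N) (E := Λ) (w := w) (e := 102 * ℓ) (by omega) hn
  refine (helect.append (δ' := 100 * ℓ * Real.exp (-4 ^ ℓ)) (R := Mass N ℓ (100 * ℓ) (3 * ℓ) n)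
    ?_ (by positivity)).mono (fun _ h => h) (fun _ h => h) ?_
  · intro σ ⟨h1, h2, h3, h4⟩
    set L₀ := (leaders σ).card
    have h5 : (4 : ℝ) ^ ℓ ≤ L₀ := by
      refine hpn.le.trans (le_trans ?_ h3)
      gcongr
    have hinv : (1 / 2 : ℝ) ^ (102 * ℓ) * 2 ^ (102 * ℓ) = 1 := by rw [← mul_pow]; norm_num
    have h6 : (2 : ℝ) ^ (102 * ℓ) * L₀ ≤ 4 * n := by
      calc (2 : ℝ) ^ (102 * ℓ) * L₀ ≤ 2 ^ (102 * ℓ) * (4 * n * (1 / 2) ^ (102 * ℓ)) := by gcongr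
        _ = 4 * n * ((1 / 2) ^ (102 * ℓ) * 2 ^ (102 * ℓ)) := by ring
        _ = 4 * n := by rw [hinv, mul_one]
    have h102 : (2 : ℝ) ^ (102 * ℓ) = 2 ^ (100 * ℓ) * 4 ^ ℓ := by
      rw [show 102 * ℓ = 100 * ℓ + (ℓ + ℓ) by ring, pow_add, pow_add, hx]
    rw [h102] at h6
    have h7 : (2 : ℝ) ^ ℓ * (2 ^ (100 * ℓ) * L₀) ≤ 4 * n := by
      have : (1 : ℝ) ≤ 2 ^ ℓ := one_le_pow₀ (by norm_num)
      have h8 : (0 : ℝ) ≤ 2 ^ (100 * ℓ) * L₀ := by positivity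
      have h9 := mul_le_mul_of_nonneg_right this h8
      have : (2 : ℝ) ^ ℓ * (1 * (2 ^ (100 * ℓ) * L₀)) ≤ 2 ^ ℓ * (2 ^ ℓ * (2 ^ (100 * ℓ) * L₀)) := by
        gcongr
      rw [hx] at h6
      linarith
    have h8 : (3 * B + 2 : ℝ) * (2 ^ (100 * ℓ) * L₀) ≤ p / 2 * n := by
      have h9 : (0 : ℝ) ≤ 2 ^ (100 * ℓ) * L₀ := by positivity
      have h10 := mul_le_mul_of_nonneg_right hpB h9
      nlinarith
    refine ((hoare_growth (Λ := Λ) hn hB hr hF (100 * ℓ) L₀ ?_).mono (P' := fun τ => τ = σ)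
      ?_ ?_ ?_) σ rfl
    · have h9 : (0 : ℝ) ≤ 2 ^ (100 * ℓ) * L₀ := by positivity
      nlinarith
    · rintro τ rfl
      exact ⟨h1, rfl, h2⟩
    · rintro τ ⟨g1, g2, g3, g4⟩
      refine ⟨g1, ?_, ?_, ?_⟩
      · have e1 : p * n ≤ 4 * 2 ^ (102 * ℓ) * L₀ := by
          have e2 : p * n * (1 / 2) ^ (102 * ℓ) / 4 ≤ L₀ := le_trans (by gcongr) h3
          have e3 := mul_le_mul_of_nonneg_left e2 (show (0 : ℝ) ≤ 4 * 2 ^ (102 * ℓ) by positivity)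
          calc p * n = 4 * 2 ^ (102 * ℓ) * (p * n * (1 / 2) ^ (102 * ℓ) / 4) := by
                rw [show 4 * (2 : ℝ) ^ (102 * ℓ) * (p * n * (1 / 2) ^ (102 * ℓ) / 4) =
                  p * n * ((1 / 2) ^ (102 * ℓ) * 2 ^ (102 * ℓ)) by ring, hinv, mul_one]
            _ ≤ _ := e3
        have e4 : (L₀ : ℝ) ≤ 2 * (leaders τ).card := by exact_mod_cast g3
        have e5 : (40 : ℝ) * n ≤ 2 ^ ℓ * (8 * 2 ^ (102 * ℓ) * (leaders τ).card) := by
          calc (40 : ℝ) * n ≤ p * 2 ^ ℓ * n := by gcongr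
            _ = 2 ^ ℓ * (p * n) := by ring
            _ ≤ 2 ^ ℓ * (4 * 2 ^ (102 * ℓ) * (2 * (leaders τ).card)) := by
              refine mul_le_mul_of_nonneg_left (e1.trans ?_) (by positivity)
              gcongr
            _ = _ := by ring
        have e6 : (n : ℝ) ≤ 2 ^ (100 * ℓ) * (leaders τ).card * 2 ^ (3 * ℓ) := by
          have : (2 : ℝ) ^ (100 * ℓ) * (leaders τ).card * 2 ^ (3 * ℓ) =
              2 ^ ℓ * (2 ^ (102 * ℓ) * (leaders τ).card) := by
            rw [h102, hx, mul_comm 3 ℓ, pow_mul]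
            ring
          rw [this]
          linarith
        exact_mod_cast e6
      · have e1 : ((leaders τ).card : ℝ) ≤ L₀ := by exact_mod_cast g2
        have e2 : (2 : ℝ) ^ (100 * ℓ) * (leaders τ).card * 4 ^ ℓ ≤ 4 * n := by
          refine le_trans ?_ h6
          rw [mul_right_comm]
          gcongr
        exact_mod_cast e2
      · have e1 : (τ.cost : ℝ) ≤ (3 * B + 2) * (2 ^ (100 * ℓ) * L₀) := by exact_mod_cast g4
        have e2 : (τ.cost : ℝ) ≤ n := by nlinarith
        exact_mod_cast e2
    · push_cast
      gcongr
  · rw [add_mul]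
    refine add_le_add ?_ le_rfl
    have e1 : Real.exp (-(((n - N.failed.card : ℕ) : ℝ) * (1 / 2) ^ (102 * ℓ) / 4)) ≤
        Real.exp (-4 ^ ℓ) := by
      refine Real.exp_le_exp.2 (neg_le_neg (hpn.le.trans ?_))
      gcongr
    have e2 : Real.exp (-(2 * n * (1 / 2) ^ (102 * ℓ))) ≤ Real.exp (-4 ^ ℓ) := by
      refine Real.exp_le_exp.2 (neg_le_neg (hpn.le.trans ?_))
      have : (0 : ℝ) < (1 / 2) ^ (102 * ℓ) := by positivity
      have : (0 : ℝ) ≤ n * (1 / 2) ^ (102 * ℓ) := by positivity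
      nlinarith
    linarith

end Schedule

/-! ### The sequence of merges, and the growth of the single cluster -/

section Merges

variable {n w Λ ℓ : ℕ} {N : Network n w}

theorem Large.one_le (H : Large n Λ ℓ) : 1 ≤ ℓ := by
  have := H.large
  by_contra h
  have h0 : ℓ = 0 := by omega
  subst h0
  simp at this

/-- The exponent of the cluster size after a merge. -/
def mergeNext (Λ κ : ℕ) : ℕ := if 5 * κ < 3 * Λ then κ + κ / 2 else κ

/-- The operations that merge clusters of size `2 ^ κ`. -/
def mergeOps (Λ κ : ℕ) : List Op :=
  if 5 * κ < 3 * Λ then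
    [.flip (κ / 2 + 6), .search false, .settle false, .trunc (2 ^ (κ + κ / 2))]
  else []

/-- A merge costs at most six times the number of members, hence at most `n / (ℓ + 1)`; the `3 * ℓ`
merges cost `O(n)` together. -/
theorem Mass.small {κ D c : ℕ} {σ : Abs n w} (H : Large n Λ ℓ) (h : Mass N ℓ κ D c σ) :
    6 * (2 ^ κ * (leaders σ).card) * (ℓ + 1) ≤ n := by
  have h1 := h.2.2.1
  have h2 : 1000 * (ℓ + 1) ≤ 4 ^ ℓ := H.large.trans (Nat.pow_le_pow_left (by norm_num) ℓ)
  have h3 := Nat.mul_le_mul_left (2 ^ κ * (leaders σ).card) h2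
  nlinarith

/-- The loss of 8 in `D` consists of the 6 additional bits in the activation exponent and of 2 for
the factor 4 in the number of active clusters. The upper bound on the mass persists because `4 ≤ 2 ^
6`. -/
theorem hoare_mergeStep (H : Large n Λ ℓ) {κ D c : ℕ} (hκ : 100 * ℓ ≤ κ) (hD : D ≤ 27 * ℓ) :
    Hoare N Λ (Mass N ℓ κ D c) (mergeOps Λ κ) (Mass N ℓ (mergeNext Λ κ) (D + 8) (c + n / (ℓ + 1)))
      (3 * Real.exp (-4 ^ ℓ)) := by
  have hn := H.pos
  have hn' : (0 : ℝ) < n := by exact_mod_cast hn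
  have hℓ := H.one_le
  have hΛ : 1000 * (ℓ + 1) ≤ Λ := H.large.trans H.le_Λ
  have hη := Real.exp_nonneg (-4 ^ ℓ)
  unfold mergeOps mergeNext
  split_ifs with hc
  swap
  · refine (Hoare.nil fun σ h => h).mono (fun _ h => h) ?_ (by positivity)
    rintro σ ⟨h1, h2, h3, h4⟩
    exact ⟨h1, h2.trans (Nat.mul_le_mul_left _ (Nat.pow_le_pow_right (by norm_num) (by omega))),
      h3, h4.trans (Nat.le_add_right _ _)⟩
  intro σ hσ
  have hsmall := hσ.small H
  obtain ⟨h1, h2, h3, h4⟩ := hσ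
  set L := (leaders σ).card with hL
  set e := κ / 2 + 6 with he
  have hinv : (1 / 2 : ℝ) ^ e * 2 ^ e = 1 := by rw [← mul_pow]; norm_num
  -- Since `5 * κ < 3 * Λ`, the exponent `κ + κ / 2` stays below `9/10` of `Λ`; this leaves enough
  -- clusters for the activation tails.
  have hLe : 2 ^ (2 * ℓ + 2 + e) ≤ L := by
    have e1 : 2 ^ (2 * ℓ + 2 + e) * 2 ^ (κ + D) ≤ L * 2 ^ (κ + D) := by
      rw [← pow_add]
      refine (Nat.pow_le_pow_right (by norm_num) (by omega)).trans (H.le_n.trans (h2.trans ?_))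
      rw [pow_add]
      exact le_of_eq (by ring)
    exact Nat.le_of_mul_le_mul_right e1 (by positivity)
  have hLe' : (4 : ℝ) ^ ℓ ≤ L * (1 / 2) ^ e / 4 := by
    have e1 : (2 : ℝ) ^ (2 * ℓ + 2 + e) ≤ L := by exact_mod_cast hLe
    have e2 : (2 : ℝ) ^ (2 * ℓ + 2 + e) = 4 ^ ℓ * 4 * 2 ^ e := by
      rw [pow_add, pow_add, pow_mul]; norm_num
    have e3 : (4 : ℝ) ^ ℓ * 4 * 2 ^ e * (1 / 2) ^ e ≤ L * (1 / 2) ^ e := by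
      rw [← e2]; gcongr
    have e4 : (4 : ℝ) ^ ℓ * 4 * 2 ^ e * (1 / 2) ^ e = 4 ^ ℓ * 4 * ((1 / 2) ^ e * 2 ^ e) := by ring
    rw [e4, hinv] at e3
    linarith
  refine ((hoare_merge (N := N) (E := Λ) (k := 2 ^ κ) (L := L) (k' := 2 ^ (κ + κ / 2)) (e := e)
    (c := c) hn (by omega) (by omega) Nat.one_le_two_pow (by
      rw [he, Nat.add_sub_cancel, ← pow_add]) ?_).mono (P' := fun τ => τ = σ) ?_ ?_ ?_) σ rfl
  -- A cluster must be large enough to find an active one: `κ ≥ 100 * ℓ` outweighs both `e ≈ κ / 2`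
  -- and the deficit `D ≤ 27 * ℓ`.
  · have e1 : 4 * n * 2 ^ e ≤ 2 ^ κ * (2 ^ κ * L) := by
      calc 4 * n * 2 ^ e ≤ 4 * (2 ^ κ * L * 2 ^ D) * 2 ^ e := by gcongr
        _ = 2 ^ κ * L * 2 ^ (2 + D + e) := by rw [pow_add, pow_add]; ring
        _ ≤ 2 ^ κ * L * 2 ^ κ := by
          gcongr
          · norm_num
          · omega
        _ = _ := by ring
    have e2 : (4 * n * 2 ^ e : ℝ) ≤ 2 ^ κ * (2 ^ κ * L) := by exact_mod_cast e1
    have e3 := mul_le_mul_of_nonneg_right e2 (show (0 : ℝ) ≤ (1 / 2) ^ e by positivity)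
    push_cast
    calc (4 * n : ℝ) = 4 * n * ((1 / 2) ^ e * 2 ^ e) := by rw [hinv, mul_one]
      _ = 4 * n * 2 ^ e * (1 / 2) ^ e := by ring
      _ ≤ _ := e3
      _ = _ := by ring
  · rintro τ rfl
    exact ⟨h1, rfl, h4⟩
  · rintro τ ⟨g1, g2, g3, g4⟩
    refine ⟨g1, ?_, ?_, ?_⟩
    · have e1 : (L : ℝ) ≤ 4 * 2 ^ e * (leaders τ).card := by
        have := mul_le_mul_of_nonneg_left g3 (show (0 : ℝ) ≤ 4 * 2 ^ e by positivity)
        calc (L : ℝ) = L * ((1 / 2) ^ e * 2 ^ e) := by rw [hinv, mul_one]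
          _ = 4 * 2 ^ e * (L * (1 / 2) ^ e / 4) := by ring
          _ ≤ _ := this
      have e2 : L ≤ 4 * 2 ^ e * (leaders τ).card := by exact_mod_cast e1
      calc n ≤ 2 ^ κ * L * 2 ^ D := h2
        _ ≤ 2 ^ κ * (4 * 2 ^ e * (leaders τ).card) * 2 ^ D := by gcongr
        _ = _ := by rw [he, pow_add, pow_add, pow_add]; ring
    · have e1 : 2 ^ e * ((leaders τ).card : ℝ) ≤ 4 * L := by
        calc 2 ^ e * ((leaders τ).card : ℝ) ≤ 2 ^ e * (4 * L * (1 / 2) ^ e) := by gcongr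
          _ = 4 * L * ((1 / 2) ^ e * 2 ^ e) := by ring
          _ = 4 * L := by rw [hinv, mul_one]
      have e2 : 2 ^ e * (leaders τ).card ≤ 4 * L := by exact_mod_cast e1
      refine le_trans ?_ h3
      refine Nat.mul_le_mul_right _ ?_
      rw [pow_add, mul_assoc]
      refine Nat.mul_le_mul_left _ ?_
      rw [he, pow_add] at e2
      nlinarith
    · refine g2.trans (Nat.add_le_add_left ?_ c)
      rw [Nat.le_div_iff_mul_le (by omega)]
      exact hsmall
  · have e1 : Real.exp (-((L : ℝ) * (1 / 2) ^ e / 4)) ≤ Real.exp (-4 ^ ℓ) :=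
      Real.exp_le_exp.2 (neg_le_neg hLe')
    have e2 : Real.exp (-(2 * L * (1 / 2) ^ e)) ≤ Real.exp (-4 ^ ℓ) := by
      refine Real.exp_le_exp.2 (neg_le_neg (hLe'.trans ?_))
      have : (0 : ℝ) ≤ L * (1 / 2) ^ e := by positivity
      linarith
    have e3 : n * Real.exp (-(2 ^ e / 64)) ≤ Real.exp (-4 ^ ℓ) := by
      have f1 : (2 : ℝ) ^ e / 64 = 2 ^ (κ / 2) := by rw [he, pow_add]; norm_num
      have f2 : 2 ^ (2 * ℓ + 2) ≤ 2 ^ (κ / 2) := Nat.pow_le_pow_right (by norm_num) (by omega)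
      have f3 : (2 : ℝ) ^ (2 * ℓ + 2) ≤ 2 ^ (κ / 2) := by exact_mod_cast f2
      have f4 : (2 : ℝ) ^ (2 * ℓ + 2) = 4 * 4 ^ ℓ := by rw [pow_add, pow_mul]; norm_num; ring
      have f5 : (2 : ℝ) ^ ℓ ≤ 4 ^ ℓ := pow_le_pow_left₀ (by norm_num) (by norm_num) _
      rw [f1]
      refine (mul_le_mul_of_nonneg_right H.le_exp (Real.exp_nonneg _)).trans ?_
      rw [← Real.exp_add]
      refine Real.exp_le_exp.2 ?_
      linarith [pow_pos (show (0 : ℝ) < 4 by norm_num) ℓ]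
    linarith

/-- The exponents of the cluster sizes. -/
def exponent (Λ ℓ i : ℕ) : ℕ := (mergeNext Λ)^[i] (100 * ℓ)

theorem exponent_succ (Λ ℓ i : ℕ) : exponent Λ ℓ (i + 1) = mergeNext Λ (exponent Λ ℓ i) :=
  Function.iterate_succ_apply' _ _ _

theorem le_mergeNext (Λ κ : ℕ) : κ ≤ mergeNext Λ κ := by
  unfold mergeNext; split_ifs <;> omega

theorem le_exponent (Λ ℓ i : ℕ) : 100 * ℓ ≤ exponent Λ ℓ i := by
  induction i with
  | zero => exact le_rfl
  | succ i ih => rw [exponent_succ]; exact ih.trans (le_mergeNext _ _)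

/-- Despite rounding, a merge multiplies the exponent by at least `4/3`. Three merges give `64/27 >
2`, so `3 * ℓ` of them would raise it to at least `100 * ℓ * 2 ^ ℓ`, beyond `Λ`. -/
theorem exponent_large (H : Large n Λ ℓ) : 3 * Λ ≤ 5 * exponent Λ ℓ (3 * ℓ) := by
  have hℓ := H.one_le
  have h : ∀ i, 3 * Λ ≤ 5 * exponent Λ ℓ i ∨ 100 * ℓ * 4 ^ i ≤ 3 ^ i * exponent Λ ℓ i := by
    intro i
    induction i with
    | zero => right; simp [exponent]
    | succ i ih =>
      rw [exponent_succ]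
      rcases ih with ih | ih
      · left
        have := le_mergeNext Λ (exponent Λ ℓ i)
        omega
      · unfold mergeNext
        split_ifs with hc
        · right
          have h1 := le_exponent Λ ℓ i
          have h2 : 4 * exponent Λ ℓ i ≤ 3 * (exponent Λ ℓ i + exponent Λ ℓ i / 2) := by omega
          calc 100 * ℓ * 4 ^ (i + 1) = 4 * (100 * ℓ * 4 ^ i) := by ring
            _ ≤ 4 * (3 ^ i * exponent Λ ℓ i) := by gcongr
            _ = 3 ^ i * (4 * exponent Λ ℓ i) := by ring
            _ ≤ 3 ^ i * (3 * (exponent Λ ℓ i + exponent Λ ℓ i / 2)) := by gcongr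
            _ = _ := by ring
        · left; omega
  rcases h (3 * ℓ) with h | h
  · exact h
  · have h1 : 27 ^ ℓ * 2 ^ ℓ ≤ 4 ^ (3 * ℓ) := by
      rw [← mul_pow, pow_mul]
      exact Nat.pow_le_pow_left (by norm_num) ℓ
    have h2 : 27 ^ ℓ * (100 * ℓ * 2 ^ ℓ) ≤ 27 ^ ℓ * exponent Λ ℓ (3 * ℓ) := by
      calc 27 ^ ℓ * (100 * ℓ * 2 ^ ℓ) = 100 * ℓ * (27 ^ ℓ * 2 ^ ℓ) := by ring
        _ ≤ 100 * ℓ * 4 ^ (3 * ℓ) := by gcongr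
        _ ≤ _ := h
        _ = _ := by rw [pow_mul]; norm_num
    have h3 := Nat.le_of_mul_le_mul_left h2 (by positivity)
    have h4 := H.Λ_lt
    rw [pow_succ] at h4
    nlinarith [Nat.one_le_two_pow (n := ℓ)]

/-- The operations by which all clusters are merged into one. -/
def mergesOps (Λ ℓ : ℕ) : List Op :=
  ((List.range (3 * ℓ)).flatMap fun i => mergeOps Λ (exponent Λ ℓ i)) ++
    [.search true, .settle true, .trunc (2 ^ (Λ - 27 * ℓ))]

theorem hoare_merges (H : Large n Λ ℓ) {c : ℕ} :
    Hoare N Λ (Mass N ℓ (100 * ℓ) (3 * ℓ) c) (mergesOps Λ ℓ)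
      (fun σ => Uniform N (2 ^ (Λ - 27 * ℓ)) σ ∧ (leaders σ).card = 1 ∧ σ.cost ≤ c + 4 * n)
      ((9 * ℓ + 1) * Real.exp (-4 ^ ℓ)) := by
  have hn := H.pos
  have hn' : (0 : ℝ) < n := by exact_mod_cast hn
  have hℓ := H.one_le
  have hΛ : 1000 * (ℓ + 1) ≤ Λ := H.large.trans H.le_Λ
  have hη := Real.exp_nonneg (-4 ^ ℓ)
  have h1 := Hoare.loop (N := N) (E := Λ) (δ := 3 * Real.exp (-4 ^ ℓ))
    (P := fun i => Mass N ℓ (exponent Λ ℓ i) (3 * ℓ + 8 * i) (c + i * (n / (ℓ + 1))))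
    (p := fun i => mergeOps Λ (exponent Λ ℓ i)) (by positivity) (3 * ℓ) fun i hi => by
      have := hoare_mergeStep (N := N) H (c := c + i * (n / (ℓ + 1))) (le_exponent Λ ℓ i)
        (show 3 * ℓ + 8 * i ≤ 27 * ℓ by omega)
      rw [exponent_succ]
      refine this.mono (fun _ h => h) (fun σ h => ?_) le_rfl
      rw [show 3 * ℓ + 8 * (i + 1) = 3 * ℓ + 8 * i + 8 by ring,
        show c + (i + 1) * (n / (ℓ + 1)) = c + i * (n / (ℓ + 1)) + n / (ℓ + 1) by ring]
      exact h
  have hexp := exponent_large H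
  set κ := exponent Λ ℓ (3 * ℓ)
  have h2 : Hoare N Λ (Mass N ℓ κ (3 * ℓ + 8 * (3 * ℓ)) (c + 3 * ℓ * (n / (ℓ + 1))))
      [.search true, .settle true, .trunc (2 ^ (Λ - 27 * ℓ))]
      (fun σ => Uniform N (2 ^ (Λ - 27 * ℓ)) σ ∧ (leaders σ).card = 1 ∧ σ.cost ≤ c + 4 * n)
      (Real.exp (-4 ^ ℓ)) := by
    intro σ hσ
    have hsmall := hσ.small H
    obtain ⟨g1, g2, g3, g4⟩ := hσ
    set L := (leaders σ).card with hL
    have hkL : 2 ^ (Λ - 27 * ℓ) ≤ 2 ^ κ * L := by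
      have e1 : 2 ^ (Λ - 27 * ℓ) * 2 ^ (27 * ℓ) ≤ 2 ^ κ * L * 2 ^ (27 * ℓ) := by
        rw [← pow_add, Nat.sub_add_cancel (by omega)]
        refine H.le_n.trans (g2.trans (le_of_eq ?_))
        congr 2
        ring
      exact Nat.le_of_mul_le_mul_right e1 (by positivity)
    have hL1 : 1 ≤ L := by
      by_contra h0
      have : L = 0 := by omega
      rw [this, mul_zero] at hkL
      have : 0 < 2 ^ (Λ - 27 * ℓ) := by positivity
      omega
    have hcost : 5 * (2 ^ κ * L) ≤ n := by nlinarith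
    have hLn : L ≤ n := by
      have : 1 * L ≤ 2 ^ κ * L := Nat.mul_le_mul_right _ Nat.one_le_two_pow
      omega
    refine ((hoare_mergeAll (N := N) (E := Λ) (k := 2 ^ κ) (L := L) (c := σ.cost) hn hL1
      Nat.one_le_two_pow hkL).mono (P' := fun τ => τ = σ) ?_ ?_ ?_) σ rfl
    · rintro τ rfl
      exact ⟨g1, rfl, le_rfl⟩
    · rintro τ ⟨f1, f2, f3⟩
      refine ⟨f1, f2, f3.trans ?_⟩
      have : 3 * ℓ * (n / (ℓ + 1)) ≤ 3 * n := by
        have := Nat.div_mul_le_self n (ℓ + 1)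
        nlinarith
      omega
    · have e1 : (L : ℝ) ≤ Real.exp (2 * 2 ^ ℓ) := le_trans (by exact_mod_cast hLn) H.le_exp
      -- From `5 * κ ≥ 3 * Λ`, the square of the cluster size is at least `2 ^ (6 * Λ / 5)`, far
      -- above `n`; this is why merging may stop at the exponent `3/5`.
      have e2 : (8 * 4 ^ ℓ : ℝ) ≤ ((2 ^ κ : ℕ) : ℝ) * (2 ^ κ : ℕ) / n := by
        rw [le_div_iff₀ hn']
        have : 8 * 4 ^ ℓ * n ≤ 2 ^ κ * 2 ^ κ := by
          calc 8 * 4 ^ ℓ * n ≤ 8 * 4 ^ ℓ * 2 ^ (Λ + 1) := by gcongr; exact H.n_lt.le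
            _ = 2 ^ (3 + 2 * ℓ + (Λ + 1)) := by
                rw [pow_add 2 (3 + 2 * ℓ), pow_add 2 3, pow_mul]; norm_num
            _ ≤ 2 ^ (κ + κ) := Nat.pow_le_pow_right (by norm_num) (by omega)
            _ = _ := pow_add _ _ _
        exact_mod_cast this
      have f5 : (2 : ℝ) ^ ℓ ≤ 4 ^ ℓ := pow_le_pow_left₀ (by norm_num) (by norm_num) _
      calc (L : ℝ) * (L * Real.exp (-(((2 ^ κ : ℕ) : ℝ) * (2 ^ κ : ℕ) / n)))
          ≤ Real.exp (2 * 2 ^ ℓ) * (Real.exp (2 * 2 ^ ℓ) * Real.exp (-(8 * 4 ^ ℓ))) := by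
            gcongr
        _ = Real.exp (2 * 2 ^ ℓ + (2 * 2 ^ ℓ + -(8 * 4 ^ ℓ))) := by
            rw [Real.exp_add, Real.exp_add]
        _ ≤ Real.exp (-4 ^ ℓ) := by
            refine Real.exp_le_exp.2 ?_
            linarith [pow_pos (show (0 : ℝ) < 4 by norm_num) ℓ]
  refine (h1.append h2 hη).mono (fun σ h => ?_) (fun _ h => h) (le_of_eq ?_)
  · simpa [exponent] using h
  · push_cast
    ring

/-- A single cluster grows. -/
theorem hoare_growOne {p : ℝ} {B : ℕ} (hn : 0 < n) (hB : 1 ≤ B)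
    (hr : 17 + Real.log B ≤ p / 2 * (B - 1)) (hF : (N.failed.card : ℝ) ≤ (1 - p) * n)
    (a J c : ℕ) (hsize : (1 + B) * (2 : ℝ) ^ (a + J) ≤ p / 2 * n) :
    Hoare N Λ (fun σ => Uniform N (2 ^ a) σ ∧ (leaders σ).card = 1 ∧ σ.cost ≤ c)
      ((List.range J).flatMap fun j => grow B (2 ^ (a + j)))
      (fun σ => Uniform N (2 ^ (a + J)) σ ∧ (leaders σ).card = 1 ∧
        σ.cost ≤ c + (3 * B + 2) * 2 ^ (a + J)) (J * (2 * Real.exp (-2 ^ a))) := by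
  refine (Hoare.loop (N := N) (E := Λ) (P := fun j σ => Uniform N (2 ^ (a + j)) σ ∧
    (leaders σ).card = 1 ∧ σ.cost ≤ c + (3 * B + 2) * 2 ^ (a + j))
    (δ := 2 * Real.exp (-2 ^ a)) (by positivity) J fun j hj => ?_).mono ?_ (fun _ h => h) le_rfl
  -- With `L = 1` and `s = 1` the conclusion says that the only cluster is not lost.
  · refine (hoare_grow (N := N) (E := Λ) hn (Nat.one_le_two_pow (n := a + j)) (L := 1)
      (c := c + (3 * B + 2) * 2 ^ (a + j)) (s := 1) hB hr ?_).mono (fun _ h => h) ?_ ?_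
    · push_cast
      have : (2 : ℝ) ^ (a + j) ≤ 2 ^ (a + J) :=
        pow_le_pow_right₀ (by norm_num) (by omega)
      have : (1 + B : ℝ) * (2 ^ (a + j) * 1) ≤ (1 + B) * 2 ^ (a + J) := by
        rw [mul_one]; gcongr
      linarith
    · rintro τ ⟨g1, g2, g3, g4⟩
      refine ⟨by rw [← add_assoc, pow_succ, mul_comm]; exact g1, by omega, g4.trans ?_⟩
      rw [← add_assoc, pow_succ]
      exact le_of_eq (by ring)
    · rw [pow_one]
      gcongr
      have : (2 : ℝ) ^ a ≤ 2 ^ (a + j) := pow_le_pow_right₀ (by norm_num) (by omega)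
      push_cast
      linarith [pow_pos (show (0 : ℝ) < 2 by norm_num) (a + j)]
  · rintro σ ⟨h1, h2, h3⟩
    exact ⟨h1, h2, h3.trans (Nat.le_add_right _ _)⟩

end Merges

/-! ### The whole program -/

section Program

variable {n w Λ ℓ : ℕ} {N : Network n w}

/-- The operations by which the remaining nodes join. -/
def joinOps (J₁ J₂ J₃ : ℕ) : List Op :=
  .replicate J₁ .join ++ (.replicate J₂ .join ++ ([.join] ++ .replicate J₃ .join))

/-- The program that builds the cluster. -/
def program (B h r C Λ ℓ : ℕ) : List Op :=
  startOps B ℓ ++ (mergesOps Λ ℓ ++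
    (((List.range (27 * ℓ - h)).flatMap fun j => grow B (2 ^ (Λ - 27 * ℓ + j))) ++
      ([.crown] ++ joinOps (r * ℓ) (ℓ + 1) (2 * C + 8))))

theorem length_flatMap_le {f : ℕ → List Op} {k : ℕ} (m : ℕ) (h : ∀ j, (f j).length ≤ k) :
    ((List.range m).flatMap f).length ≤ m * k := by
  induction m with
  | zero => simp
  | succ m ih =>
    rw [List.range_succ, List.flatMap_append, List.flatMap_singleton, List.length_append, add_mul,
      one_mul]
    exact add_le_add ih (h m)

theorem length_program_le (B h r C Λ : ℕ) (hℓ : 1 ≤ ℓ) :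
    (program B h r C Λ ℓ).length ≤ (127 * (B + 1) + r + 2 * C + 30) * ℓ := by
  have h1 := length_flatMap_le (f := fun j => grow B (2 ^ j)) (k := B + 1) (100 * ℓ)
    fun j => by simp [grow]
  have h2 := length_flatMap_le (f := fun i => mergeOps Λ (exponent Λ ℓ i)) (k := 4) (3 * ℓ)
    fun j => by unfold mergeOps; split_ifs <;> simp
  have h3 := length_flatMap_le (f := fun j => grow B (2 ^ (Λ - 27 * ℓ + j))) (k := B + 1)
    (27 * ℓ - h) fun j => by simp [grow]
  have h4 : (27 * ℓ - h) * (B + 1) ≤ 27 * ℓ * (B + 1) := Nat.mul_le_mul_right _ (Nat.sub_le _ _)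
  simp only [program, startOps, mergesOps, joinOps, List.length_append, List.length_cons,
    List.length_nil, List.length_replicate]
  nlinarith

theorem share_notMem_program (B h r C Λ ℓ : ℕ) : Op.share ∉ program B h r C Λ ℓ := by
  simp only [program, startOps, mergesOps, joinOps, grow, mergeOps, List.mem_append,
    List.mem_flatMap, List.mem_replicate, List.mem_cons, List.not_mem_nil, reduceCtorEq]
  simp only [and_false, or_false, false_or, exists_false, not_exists, not_and]
  intro i _
  split_ifs <;> simp

theorem schedule_le (r C : ℕ) (hℓ : 1 ≤ ℓ) :
    165 * ℓ + r * ℓ + 2 * C + 10 ≤ (r + C + 200) * (ℓ + 1) := by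
  nlinarith

/-- The share of the surviving nodes that may be missed, relative to the failed nodes. -/
noncomputable def missRate (ℓ : ℕ) : ℝ := 8 / 4 ^ ℓ + 2 / 2 ^ ℓ

/-- Here `p` is a lower bound for the fraction of survivors; `h` makes growth stop while enough free
nodes remain, and `r` rounds of joining divide the outsiders by 4. The final phase uses `t = 4 ^ ℓ`,
`M = n / 4 ^ ℓ` and `T = 8 ^ ℓ`, whence the two terms of `missRate`. The figure 27 is `3 + 8 * 3`:
the initial deficit and 8 per merge. -/
theorem hoare_program (H : Large n Λ ℓ) {p : ℝ} {B h r C : ℕ} (hp0 : 0 < p) (hB : 1 ≤ B)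
    (hr : 17 + Real.log B ≤ p / 2 * (B - 1)) (hF : (N.failed.card : ℝ) ≤ (1 - p) * n)
    (hpB : 8 * (3 * B + 2) ≤ p * 2 ^ ℓ) (hh : 2 * (1 + B) ≤ p * 2 ^ h)
    (hrh : (1 - (1 / 2) ^ (h + 1) / 4 : ℝ) ^ r ≤ 1 / 4) (hhℓ : h ≤ ℓ)
    (hrC : (r + C + 200) * (ℓ + 1) ≤ 2 ^ ℓ) :
    Hoare N Λ (fun σ => σ = Abs.init n w) (program B h r C Λ ℓ)
      (fun σ => Clustered N σ ∧
        ((outsiders N σ).card : ℝ) ≤ missRate ℓ * N.failed.card ∧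
        (σ.cost : ℝ) ≤ (3 * B + 9 + 4 / (1 / 2) ^ (h + 1)) * n) (1 / n ^ C) := by
  have hn := H.pos
  have hn' : (0 : ℝ) < n := by exact_mod_cast hn
  have hℓ := H.one_le
  have hΛ : 1000 * (ℓ + 1) ≤ Λ := H.large.trans H.le_Λ
  have hη := Real.exp_nonneg (-4 ^ ℓ)
  have h4 : (0 : ℝ) < 4 ^ ℓ := by positivity
  have hx : (4 : ℝ) ^ ℓ = 2 ^ ℓ * 2 ^ ℓ := by rw [← mul_pow]; norm_num
  have hpow : ∀ m : ℕ, m ≤ Λ → (2 : ℝ) ^ m ≤ n := fun m hm => by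
    exact_mod_cast (Nat.pow_le_pow_right (by norm_num) hm).trans H.le_n
  have hbound := (schedule_le r C hℓ).trans hrC
  set q : ℝ := (1 / 2) ^ (h + 1) with hq
  have hq0 : 0 < q := by positivity
  have hq1 : q ≤ 1 := pow_le_one₀ (by norm_num) (by norm_num)
  have hinv : q * 2 ^ (h + 1) = 1 := by rw [hq, ← mul_pow]; norm_num
  have hs1 := hoare_start (N := N) (w := w) H hp0 hB hr hF hpB
  have hs2 := hoare_merges (N := N) H (c := n)
  have hs3 := hoare_growOne (N := N) (Λ := Λ) hn hB hr hF (Λ - 27 * ℓ) (27 * ℓ - h) (n + 4 * n) (by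
    rw [show Λ - 27 * ℓ + (27 * ℓ - h) = Λ - h by omega]
    have e1 : (2 : ℝ) ^ (Λ - h) * 2 ^ h ≤ n := by
      rw [← pow_add]
      exact hpow _ (by omega)
    have e2 := mul_le_mul_of_nonneg_right hh (show (0 : ℝ) ≤ 2 ^ (Λ - h) by positivity)
    nlinarith)
  rw [show Λ - 27 * ℓ + (27 * ℓ - h) = Λ - h by omega] at hs3
  have hs4 : Hoare N Λ (fun σ => Uniform N (2 ^ (Λ - h)) σ ∧ (leaders σ).card = 1 ∧
      σ.cost ≤ n + 4 * n + (3 * B + 2) * 2 ^ (Λ - h)) [.crown]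
      (fun σ => Clustered N σ ∧ q * n ≤ (members σ).card ∧ (σ.cost : ℝ) ≤ (3 * B + 8) * n) 0 := by
    refine Hoare.sure fun σ ⟨g1, g2, g3⟩ x => ?_
    obtain ⟨f1, f2, f3⟩ := crown_spec (x := x) g1 g2
    refine ⟨f1, ?_, ?_⟩
    · refine le_trans ?_ (Nat.cast_le.2 f2)
      have e1 : (n : ℝ) ≤ 2 ^ (Λ + 1) := by exact_mod_cast H.n_lt.le
      have e2 : (2 : ℝ) ^ (Λ + 1) = 2 ^ (Λ - h) * 2 ^ (h + 1) := by
        rw [← pow_add]; congr 1; omega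
      push_cast
      calc q * n ≤ q * (2 ^ (Λ - h) * 2 ^ (h + 1)) := by rw [← e2]; gcongr
        _ = 2 ^ (Λ - h) * (q * 2 ^ (h + 1)) := by ring
        _ = 2 ^ (Λ - h) := by rw [hinv, mul_one]
    · rw [f3]
      have e1 := hpow (Λ - h) (by omega)
      have e2 : (σ.cost : ℝ) ≤ n + 4 * n + (3 * B + 2) * 2 ^ (Λ - h) := by exact_mod_cast g3
      have e3 : (3 * B + 2 : ℝ) * 2 ^ (Λ - h) ≤ (3 * B + 2) * n := by gcongr
      push_cast
      linarith
  -- The polylogarithmic numerator is at most the square root of `n`, so every two rounds gain a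
  -- factor `n`; this explains the number `2 * C + 8` of last rounds.
  have hy : (n : ℝ) * ((2 * 8 ^ ℓ + 2 * 4 ^ ℓ) / n) ^ (2 * C + 8) ≤ 1 / (2 * n ^ C) := by
    have e1 : (2 : ℝ) * 8 ^ ℓ + 2 * 4 ^ ℓ ≤ 4 * 8 ^ ℓ := by
      have : (4 : ℝ) ^ ℓ ≤ 8 ^ ℓ := pow_le_pow_left₀ (by norm_num) (by norm_num) _
      linarith
    have e2 : ((2 : ℝ) * 8 ^ ℓ + 2 * 4 ^ ℓ) ^ 2 ≤ n := by
      calc ((2 : ℝ) * 8 ^ ℓ + 2 * 4 ^ ℓ) ^ 2 ≤ (4 * 8 ^ ℓ) ^ 2 := by gcongr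
        _ = 2 ^ (4 + 6 * ℓ) := by
          rw [pow_add, pow_mul, mul_pow, ← pow_mul, mul_comm ℓ 2, pow_mul]; norm_num
        _ ≤ n := hpow _ (by omega)
    have e3 : (((2 : ℝ) * 8 ^ ℓ + 2 * 4 ^ ℓ) / n) ^ 2 ≤ 1 / n := by
      rw [div_pow, div_le_div_iff₀ (by positivity) hn']
      nlinarith
    have e4 : (n : ℝ) ≥ 2 := by
      have := hpow 1 (by omega)
      linarith
    calc (n : ℝ) * ((2 * 8 ^ ℓ + 2 * 4 ^ ℓ) / n) ^ (2 * C + 8)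
        = n * (((2 * 8 ^ ℓ + 2 * 4 ^ ℓ) / n) ^ 2) ^ (C + 4) := by rw [← pow_mul]; ring_nf
      _ ≤ n * (1 / n) ^ (C + 4) := by gcongr
      _ = 1 / (n ^ 3 * n ^ C) := by
        rw [one_div, inv_pow, show (n : ℝ) ^ (C + 4) = n * (n ^ 3 * n ^ C) by ring]
        field_simp
      _ ≤ 1 / (2 * n ^ C) := by
        gcongr
        nlinarith [sq_nonneg (n : ℝ)]
  have hs5 := hoare_joins (N := N) (E := Λ) (c := (3 * B + 8) * n) (q := q) (t := 4 ^ ℓ)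
    (M := n / 4 ^ ℓ) (J₁ := r * ℓ) (J₂ := ℓ + 1) (J₃ := 2 * C + 8) (T := 8 ^ ℓ)
    (δ := 1 / (2 * n ^ C)) hn hq0 hq1 h4.le (by
      have e1 : (1 - q / 4) ^ (r * ℓ) ≤ (1 / 4) ^ ℓ := by
        rw [pow_mul]
        refine pow_le_pow_left₀ (pow_nonneg (by linarith) _) hrh _
      calc (1 - q / 4) ^ (r * ℓ) * n ≤ (1 / 4) ^ ℓ * n := by gcongr
        _ = n / 4 ^ ℓ := by rw [one_div, inv_pow]; field_simp) (by
      rw [div_le_div_iff₀ hq0 h4]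
      have e1 : (2 : ℝ) ^ (2 + 4 * ℓ + (h + 1)) ≤ n := hpow _ (by omega)
      have e2 : (2 : ℝ) ^ (2 + 4 * ℓ + (h + 1)) = 4 * 4 ^ ℓ * 4 ^ ℓ * 2 ^ (h + 1) := by
        rw [pow_add, pow_add, mul_assoc 4, ← mul_pow, pow_mul]; norm_num
      rw [e2] at e1
      have e3 := mul_le_mul_of_nonneg_right e1 hq0.le
      calc (4 : ℝ) * 4 ^ ℓ * 4 ^ ℓ = 4 * 4 ^ ℓ * 4 ^ ℓ * (q * 2 ^ (h + 1)) := by rw [hinv, mul_one]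
        _ = 4 * 4 ^ ℓ * 4 ^ ℓ * 2 ^ (h + 1) * q := by ring
        _ ≤ _ := e3) (by
      rw [mul_div_assoc', div_le_iff₀ h4, mul_comm]
      gcongr
      have : (1000 : ℝ) * (ℓ + 1) ≤ 2 ^ ℓ := by exact_mod_cast H.large
      nlinarith [ℓ.cast_nonneg (α := ℝ)]) (by
      refine H.n_lt.trans_le (Nat.pow_le_pow_right (by norm_num) ?_)
      exact H.Λ_lt) (by positivity) (by positivity) hy
  refine (hs1.append (hs2.append (hs3.append (hs4.append hs5 (by positivity)) (by positivity))
    (by positivity)) (by positivity)).mono (fun _ h => h) ?_ ?_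
  · rintro σ ⟨g1, g2, g3⟩
    refine ⟨g1, g2.trans (le_of_eq ?_), g3.trans ?_⟩
    · congr 1
      rw [missRate]
      congr 1
      · field_simp
      · rw [show (8 : ℝ) = 4 * 2 by norm_num, mul_pow]
        field_simp
    · have e1 : ((r * ℓ : ℕ) + (ℓ + 1 : ℕ) + 1 + (2 * C + 8 : ℕ) : ℝ) ≤ 4 ^ ℓ := by
        have e2 : r * ℓ + (ℓ + 1) + 1 + (2 * C + 8) ≤ 2 ^ ℓ := by omega
        have e3 : ((r * ℓ + (ℓ + 1) + 1 + (2 * C + 8) : ℕ) : ℝ) ≤ 2 ^ ℓ := by exact_mod_cast e2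
        have : (2 : ℝ) ^ ℓ ≤ 4 ^ ℓ := pow_le_pow_left₀ (by norm_num) (by norm_num) _
        push_cast at e3 ⊢
        linarith
      have e2 : ((r * ℓ : ℕ) + (ℓ + 1 : ℕ) + 1 + (2 * C + 8 : ℕ) : ℝ) * (n / 4 ^ ℓ) ≤ n := by
        calc ((r * ℓ : ℕ) + (ℓ + 1 : ℕ) + 1 + (2 * C + 8 : ℕ) : ℝ) * (n / 4 ^ ℓ)
            ≤ 4 ^ ℓ * (n / 4 ^ ℓ) := by gcongr
          _ = n := by field_simp
      have e3 : 4 * n / q = 4 / q * n := by ring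
      rw [e3]
      linarith
  · have e1 : Real.exp (-2 ^ (Λ - 27 * ℓ)) ≤ Real.exp (-4 ^ ℓ) := by
      refine Real.exp_le_exp.2 (neg_le_neg ?_)
      have : (4 : ℝ) ^ ℓ = 2 ^ (2 * ℓ) := by rw [pow_mul]; norm_num
      rw [this]
      exact pow_le_pow_right₀ (by norm_num) (by omega)
    have e2 : ((27 * ℓ - h : ℕ) : ℝ) * (2 * Real.exp (-2 ^ (Λ - 27 * ℓ))) ≤
        27 * ℓ * (2 * Real.exp (-4 ^ ℓ)) := by
      gcongr
      exact_mod_cast Nat.sub_le _ _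
    have e3 : (2 : ℝ) ^ ℓ * Real.exp (-4 ^ ℓ) ≤ 1 / (2 * n ^ C) := by
      have f1 : (n : ℝ) ^ C ≤ Real.exp (C * (2 * 2 ^ ℓ)) := by
        rw [Real.exp_nat_mul]
        exact pow_le_pow_left₀ hn'.le H.le_exp C
      have f2 : (2 : ℝ) ^ ℓ ≤ Real.exp (2 ^ ℓ - 1) := by
        have := Real.add_one_le_exp ((2 : ℝ) ^ ℓ - 1)
        linarith
      have f3 : (2 : ℝ) ≤ Real.exp 1 := by linarith [Real.add_one_le_exp (1 : ℝ)]
      have f4 : (2 * C + 2 : ℝ) ≤ 2 ^ ℓ := by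
        have : 2 * C + 2 ≤ 2 ^ ℓ := by omega
        exact_mod_cast this
      rw [le_div_iff₀ (by positivity)]
      calc (2 : ℝ) ^ ℓ * Real.exp (-4 ^ ℓ) * (2 * n ^ C)
          ≤ Real.exp (2 ^ ℓ - 1) * Real.exp (-4 ^ ℓ) *
            (Real.exp 1 * Real.exp (C * (2 * 2 ^ ℓ))) := by gcongr
        _ = Real.exp (2 ^ ℓ - 1 + -4 ^ ℓ + (1 + C * (2 * 2 ^ ℓ))) := by
          rw [Real.exp_add, Real.exp_add, Real.exp_add]
        _ ≤ 1 := by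
          refine Real.exp_le_one_iff.2 ?_
          rw [hx]
          have : (0 : ℝ) < 2 ^ ℓ := by positivity
          nlinarith
    -- This counts the terms `exp (-4 ^ ℓ)` from the start, the merges, the growth of the single
    -- cluster and the joins.
    have e4 : ((2 + 100 * ℓ) + (9 * ℓ + 1) + 54 * ℓ + (r * ℓ + (ℓ + 1) + 1) : ℝ) ≤ 2 ^ ℓ := by
      have : (2 + 100 * ℓ) + (9 * ℓ + 1) + 54 * ℓ + (r * ℓ + (ℓ + 1) + 1) ≤
          2 ^ ℓ := by omega
      exact_mod_cast this
    have e5 := mul_le_mul_of_nonneg_right e4 hη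
    have e6 : (1 : ℝ) / n ^ C = 1 / (2 * n ^ C) + 1 / (2 * n ^ C) := by field_simp; norm_num
    rw [e6]
    push_cast
    linarith

end Program

/-! ### Choice of parameters, and asymptotics of iterated logarithms -/

section Parameters

/-- Taking `B = m ^ 2` bounds the logarithm linearly in `m`, while the right-hand side is quadratic.
-/
theorem exists_contacts {p : ℝ} (hp0 : 0 < p) (hp1 : p ≤ 1) :
    ∃ B : ℕ, 1 ≤ B ∧ 17 + Real.log B ≤ p / 2 * (B - 1) := by
  obtain ⟨m, hm⟩ := exists_nat_ge (40 / p)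
  have h1 : 40 ≤ p * m := by
    rw [div_le_iff₀ hp0] at hm
    linarith
  have h2 : (40 : ℝ) ≤ m := by nlinarith [m.cast_nonneg (α := ℝ)]
  have h3 : 1 ≤ m := by
    have : (1 : ℝ) ≤ m := by linarith
    exact_mod_cast this
  refine ⟨m ^ 2, Nat.one_le_pow _ _ h3, ?_⟩
  push_cast
  rw [Real.log_pow]
  have h4 := Real.log_le_sub_one_of_pos (show (0 : ℝ) < m by linarith)
  have h5 := mul_le_mul_of_nonneg_right h1 (show (0 : ℝ) ≤ m by linarith)
  push_cast
  nlinarith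

theorem eventually_mul_le_two_pow (A : ℕ) : ∀ᶠ ℓ : ℕ in atTop, A * (ℓ + 1) ≤ 2 ^ ℓ := by
  have h := tendsto_pow_const_div_const_pow_of_one_lt 1 (show (1 : ℝ) < 2 by norm_num)
  have h1 := h.eventually (gt_mem_nhds (show (0 : ℝ) < 1 / (2 * A + 1) by positivity))
  filter_upwards [h1, eventually_ge_atTop 1] with ℓ hℓ hℓ1
  rw [pow_one, div_lt_div_iff₀ (by positivity) (by positivity), one_mul] at hℓ
  have h2 : ℓ * (2 * A + 1) < 2 ^ ℓ := by exact_mod_cast hℓ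
  nlinarith

theorem tendsto_log_two : Tendsto (Nat.log 2) atTop atTop :=
  tendsto_atTop.2 fun b => (eventually_ge_atTop (2 ^ b)).mono fun n hn =>
    Nat.le_log_of_pow_le (by norm_num) hn

theorem tendsto_log_log_two : Tendsto (fun n => Nat.log 2 (Nat.log 2 n)) atTop atTop :=
  tendsto_log_two.comp tendsto_log_two

theorem tendsto_missRate : Tendsto missRate atTop (𝓝 0) := by
  have h : ∀ c b : ℝ, 1 < b → Tendsto (fun ℓ : ℕ => c / b ^ ℓ) atTop (𝓝 0) := fun c b hb =>
    tendsto_const_nhds.div_atTop (tendsto_pow_atTop_atTop_of_one_lt hb)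
  have h1 := (h 8 4 (by norm_num)).add (h 2 2 (by norm_num))
  rwa [add_zero] at h1

theorem large_log {n : ℕ}
    (h : 1000 * (Nat.log 2 (Nat.log 2 n) + 1) ≤ 2 ^ Nat.log 2 (Nat.log 2 n)) :
    Large n (Nat.log 2 n) (Nat.log 2 (Nat.log 2 n)) := by
  have h1 : Nat.log 2 n ≠ 0 := by
    intro h0
    simp [h0] at h
  have h2 : n ≠ 0 := by
    rintro rfl
    simp at h1
  exact ⟨Nat.pow_log_le_self 2 h2, Nat.lt_pow_succ_log_self (by norm_num) n,
    Nat.pow_log_le_self 2 h1, Nat.lt_pow_succ_log_self (by norm_num) _, h⟩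

/-- One factor 2 comes from `log 2 ≥ 1/2`, the other from `ℓ - 1 ≥ ℓ / 2`. -/
theorem Large.le_log_log {n Λ ℓ : ℕ} (H : Large n Λ ℓ) :
    (ℓ : ℝ) ≤ 4 * Real.log (Real.log n) := by
  have hℓ := H.one_le
  have hlog2 : (1 / 2 : ℝ) ≤ Real.log 2 := by linarith [Real.log_two_gt_d9]
  have h1 : (Λ : ℝ) * Real.log 2 ≤ Real.log n := by
    rw [← Real.log_pow]
    exact Real.log_le_log (by positivity) (by exact_mod_cast H.le_n)
  have h2 : (2 : ℝ) ^ ℓ ≤ Λ := by exact_mod_cast H.le_Λ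
  have h3 : (2 : ℝ) ^ ℓ * (1 / 2) ≤ Real.log n := by nlinarith [Λ.cast_nonneg (α := ℝ)]
  have h4 := Real.log_le_log (by positivity) h3
  rw [Real.log_mul (by positivity) (by norm_num), Real.log_pow, one_div, Real.log_inv] at h4
  have h5 : (2 : ℝ) ≤ ℓ := by
    have : 2 ≤ ℓ := by
      by_contra hlt
      have h6 : ℓ = 1 := by omega
      have h7 := H.large
      rw [h6] at h7
      norm_num at h7
    exact_mod_cast this
  nlinarith

end Parameters
end Gossip
/-- For every exponent `C` of the failure probability and every tolerated fraction `γ < 1` of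
crashed nodes there is a gossip algorithm (the nodes know `n` and the length `w` of the IDs), which
knows neither the length of the rumor nor the constants `κ`, `c` below. For IDs of `O(log n)` bits
and rumors of `b = Ω(log n)` bits it runs in `O(log log n)` rounds, and with probability at least
`1 - n ^ (-C)` it spreads the rumor to all nodes with `O(n)` messages and `O(n b)` bits; moreover it
is fault-tolerant. -/
theorem mainTheorem1 (C : ℕ) (γ : ℝ) (hγ₀ : 0 ≤ γ) (hγ₁ : γ < 1) :
    ∃ A : (n w : ℕ) → Gossip.Algorithm w,
      ∀ κ c : ℝ, 0 < c →
        ∃ (K : ℝ) (ε : ℕ → ℝ), Tendsto ε atTop (𝓝 0) ∧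
          ∀ᶠ n : ℕ in atTop, ∀ w : ℕ, (w : ℝ) ≤ κ * Real.logb 2 n →
            ∀ id : Fin n ↪ BitVec w,
              ((A n w).rounds : ℝ) ≤ K * Real.log (Real.log n) ∧
              Gossip.Broadcasts id (A n w) K (c * Real.logb 2 n) (1 / (n : ℝ) ^ C) ∧
              Gossip.FaultTolerant id (A n w) K (c * Real.logb 2 n) (1 / (n : ℝ) ^ C) γ (ε n) := by
  have hp0 : 0 < 1 - γ := by linarith
  obtain ⟨B, hB, hr⟩ := Gossip.exists_contacts hp0 (by linarith)
  -- A cluster of size at most `n / 2 ^ h` and all its `B` rounds of invitations then block at most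
  -- half of the guaranteed survivors.
  obtain ⟨h, hh⟩ := pow_unbounded_of_one_lt (2 * (1 + B) / (1 - γ)) (show (1 : ℝ) < 2 by norm_num)
  rw [div_lt_iff₀ hp0] at hh
  have hq0 : (0 : ℝ) < (1 / 2) ^ (h + 1) := by positivity
  have hq1 : (1 / 2 : ℝ) ^ (h + 1) ≤ 1 := pow_le_one₀ (by norm_num) (by norm_num)
  obtain ⟨r, hrh⟩ := exists_pow_lt_of_lt_one (show (0 : ℝ) < 1 / 4 by norm_num)
    (show (1 - (1 / 2) ^ (h + 1) / 4 : ℝ) < 1 by linarith)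
  -- The program depends only on `n`, `C` and `γ`; the constants `κ` and `c` enter only through `K`.
  -- The `Nat.log 2 n` coins per operation suffice for every election and activation exponent.
  refine ⟨fun n w => Gossip.alg
    (Gossip.program B h r C (Nat.log 2 n) (Nat.log 2 (Nat.log 2 n)) ++ [.share]) (Nat.log 2 n) w,
    fun κ c hc => ?_⟩
  set D : ℝ := |κ| / c with hD
  have hD0 : 0 ≤ D := by positivity
  -- The 31 is the 30 of `length_program_le` plus the final `share`; the 8 combines two rounds per
  -- operation with the 4 of `Large.le_log_log`.
  set R : ℝ := (127 * (B + 1) + r + 2 * C + 31) * 8 with hR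
  have hR0 : 0 ≤ R := by positivity
  set K₁ : ℝ := 3 * B + 9 + 4 / (1 / 2) ^ (h + 1) + R with hK₁
  have hK₁0 : 0 ≤ K₁ := by positivity
  refine ⟨2 * (K₁ + 2) * (2 + 2 * D), fun n => Gossip.missRate (Nat.log 2 (Nat.log 2 n)),
    Gossip.tendsto_missRate.comp Gossip.tendsto_log_log_two, ?_⟩
  obtain ⟨A, hA⟩ := exists_nat_ge (8 * (3 * B + 2) / (1 - γ))
  rw [div_le_iff₀ hp0] at hA
  filter_upwards [Gossip.tendsto_log_log_two.eventually (Gossip.eventually_mul_le_two_pow 1000),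
    Gossip.tendsto_log_log_two.eventually (Gossip.eventually_mul_le_two_pow A),
    Gossip.tendsto_log_log_two.eventually (Gossip.eventually_mul_le_two_pow (r + C + 200)),
    Gossip.tendsto_log_log_two.eventually (eventually_ge_atTop h)] with n hn1 hn2 hn3 hn4 w hw id
  have H := Gossip.large_log hn1
  set Λ := Nat.log 2 n
  set ℓ := Nat.log 2 Λ
  have hn := H.pos
  have hn' : (0 : ℝ) < n := by exact_mod_cast hn
  have hloglog := H.le_log_log
  have hℓ : (1 : ℝ) ≤ ℓ := by exact_mod_cast H.one_le
  have hpB : 8 * (3 * B + 2) ≤ (1 - γ) * 2 ^ ℓ := by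
    have h1 : A ≤ 2 ^ ℓ := le_trans (Nat.le_mul_of_pos_right A (Nat.succ_pos ℓ)) hn2
    have h2 : (A : ℝ) ≤ 2 ^ ℓ := by exact_mod_cast h1
    nlinarith
  have hlog : 0 < Real.logb 2 n := by
    refine Real.logb_pos (by norm_num) ?_
    have h1 : 2 ^ 1 ≤ n := (Nat.pow_le_pow_right (by norm_num)
      ((Nat.one_le_two_pow).trans H.le_Λ)).trans H.le_n
    have h2 : (2 : ℝ) ≤ n := by exact_mod_cast h1
    linarith
  have hlen : ∀ b : ℕ, c * Real.logb 2 n ≤ b → 1 ≤ b ∧ (w : ℝ) ≤ D * b := by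
    intro b hb
    have h1 : 0 < c * Real.logb 2 n := by positivity
    refine ⟨?_, ?_⟩
    · have : (0 : ℝ) < b := h1.trans_le hb
      exact_mod_cast this
    · calc (w : ℝ) ≤ κ * Real.logb 2 n := hw
        _ ≤ |κ| * Real.logb 2 n := by gcongr; exact le_abs_self κ
        _ = D * (c * Real.logb 2 n) := by rw [hD]; field_simp
        _ ≤ D * b := by gcongr
  have hfail : ∀ failed : Finset (Fin n), (failed.card : ℝ) ≤ γ * n →
      Gossip.fail ⟨id, failed⟩ Λ (Gossip.program B h r C Λ ℓ) (Gossip.Abs.init n w)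
        (Gossip.Final ⟨id, failed⟩ K₁ (Gossip.missRate ℓ)) ≤ 1 / (n : ℝ) ^ C := by
    intro failed hF
    refine (Gossip.hoare_program (N := ⟨id, failed⟩) (w := w) H hp0 hB hr ?_ hpB ?_ hrh.le hn4
      hn3).mono (fun _ h => h) ?_ le_rfl _ rfl
    · change (failed.card : ℝ) ≤ _
      linarith
    · linarith
    · rintro σ ⟨⟨-, u, hu⟩, h2, h3⟩
      refine ⟨u, hu, h2, h3.trans ?_⟩
      gcongr
      linarith
  refine ⟨?_, ?_, ?_⟩
  · have h1 := Gossip.length_program_le B h r C Λ H.one_le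
    have h2 : ((Gossip.program B h r C Λ ℓ).length : ℝ) ≤
        (127 * (B + 1) + r + 2 * C + 30) * ℓ := by exact_mod_cast h1
    have h3 : ((((Gossip.program B h r C Λ ℓ) ++ [Gossip.Op.share]).length * 2 : ℕ) : ℝ) ≤
        R * Real.log (Real.log n) := by
      rw [List.length_append]
      push_cast
      have h4 : (0 : ℝ) ≤ 127 * (B + 1) + r + 2 * C + 31 := by positivity
      have h5 := mul_le_mul_of_nonneg_left hloglog h4
      simp only [List.length_cons, List.length_nil]
      push_cast
      rw [hR]
      nlinarith
    refine h3.trans (mul_le_mul_of_nonneg_right ?_ (by linarith))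
    have h6 : R ≤ K₁ := by
      rw [hK₁]
      have : (0 : ℝ) ≤ 3 * B + 9 + 4 / (1 / 2) ^ (h + 1) := by positivity
      linarith
    nlinarith
  · refine Gossip.broadcasts_of_fail hn (Gossip.share_notMem_program _ _ _ _ _ _) hK₁0 hD0 hlen
      (ε := Gossip.missRate ℓ) (hfail ∅ ?_)
    simp only [Finset.card_empty, Nat.cast_zero]
    positivity
  · exact Gossip.faultTolerant_of_fail hn (Gossip.share_notMem_program _ _ _ _ _ _) hK₁0 hD0 hlen
      hfail
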